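/- Let $d\ge 2$, $\zeta\in[1,2]^d$ and $r\in(0,1]$. For $k\in\mathbb R^d$ put $|k|_\zeta^2=\sum_{j=1}^d\zeta_j|k^{(j)}|^2$ and $\gamma_k=(1+|k|_\zeta^2)^r$. For $\nu,\lambda>0$ put $T_{\mathrm{kin}}=\lambda^{-2}$ and $\varrho=\nu T_{\mathrm{kin}}=\nu\lambda^{-2}$. For $k=k_1-k_2+k_3$ write $$\Omega=|k_1|_\zeta^2-|k_2|_\zeta^2+|k_3|_\zeta^2-|k|_\zeta^2,\qquad \Gamma_\pm=\pm\gamma_k+\gamma_{k_1}+\gamma_{k_2}+\gamma_{k_3}.$$ Let $f_j(\cdot,t)$, $j=1,2,3$, be real-valued Schwartz functions on $\mathbb R^d$, uniformly in $t\in[0,1]$ (each Schwartz seminorm is bounded uniformly in $t\in[0,1]$), and set $$\mathscr S_1(k,t)=4\int_{k=k_1-k_2+k_3}\frac{\nu^{-1}\Gamma_-}{\Gamma_-^2+(\nu^{-1}\Omega)^2}\prod_{j=1}^3f_j(k_j,t)\,dk_1\,dk_3,$$ $$\mathscr S_2(k,t,\tau)=4\int_{k=k_1-k_2+k_3}\mathrm{Re}\Big(\frac{\nu^{-1}e^{iT_{\mathrm{kin}}\Omega\tau}}{\Gamma_--i\nu^{-1}\Omega}\Big)e^{-\varrho\Gamma_+\tau}\prod_{j=1}^3f_j(k_j,t)\,dk_1\,dk_3,$$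 $$\mathcal K_1(\phi_1,\phi_2,\phi_3)(k)=\int_{k=k_1-k_2+k_3}4\pi\,\delta_{\mathbb R}(\Omega)\prod_{j=1}^3\phi_j(k_j)\,dk_1\,dk_3,$$ where $\int\delta_{\mathbb R}(\Omega)F$ denotes the common limit, as $\varepsilon\to0^+$, of $\int\varepsilon^{-1}\rho(\Omega/\varepsilon)F$ over all $\rho\in C_c(\mathbb R)$ with $\int\rho=1$. Theorem. There is $\theta\in(0,1)$, depending only on $d,\zeta,r$, such that for every $c_0>0$ there is a constant $C>0$, depending only on $d,\zeta,r,c_0$ and on the uniform bounds of the Schwartz seminorms of $f_1,f_2,f_3$, such that for all $0<\nu\le\frac12$ and $\lambda>0$ with $\varrho\ge c_0$, all $k\in\mathbb R^d$ and all $t\in[0,1]$, the integrals defining $\mathscr S_1(k,t)$ and $\mathscr S_2(k,t,\tau)$, $\tau>0$, converge absolutely, the limit defining $\mathcal K_1(f_1(\cdot,t),f_2(\cdot,t),f_3(\cdot,t))(k)$ exists, and $$\big|\mathscr S_1(k,t)-\mathcal K_1(f_1(\cdot,t),f_2(\cdot,t),f_3(\cdot,t))(k)\big|\le C\nu^\theta,$$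 $$|\mathscr S_2(k,t,\tau)|\le C\nu^\theta\quad\text{for }\tau\in[\varrho^{-1}\nu^\theta,1],\qquad |\mathscr S_2(k,t,\tau)|\le C|\log\nu|\quad\text{for }\tau\in(0,\varrho^{-1}\nu^\theta).$$ -/

import Mathlib

open MeasureTheory Filter Topology
open scoped SchwartzMap

namespace DampedWKE

noncomputable section

/-- `HasDeltaIntegral μ Ω F I` says that `∫ δ(Ω(x)) F(x) dμ(x) = I`, the Dirac delta on `ℝ` being
understood through arbitrary approximations of the identity: for every continuous compactly
supported `ρ : ℝ → ℝ` with `∫ ρ = 1`, the (absolutely convergent) integrals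
`∫ ε⁻¹ ρ(Ω(x) / ε) F(x) dμ(x)` tend to `I` as `ε → 0⁺`. -/
def HasDeltaIntegral {α : Type*} [MeasurableSpace α] (μ : Measure α) (Ω F : α → ℝ) (I : ℝ) :
    Prop :=
  ∀ ρ : ℝ → ℝ, Continuous ρ → HasCompactSupport ρ → ∫ s, ρ s = 1 →
    (∀ ε : ℝ, 0 < ε → Integrable (fun x => ε⁻¹ * ρ (Ω x / ε) * F x) μ) ∧
    Tendsto (fun ε : ℝ => ∫ x, ε⁻¹ * ρ (Ω x / ε) * F x ∂μ) (𝓝[>] 0) (𝓝 I)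

/-- The value of the delta integral is unique. -/
theorem HasDeltaIntegral.unique {α : Type*} [MeasurableSpace α] {μ : Measure α} {Ω F : α → ℝ}
    {I J : ℝ} (hI : HasDeltaIntegral μ Ω F I) (hJ : HasDeltaIntegral μ Ω F J) : I = J := by
  let g : ContDiffBump (0 : ℝ) := ⟨1, 2, one_pos, one_lt_two⟩
  have h1 : Continuous (g.normed volume) := g.continuous_normed
  have h2 : HasCompactSupport (g.normed volume) := g.hasCompactSupport_normed
  have h3 : ∫ s, g.normed volume s = 1 := g.integral_normed
  exact tendsto_nhds_unique (hI _ h1 h2 h3).2 (hJ _ h1 h2 h3).2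

open Classical in
/-- The integral `∫ δ(Ω(x)) F(x) dμ(x)` (with the default value `0` if it does not exist). -/
def deltaIntegral {α : Type*} [MeasurableSpace α] (μ : Measure α) (Ω F : α → ℝ) : ℝ :=
  if h : ∃ I, HasDeltaIntegral μ Ω F I then h.choose else 0

theorem HasDeltaIntegral.deltaIntegral_eq {α : Type*} [MeasurableSpace α] {μ : Measure α}
    {Ω F : α → ℝ} {I : ℝ} (h : HasDeltaIntegral μ Ω F I) : deltaIntegral μ Ω F = I := by
  have hex : ∃ I, HasDeltaIntegral μ Ω F I := ⟨I, h⟩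
  unfold deltaIntegral
  rw [dif_pos hex]
  exact hex.choose_spec.unique h

/-- The squared norm `|k|²_ζ = ∑ⱼ ζⱼ (k⁽ʲ⁾)²`. -/
def normSqZeta {d : ℕ} (ζ : Fin d → ℝ) (k : EuclideanSpace ℝ (Fin d)) : ℝ :=
  ∑ j, ζ j * k j ^ 2

/-- The dissipation coefficients `γ_k = (1 + |k|²_ζ)^r`. -/
def dissip {d : ℕ} (ζ : Fin d → ℝ) (r : ℝ) (k : EuclideanSpace ℝ (Fin d)) : ℝ :=
  (1 + normSqZeta ζ k) ^ r

/-- The resonance function `|k₁|²_ζ - |k₂|²_ζ + |k₃|²_ζ - |k|²_ζ` on `k = k₁ - k₂ + k₃`, as a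
function of `p = (k₁, k₃)`, with `k₂ = k₁ + k₃ - k`. -/
def resOmega {d : ℕ} (ζ : Fin d → ℝ) (k : EuclideanSpace ℝ (Fin d))
    (p : EuclideanSpace ℝ (Fin d) × EuclideanSpace ℝ (Fin d)) : ℝ :=
  normSqZeta ζ p.1 - normSqZeta ζ (p.1 + p.2 - k) + normSqZeta ζ p.2 - normSqZeta ζ k

/-- `Γ₊ = γ_k + γ_{k₁} + γ_{k₂} + γ_{k₃}` with `p = (k₁, k₃)` and `k₂ = k₁ + k₃ - k`. -/
def gammaPlus {d : ℕ} (ζ : Fin d → ℝ) (r : ℝ) (k : EuclideanSpace ℝ (Fin d))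
    (p : EuclideanSpace ℝ (Fin d) × EuclideanSpace ℝ (Fin d)) : ℝ :=
  dissip ζ r k + (dissip ζ r p.1 + dissip ζ r (p.1 + p.2 - k) + dissip ζ r p.2)

/-- `Γ₋ = -γ_k + γ_{k₁} + γ_{k₂} + γ_{k₃}` with `p = (k₁, k₃)` and `k₂ = k₁ + k₃ - k`. -/
def gammaMinus {d : ℕ} (ζ : Fin d → ℝ) (r : ℝ) (k : EuclideanSpace ℝ (Fin d))
    (p : EuclideanSpace ℝ (Fin d) × EuclideanSpace ℝ (Fin d)) : ℝ :=
  -dissip ζ r k + (dissip ζ r p.1 + dissip ζ r (p.1 + p.2 - k) + dissip ζ r p.2)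

/-- `∏ⱼ φⱼ(kⱼ)` with `p = (k₁, k₃)` and `k₂ = k₁ + k₃ - k`. -/
def tripleProd {d : ℕ} (φ₁ φ₂ φ₃ : EuclideanSpace ℝ (Fin d) → ℝ) (k : EuclideanSpace ℝ (Fin d))
    (p : EuclideanSpace ℝ (Fin d) × EuclideanSpace ℝ (Fin d)) : ℝ :=
  φ₁ p.1 * φ₂ (p.1 + p.2 - k) * φ₃ p.2

/-- The kinetic time scale `T_kin = λ⁻²`. -/
def Tkin (lam : ℝ) : ℝ := (lam ^ 2)⁻¹

/-- The ratio `ϱ = T_kin / T_for = ν λ⁻²` of the kinetic and the forcing time scales. -/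
def varrho (ν lam : ℝ) : ℝ := ν * Tkin lam

/-- The integrand of `𝒮₁`. -/
def S1Integrand {d : ℕ} (ζ : Fin d → ℝ) (r ν : ℝ) (f₁ f₂ f₃ : ℝ → 𝓢(EuclideanSpace ℝ (Fin d), ℝ))
    (k : EuclideanSpace ℝ (Fin d)) (t : ℝ)
    (p : EuclideanSpace ℝ (Fin d) × EuclideanSpace ℝ (Fin d)) : ℝ :=
  ν⁻¹ * gammaMinus ζ r k p / (gammaMinus ζ r k p ^ 2 + (ν⁻¹ * resOmega ζ k p) ^ 2) *
    tripleProd (f₁ t) (f₂ t) (f₃ t) k p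

/-- The integral `𝒮₁(k, t)`. -/
def S1 {d : ℕ} (ζ : Fin d → ℝ) (r ν : ℝ) (f₁ f₂ f₃ : ℝ → 𝓢(EuclideanSpace ℝ (Fin d), ℝ))
    (k : EuclideanSpace ℝ (Fin d)) (t : ℝ) : ℝ :=
  4 * ∫ p, S1Integrand ζ r ν f₁ f₂ f₃ k t p

/-- The integrand of `𝒮₂`. -/
def S2Integrand {d : ℕ} (ζ : Fin d → ℝ) (r ν lam : ℝ)
    (f₁ f₂ f₃ : ℝ → 𝓢(EuclideanSpace ℝ (Fin d), ℝ))
    (k : EuclideanSpace ℝ (Fin d)) (t τ : ℝ)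
    (p : EuclideanSpace ℝ (Fin d) × EuclideanSpace ℝ (Fin d)) : ℝ :=
  (((ν⁻¹ : ℝ) * Complex.exp (Complex.I * ((Tkin lam * resOmega ζ k p * τ : ℝ) : ℂ)) /
      ((gammaMinus ζ r k p : ℂ) - Complex.I * ((ν⁻¹ * resOmega ζ k p : ℝ) : ℂ)) : ℂ)).re *
    Real.exp (-(varrho ν lam * gammaPlus ζ r k p * τ)) *
    tripleProd (f₁ t) (f₂ t) (f₃ t) k p

/-- The oscillatory integral `𝒮₂(k, t, τ)`. -/
def S2 {d : ℕ} (ζ : Fin d → ℝ) (r ν lam : ℝ) (f₁ f₂ f₃ : ℝ → 𝓢(EuclideanSpace ℝ (Fin d), ℝ))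
    (k : EuclideanSpace ℝ (Fin d)) (t τ : ℝ) : ℝ :=
  4 * ∫ p, S2Integrand ζ r ν lam f₁ f₂ f₃ k t τ p

/-- The kinetic kernel
`𝒦₁(φ₁, φ₂, φ₃)(k) = ∫_{k = k₁ - k₂ + k₃} 4π δ(Ω) φ₁(k₁) φ₂(k₂) φ₃(k₃) dk₁ dk₃`. -/
def K1 {d : ℕ} (ζ : Fin d → ℝ) (φ₁ φ₂ φ₃ : EuclideanSpace ℝ (Fin d) → ℝ)
    (k : EuclideanSpace ℝ (Fin d)) : ℝ :=
  deltaIntegral volume (resOmega ζ k) (fun p => 4 * Real.pi * tripleProd φ₁ φ₂ φ₃ k p)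

end

end DampedWKE

open DampedWKE

/-! Both integrands are real parts of `exp (i s Ω) (ν Γ₋ - i Ω)⁻¹ A(k₁, k₃)`, with `s = 0` for `𝒮₁`,
and with `s = T_kin τ` and the factor `exp (-ϱ Γ₊ τ)` absorbed into the amplitude `A` for `𝒮₂`. The
resonance function factors as `Ω = -2 ⟨k₁ - k, k₃ - k⟩_ζ` (`resOmega_eq`). For fixed `k₁` it is
therefore affine in `k₃`, with slope at least `|k₁ - k|` in the direction of `k₁ - k`, and averaging
over translations in that direction turns every estimate into one about kernels in the single
variable `w = Ω`.

A kernel of vanishing integral only sees how the amplitude deviates from its value on the resonant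
set, so it contributes no more than the `√|w|` moment of a majorant
(`norm_integral_comp_affine_le`). The price is `|k₁ - k|^(-3/2)`, locally integrable because `d ≥
2`. Hölder order `1/2` is used since the first moment of the Lorentzian `ν / (ν² + w²)` diverges,
while its `√|w|` moment is of order `√ν`.

The sign of `Γ₋` is not fixed, but subadditivity of `x ↦ x^r` gives `Γ₋ ≥ 1 - |Ω|^r`: hence `Γ₋ ≥ 1`
on the resonant set, and the denominators dominate `ν² + Ω²` everywhere
(`exists_sq_le_denominator`). Replacing `Γ₋` by `1` then costs `√ν`
(`exists_norm_integral_gammaMinus_sub_le`), because `exp (i s w)` times a difference of two Cauchy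
kernels has integral zero when `s ≥ 0`: all poles lie in the lower half plane.

For `𝒮₁`, the Lorentzian minus `π ε⁻¹ ρ(w / ε)` has integral zero, and the resulting bound by `√ν +
√ε` yields both the existence of the delta integral and the rate of convergence. For `𝒮₂` with `s ≥
ν^(-7/8)`, a shift of `w` by the half period `π / s` reverses the sign of the exponential and
produces the decay (`exists_norm_integral_osc_le`). For the remaining `τ`, taking absolute values
leaves `∫ dw / ((ν + |w|)(1 + |w|))`, which is of order `|log ν|`. All powers are collected into `θ
= 1/8`. -/

/-! ### The averaging bump. -/

/-- The triangle function `max 0 (1 - |t|)`. -/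
noncomputable def triangle (t : ℝ) : ℝ := max 0 (1 - |t|)

lemma triangle_nonneg (t : ℝ) : 0 ≤ triangle t := le_max_left _ _

lemma triangle_le_one (t : ℝ) : triangle t ≤ 1 :=
  max_le zero_le_one (by linarith [abs_nonneg t])

lemma triangle_eq_zero {t : ℝ} (ht : 1 ≤ |t|) : triangle t = 0 :=
  max_eq_left (by linarith)

lemma continuous_triangle : Continuous triangle := by
  unfold triangle; fun_prop

lemma abs_triangle_sub_le (s t : ℝ) : |triangle s - triangle t| ≤ |s - t| := by
  unfold triangle
  have h := abs_max_sub_max_le_abs (1 - |s|) (1 - |t|) 0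
  rw [max_comm 0, max_comm 0]
  refine h.trans ?_
  have := abs_abs_sub_abs_le t s
  rw [show 1 - |s| - (1 - |t|) = |t| - |s| by ring, abs_sub_comm s t]
  exact this

lemma hasCompactSupport_triangle : HasCompactSupport triangle :=
  HasCompactSupport.of_support_subset_isCompact (isCompact_Icc (a := -1) (b := 1)) (by
    intro t ht
    by_contra h
    refine ht (triangle_eq_zero ?_)
    by_contra h'
    exact h (abs_le.1 (not_le.1 h').le))

lemma integrable_triangle : Integrable triangle :=
  continuous_triangle.integrable_of_hasCompactSupport hasCompactSupport_triangle

lemma integral_triangle : ∫ t, triangle t = 1 := by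
  have h1 : ∫ t, triangle t = ∫ t in (-1 : ℝ)..1, triangle t := by
    rw [intervalIntegral.integral_of_le (by norm_num), setIntegral_eq_integral_of_forall_compl_eq_zero]
    intro t ht
    refine triangle_eq_zero ?_
    by_contra h'
    have := abs_lt.1 (not_le.1 h')
    exact ht ⟨this.1, this.2.le⟩
  rw [h1, ← intervalIntegral.integral_add_adjacent_intervals (b := 0)
    (continuous_triangle.intervalIntegrable _ _) (continuous_triangle.intervalIntegrable _ _)]
  have h2 : ∫ t in (-1 : ℝ)..0, triangle t = ∫ t in (-1 : ℝ)..0, (1 + t) := by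
    refine intervalIntegral.integral_congr fun t ht => ?_
    rw [Set.uIcc_of_le (by norm_num)] at ht
    simp only [triangle]
    rw [abs_of_nonpos ht.2, max_eq_right] <;> linarith [ht.1, ht.2]
  have h3 : ∫ t in (0 : ℝ)..1, triangle t = ∫ t in (0 : ℝ)..1, (1 - t) := by
    refine intervalIntegral.integral_congr fun t ht => ?_
    rw [Set.uIcc_of_le (by norm_num)] at ht
    simp only [triangle]
    rw [abs_of_nonneg ht.1, max_eq_right]; linarith [ht.1, ht.2]
  rw [h2, h3, intervalIntegral.integral_add (by simp) (by simp),
    intervalIntegral.integral_sub (by simp) (by simp)]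
  simp
  norm_num

/-- The Lipschitz bound serves at distance below one and the range `[0, 1]` beyond. The square root
matches the moment that is finite for the Lorentzian. -/
lemma abs_triangle_sub_le_sqrt (s t : ℝ) : |triangle s - triangle t| ≤ √|s - t| := by
  rcases le_total |s - t| 1 with h | h
  · refine (abs_triangle_sub_le s t).trans (Real.le_sqrt_of_sq_le ?_)
    nlinarith [abs_nonneg (s - t)]
  · refine le_trans ?_ (Real.one_le_sqrt.2 h)
    rw [abs_le]
    constructor <;> linarith [triangle_nonneg s, triangle_nonneg t, triangle_le_one s,
      triangle_le_one t]

/-! ### Integrals of functions of an affine form, averaged along lines. -/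

section Slices

variable {E : Type*} [NormedAddCommGroup E] [NormedSpace ℝ E] [FiniteDimensional ℝ E]
  [MeasurableSpace E] [BorelSpace E] {μ : Measure E} [μ.IsAddHaarMeasure]

/-- Integration of a product of a slowly varying weight and a function of an affine form. -/
lemma lintegral_weight_mul_comp_affine_le {l : E → ℝ} (hl : Measurable l) {n : E} {a : ℝ}
    (ha : a ≠ 0) (hla : ∀ y t, l (y + t • n) = l y + t * a) {W : E → ENNReal} (hW : Measurable W)
    {κ : ENNReal} (hκ : ∀ y, ∀ t ∈ Set.Icc (0 : ℝ) 1, W (y + t • n) ≤ κ * W y)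
    {m : ℝ → ENNReal} (hm : Measurable m) :
    ∫⁻ y, W y * m (l y) ∂μ ≤ κ * (∫⁻ y, W y ∂μ) * (ENNReal.ofReal |a⁻¹| * ∫⁻ w, m w) := by
  have hscale : ∀ b : ℝ, ∫⁻ t, m (b + t * a) = ENNReal.ofReal |a⁻¹| * ∫⁻ w, m w := by
    intro b
    rw [← lintegral_add_left_eq_self m b, ← smul_eq_mul, ← lintegral_smul_measure,
      ← Real.map_volume_mul_left ha, lintegral_map (by fun_prop) (by fun_prop)]
    simp_rw [mul_comm a]
  -- Averaging over the translations by `t • n`, `t ∈ [0, 1]`, costs `κ` in the weight; the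
  -- `t`-integral can then be enlarged to the whole line, where it sees only the total mass of `m`.
  calc ∫⁻ y, W y * m (l y) ∂μ
      = ∫⁻ t in Set.Icc (0 : ℝ) 1, ∫⁻ y, W y * m (l y) ∂μ := by simp
    _ ≤ ∫⁻ t in Set.Icc (0 : ℝ) 1, ∫⁻ y, κ * W y * m (l y + t * a) ∂μ := by
        refine setLIntegral_mono' measurableSet_Icc fun t ht => ?_
        rw [← lintegral_add_right_eq_self _ (t • n)]
        refine lintegral_mono fun y => ?_
        rw [hla]
        gcongr
        exact hκ y t ht
    _ = ∫⁻ y, (∫⁻ t in Set.Icc (0 : ℝ) 1, κ * W y * m (l y + t * a)) ∂μ := by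
        refine lintegral_lintegral_swap ?_
        refine Measurable.aemeasurable ?_
        simp only [Function.uncurry_def]
        fun_prop
    _ ≤ ∫⁻ y, κ * W y * (ENNReal.ofReal |a⁻¹| * ∫⁻ w, m w) ∂μ := by
        refine lintegral_mono fun y => ?_
        rw [← hscale (l y), ← lintegral_const_mul _ (by fun_prop)]
        exact setLIntegral_le_lintegral _ _
    _ = κ * (∫⁻ y, W y ∂μ) * (ENNReal.ofReal |a⁻¹| * ∫⁻ w, m w) := by
        rw [lintegral_mul_const _ (by fun_prop), lintegral_const_mul _ hW]

lemma integral_weight_mul_comp_affine_le {l : E → ℝ} (hl : Measurable l) {n : E} {a : ℝ}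
    (ha : a ≠ 0) (hla : ∀ y t, l (y + t • n) = l y + t * a) {W : E → ℝ} (hW : Measurable W)
    (hW0 : ∀ y, 0 ≤ W y) (hWi : Integrable W μ) {κ : ℝ} (hκ0 : 0 ≤ κ)
    (hκ : ∀ y, ∀ t ∈ Set.Icc (0 : ℝ) 1, W (y + t • n) ≤ κ * W y)
    {m : ℝ → ℝ} (hm : Measurable m) (hm0 : ∀ w, 0 ≤ m w) (hmi : Integrable m) :
    Integrable (fun y => W y * m (l y)) μ ∧
    ∫ y, W y * m (l y) ∂μ ≤ κ * (∫ y, W y ∂μ) * (|a|⁻¹ * ∫ w, m w) := by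
  have key := lintegral_weight_mul_comp_affine_le (μ := μ) hl ha hla hW.ennreal_ofReal
    (κ := ENNReal.ofReal κ) (fun y t ht => by
      rw [← ENNReal.ofReal_mul hκ0]
      exact ENNReal.ofReal_le_ofReal (hκ y t ht)) hm.ennreal_ofReal
  have hI1 : 0 ≤ ∫ y, W y ∂μ := integral_nonneg hW0
  have hI2 : 0 ≤ ∫ w, m w := integral_nonneg hm0
  rw [← ofReal_integral_eq_lintegral_ofReal hWi (ae_of_all _ hW0),
    ← ofReal_integral_eq_lintegral_ofReal hmi (ae_of_all _ hm0),
    ← ENNReal.ofReal_mul hκ0, ← ENNReal.ofReal_mul (abs_nonneg _),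
    ← ENNReal.ofReal_mul (by positivity), abs_inv] at key
  simp_rw [← ENNReal.ofReal_mul (hW0 _)] at key
  have hn : ∀ y, 0 ≤ W y * m (l y) := fun y => mul_nonneg (hW0 y) (hm0 _)
  have hmeas : Measurable fun y => W y * m (l y) := by fun_prop
  have hint : Integrable (fun y => W y * m (l y)) μ := by
    refine ⟨hmeas.aestronglyMeasurable, ?_⟩
    rw [hasFiniteIntegral_iff_ofReal (ae_of_all _ hn)]
    exact key.trans_lt ENNReal.ofReal_lt_top
  refine ⟨hint, ?_⟩
  rw [← ofReal_integral_eq_lintegral_ofReal hint (ae_of_all _ hn)] at key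
  exact (ENNReal.ofReal_le_ofReal_iff (by positivity)).1 key

/-- Averaging over translations does not change an integral. -/
lemma integral_eq_integral_average (n : E) {Φ : E → ℂ} (hΦ : Integrable Φ μ) :
    Integrable (fun p : E × ℝ => (triangle p.2 : ℂ) * Φ (p.1 + p.2 • n)) (μ.prod volume) ∧
    ∫ y, Φ y ∂μ = ∫ y, (∫ t, (triangle t : ℂ) * Φ (y + t • n)) ∂μ := by
  have h0 : Integrable (fun p : ℝ × E => (triangle p.1 : ℂ) * Φ p.2) (volume.prod μ) :=
    integrable_triangle.ofReal.mul_prod hΦ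
  -- A shear preserves the product measure, which makes the averaged integrand jointly integrable
  -- and permits Fubini.
  have hmp : MeasurePreserving (fun p : ℝ × E => (p.1, p.2 + p.1 • n)) (volume.prod μ)
      (volume.prod μ) := by
    refine (MeasurePreserving.id volume).skew_product (g := fun t y => y + t • n) ?_ ?_
    · simp only [Function.uncurry_def]; fun_prop
    · exact ae_of_all _ fun t => map_add_right_eq_self μ (t • n)
  have h1 : Integrable (fun p : ℝ × E => (triangle p.1 : ℂ) * Φ (p.2 + p.1 • n))
      (volume.prod μ) := hmp.integrable_comp_of_integrable h0
  refine ⟨h1.swap, ?_⟩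
  have h2 := integral_integral_swap (f := fun (t : ℝ) (y : E) => (triangle t : ℂ) * Φ (y + t • n))
    (μ := volume) (ν := μ) h1
  rw [← h2]
  simp_rw [integral_const_mul, integral_add_right_eq_self]
  rw [integral_mul_const, integral_complex_ofReal, integral_triangle]
  simp

/-- The estimate of an integrand on a line, after the value at the zero of the affine form has been
subtracted. -/
lemma norm_triangle_sub_le {t t₀ A B M : ℝ} {z z₀ : ℂ} (hz : ‖z‖ ≤ A) (hz₀ : ‖z₀‖ ≤ B)
    (hA : |t| ≤ 1 → A ≤ M) (hB : |t₀| ≤ 1 → B ≤ M) (hM : 0 ≤ M)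
    (hd : |t - t₀| ≤ 1 → ‖z - z₀‖ ≤ A * |t - t₀|) :
    ‖(triangle t : ℂ) * z - (triangle t₀ : ℂ) * z₀‖ ≤ 3 * M * √|t - t₀| := by
  have hs := abs_triangle_sub_le_sqrt t t₀
  have h0 := triangle_nonneg t
  have h1 := triangle_nonneg t₀
  have h0' := triangle_le_one t
  have hq := Real.sqrt_nonneg |t - t₀|
  by_cases ht : |t| ≤ 1
  · have hAM := hA ht
    by_cases ht₀ : |t₀| ≤ 1
    · have hBM := hB ht₀
      have hzz : ‖z - z₀‖ ≤ 2 * M * √|t - t₀| := by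
        rcases le_total |t - t₀| 1 with h | h
        · refine (hd h).trans ?_
          have : |t - t₀| ≤ √|t - t₀| := Real.le_sqrt_of_sq_le (by nlinarith [abs_nonneg (t - t₀)])
          have h3 : 0 ≤ A := (norm_nonneg _).trans hz
          calc A * |t - t₀| ≤ M * √|t - t₀| := by gcongr
            _ ≤ 2 * M * √|t - t₀| := by nlinarith [mul_nonneg hM hq]
        · have := Real.one_le_sqrt.2 h
          calc ‖z - z₀‖ ≤ ‖z‖ + ‖z₀‖ := norm_sub_le _ _
            _ ≤ 2 * M * 1 := by linarith
            _ ≤ _ := by gcongr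
      rw [show (triangle t : ℂ) * z - (triangle t₀ : ℂ) * z₀ =
        (triangle t : ℂ) * (z - z₀) + ((triangle t - triangle t₀ : ℝ) : ℂ) * z₀ by push_cast; ring]
      refine (norm_add_le _ _).trans ?_
      rw [norm_mul, norm_mul, Complex.norm_real, Complex.norm_real, Real.norm_eq_abs,
        Real.norm_eq_abs, abs_of_nonneg h0]
      calc triangle t * ‖z - z₀‖ + |triangle t - triangle t₀| * ‖z₀‖
          ≤ 1 * (2 * M * √|t - t₀|) + √|t - t₀| * M := by
            gcongr
            exact hz₀.trans hBM
        _ = _ := by ring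
    · rw [triangle_eq_zero (not_le.1 ht₀).le] at hs ⊢
      rw [Complex.ofReal_zero, zero_mul, sub_zero, norm_mul, Complex.norm_real, Real.norm_eq_abs]
      rw [sub_zero] at hs
      calc |triangle t| * ‖z‖ ≤ √|t - t₀| * M := by gcongr; exact hz.trans hAM
        _ ≤ _ := by nlinarith [mul_nonneg hM hq]
  · rw [triangle_eq_zero (not_le.1 ht).le] at hs ⊢
    rw [Complex.ofReal_zero, zero_mul, zero_sub, norm_neg, norm_mul, Complex.norm_real,
      Real.norm_eq_abs]
    rw [zero_sub, abs_neg] at hs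
    by_cases ht₀ : |t₀| ≤ 1
    · calc |triangle t₀| * ‖z₀‖ ≤ √|t - t₀| * M := by gcongr; exact hz₀.trans (hB ht₀)
        _ ≤ _ := by nlinarith [mul_nonneg hM hq]
    · rw [triangle_eq_zero (not_le.1 ht₀).le, abs_zero, zero_mul]
      positivity

/-- An integral of kernels of vanishing integral in an affine form is controlled by the Hölder
moment of a majorant of the kernels. -/
lemma norm_integral_comp_affine_le {l : E → ℝ} {n : E} (hn : ‖n‖ ≤ 1) {a : ℝ}
    (ha : a ≠ 0) (hla : ∀ y t, l (y + t • n) = l y + t * a) {W : E → ℝ}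
    (hW0 : ∀ y, 0 ≤ W y) (hWi : Integrable W μ) {κ : ℝ} (hκ0 : 0 ≤ κ)
    (hκ : ∀ y, ∀ t : ℝ, |t| ≤ 1 → W (y + t • n) ≤ κ * W y)
    {m : ℝ → ℝ} (hm0 : ∀ w, 0 ≤ m w) (hmi : Integrable fun w => m w * √|w|)
    {Q : E → ℝ → ℂ} (hΦ : Integrable (fun y => Q y (l y)) μ)
    (hQi : ∀ y, l y = 0 → Integrable (Q y)) (hQ0 : ∀ y, l y = 0 → ∫ w, Q y w = 0)
    (hQ : ∀ y, ‖Q y (l y)‖ ≤ W y * m (l y)) (hQ' : ∀ y, l y = 0 → ∀ w, ‖Q y w‖ ≤ W y * m w)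
    (hQl : ∀ y y₀, l y₀ = 0 → ‖y - y₀‖ ≤ 1 → ‖Q y (l y) - Q y₀ (l y)‖ ≤
      W y * m (l y) * ‖y - y₀‖) :
    ‖∫ y, Q y (l y) ∂μ‖ ≤
      3 * κ * (∫ y, W y ∂μ) * (|a|⁻¹ * (√|a|)⁻¹ * ∫ w, m w * √|w|) := by
  obtain ⟨hprod, heq⟩ := integral_eq_integral_average n hΦ
  rw [heq]
  have hscale : (fun t => m (a * t) * √|t|) =
      fun t => (√|a|)⁻¹ * (fun w => m w * √|w|) (a * t) := by
    ext t
    have : 0 < √|a| := Real.sqrt_pos.2 (abs_pos.2 ha)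
    simp only [abs_mul, Real.sqrt_mul (abs_nonneg a)]
    field_simp
  have hsc : ∀ t₀ : ℝ, Integrable (fun t => m (a * (t - t₀)) * √|t - t₀|) ∧
      ∫ t, m (a * (t - t₀)) * √|t - t₀| = |a|⁻¹ * (√|a|)⁻¹ * ∫ w, m w * √|w| := by
    intro t₀
    have h1 : Integrable fun t => m (a * t) * √|t| := by
      rw [hscale]
      exact (hmi.comp_mul_left' ha).const_mul _
    refine ⟨h1.comp_sub_right t₀, ?_⟩
    rw [integral_sub_right_eq_self (fun t => m (a * t) * √|t|) t₀, hscale, integral_const_mul,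
      Measure.integral_comp_mul_left (fun w => m w * √|w|) a, abs_inv, smul_eq_mul]
    ring
  have hbound : ∀ᵐ y ∂μ, ‖∫ t, (triangle t : ℂ) * Q (y + t • n) (l (y + t • n))‖ ≤
      3 * κ * W y * (|a|⁻¹ * (√|a|)⁻¹ * ∫ w, m w * √|w|) := by
    filter_upwards [hprod.prod_right_ae] with y hy
    -- The parameter at which the line through `y` meets the zero set of `l`. Along the line the
    -- argument of the kernel is `a (t - t₀)`.
    set t₀ : ℝ := -(l y) / a with ht₀
    have hl0 : l (y + t₀ • n) = 0 := by
      rw [hla, ht₀]; field_simp; ring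
    have hlt : ∀ t, l (y + t • n) = a * (t - t₀) := by
      intro t; rw [hla, ht₀]; field_simp; ring
    have hzi : Integrable fun t => (triangle t₀ : ℂ) * Q (y + t₀ • n) (a * (t - t₀)) :=
      (((hQi _ hl0).comp_mul_left' ha).comp_sub_right t₀).const_mul _
    have hz : ∫ t, (triangle t₀ : ℂ) * Q (y + t₀ • n) (a * (t - t₀)) = 0 := by
      rw [integral_const_mul, integral_sub_right_eq_self (fun t => Q (y + t₀ • n) (a * t)) t₀,
        Measure.integral_comp_mul_left, hQ0 _ hl0]
      simp
    -- Subtracting the kernel with bump and base point frozen at `t₀` changes nothing, since its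
    -- integral vanishes; the difference gains the factor `√|t - t₀|`.
    rw [← sub_zero (∫ t, _), ← hz, ← integral_sub hy hzi, ← (hsc t₀).2, ← integral_const_mul]
    refine norm_integral_le_of_norm_le ((hsc t₀).1.const_mul _) (ae_of_all _ fun t => ?_)
    have e1 : y + t • n - (y + t₀ • n) = (t - t₀) • n := by rw [sub_smul]; abel
    have e2 : ‖y + t • n - (y + t₀ • n)‖ ≤ |t - t₀| := by
      rw [e1, norm_smul, Real.norm_eq_abs]
      exact mul_le_of_le_one_right (abs_nonneg _) hn
    have hm' := hm0 (a * (t - t₀))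
    have key := norm_triangle_sub_le (t := t) (t₀ := t₀) (M := κ * W y * m (a * (t - t₀)))
      (hQ (y + t • n)) (hQ' _ hl0 (a * (t - t₀)))
      (fun h => by rw [hlt]; gcongr; exact hκ y t h)
      (fun h => by gcongr; exact hκ y t₀ h)
      (mul_nonneg (mul_nonneg hκ0 (hW0 y)) hm')
      (fun h => by
        have := hQl (y + t • n) (y + t₀ • n) hl0 (e2.trans h)
        rw [hlt] at this ⊢
        refine this.trans ?_
        have := hW0 (y + t • n)
        gcongr)
    calc _ ≤ _ := key
      _ = _ := by ring
  refine (norm_integral_le_of_norm_le ((hWi.const_mul _).mul_const _) hbound).trans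
    (le_of_eq ?_)
  rw [integral_mul_const, integral_const_mul]

/-- A small shift of the kernel is controlled by the regularity of the amplitude. -/
lemma norm_integral_shift_comp_affine_le {l : E → ℝ} (hl : Measurable l) {n : E} (hn : ‖n‖ ≤ 1)
    {a : ℝ} (ha : a ≠ 0) (hla : ∀ y t, l (y + t • n) = l y + t * a) {W : E → ℝ} (hW : Measurable W)
    (hW0 : ∀ y, 0 ≤ W y) (hWi : Integrable W μ) {κ : ℝ} (hκ0 : 0 ≤ κ)
    (hκ : ∀ y, ∀ t : ℝ, |t| ≤ 1 → W (y + t • n) ≤ κ * W y)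
    {H : ℝ → ℂ} (hH : Measurable H) (hHi : Integrable H) {A : E → ℂ} (hAm : Measurable A)
    (hA : ∀ y, ‖A y‖ ≤ W y) (hAl : ∀ y y', ‖y - y'‖ ≤ 1 → ‖A y - A y'‖ ≤ W y * ‖y - y'‖)
    (δ : ℝ) :
    ‖∫ y, (H (l y) - H (l y + δ)) * A y ∂μ‖ ≤
      2 * κ * (∫ y, W y ∂μ) * (|a|⁻¹ * (√|a|)⁻¹ * √|δ| * ∫ w, ‖H w‖) := by
  -- Moving `y` by `η • n` shifts the affine form by `δ`, so a change of variables transfers the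
  -- shift from the kernel to the amplitude.
  set η : ℝ := δ / a with hη
  have hδ : ∀ y, l (y + η • n) = l y + δ := by
    intro y; rw [hla, hη]; field_simp
  have hW1 : ∀ y, ∀ t ∈ Set.Icc (0 : ℝ) 1, W (y + t • n) ≤ κ * W y := fun y t ht =>
    hκ y t (by rw [abs_of_nonneg ht.1]; exact ht.2)
  obtain ⟨hi1, hb1⟩ := integral_weight_mul_comp_affine_le (μ := μ) hl ha hla hW hW0 hWi hκ0 hW1
    (m := fun w => ‖H w‖) (by fun_prop) (fun w => norm_nonneg _) hHi.norm
  obtain ⟨hi2, hb2⟩ := integral_weight_mul_comp_affine_le (μ := μ) hl ha hla hW hW0 hWi hκ0 hW1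
    (m := fun w => ‖H (w + δ)‖) (by fun_prop) (fun w => norm_nonneg _) (hHi.comp_add_right δ).norm
  rw [integral_add_right_eq_self (fun w => ‖H w‖) δ] at hb2
  have hj1 : Integrable (fun y => H (l y) * A y) μ := by
    refine hi1.mono' (by fun_prop) (ae_of_all _ fun y => ?_)
    rw [norm_mul, mul_comm]
    exact mul_le_mul_of_nonneg_right (hA y) (norm_nonneg _)
  have hj2 : Integrable (fun y => H (l y + δ) * A y) μ := by
    refine hi2.mono' (by fun_prop) (ae_of_all _ fun y => ?_)
    rw [norm_mul, mul_comm]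
    exact mul_le_mul_of_nonneg_right (hA y) (norm_nonneg _)
  have hi2' : Integrable (fun y => W (y + -(η • n)) * ‖H (l y)‖) μ := by
    refine (integrable_congr (ae_of_all _ fun y => ?_)).1 (hi2.comp_add_right (-(η • n)))
    simp only [← hδ, neg_add_cancel_right]
  have hb2' : ∫ y, W (y + -(η • n)) * ‖H (l y)‖ ∂μ = ∫ y, W y * ‖H (l y + δ)‖ ∂μ := by
    rw [← integral_add_right_eq_self _ (η • n)]
    simp only [hδ, add_neg_cancel_right]
  have hj2' : Integrable (fun y => H (l y) * A (y + -(η • n))) μ := by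
    refine (integrable_congr (ae_of_all _ fun y => ?_)).1 (hj2.comp_add_right (-(η • n)))
    simp only [← hδ, neg_add_cancel_right]
  have he : ∫ y, H (l y + δ) * A y ∂μ = ∫ y, H (l y) * A (y + -(η • n)) ∂μ := by
    rw [← integral_add_right_eq_self (fun y => H (l y) * A (y + -(η • n))) (η • n)]
    simp only [hδ, add_neg_cancel_right]
  -- The Lipschitz bound for `|η| ≤ 1` and the triangle inequality for `|η| ≥ 1` combine into a
  -- Hölder bound of order `1/2`, valid for every displacement.
  have hdiff : ∀ y, ‖A y - A (y + -(η • n))‖ ≤ √|η| * (W y + W (y + -(η • n))) := by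
    intro y
    have e1 : ‖y - (y + -(η • n))‖ ≤ |η| := by
      rw [show y - (y + -(η • n)) = η • n by abel, norm_smul, Real.norm_eq_abs]
      exact mul_le_of_le_one_right (abs_nonneg _) hn
    have h1 := hW0 y
    have h2 := hW0 (y + -(η • n))
    rcases le_total |η| 1 with h | h
    · have h3 : |η| ≤ √|η| := Real.le_sqrt_of_sq_le (by nlinarith [abs_nonneg η])
      calc _ ≤ W y * ‖y - (y + -(η • n))‖ := hAl _ _ (e1.trans h)
        _ ≤ W y * √|η| := by gcongr; exact e1.trans h3
        _ ≤ _ := by nlinarith [mul_nonneg (Real.sqrt_nonneg |η|) h2]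
    · have h3 := Real.one_le_sqrt.2 h
      calc _ ≤ ‖A y‖ + ‖A (y + -(η • n))‖ := norm_sub_le _ _
        _ ≤ 1 * (W y + W (y + -(η • n))) := by linarith [hA y, hA (y + -(η • n))]
        _ ≤ _ := by gcongr
  have hsq : √|η| = (√|a|)⁻¹ * √|δ| := by
    rw [hη, abs_div, Real.sqrt_div (abs_nonneg δ), div_eq_inv_mul]
  calc ‖∫ y, (H (l y) - H (l y + δ)) * A y ∂μ‖
      = ‖∫ y, H (l y) * (A y - A (y + -(η • n))) ∂μ‖ := by
        simp_rw [sub_mul, mul_sub]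
        rw [integral_sub hj1 hj2, integral_sub hj1 hj2', he]
    _ ≤ ∫ y, √|η| * (W y * ‖H (l y)‖ + W (y + -(η • n)) * ‖H (l y)‖) ∂μ := by
        refine norm_integral_le_of_norm_le ((hi1.add hi2').const_mul _) (ae_of_all _ fun y => ?_)
        rw [norm_mul]
        calc _ ≤ ‖H (l y)‖ * (√|η| * (W y + W (y + -(η • n)))) := by gcongr; exact hdiff y
          _ = _ := by ring
    _ = √|η| * (∫ y, W y * ‖H (l y)‖ ∂μ + ∫ y, W y * ‖H (l y + δ)‖ ∂μ) := by
        rw [integral_const_mul, integral_add hi1 hi2', hb2']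
    _ ≤ √|η| * (κ * (∫ y, W y ∂μ) * (|a|⁻¹ * ∫ w, ‖H w‖) +
          κ * (∫ y, W y ∂μ) * (|a|⁻¹ * ∫ w, ‖H w‖)) := by gcongr
    _ = _ := by rw [hsq]; ring

end Slices

/-! ### The Cauchy kernel, its moments and its vanishing integrals. -/

/-- The kernel `(b - i w)⁻¹`. -/
noncomputable def cauchyKer (b w : ℝ) : ℂ := ((b : ℂ) - Complex.I * w)⁻¹

lemma normSq_sub_I_mul (b w : ℝ) : Complex.normSq ((b : ℂ) - Complex.I * w) = b ^ 2 + w ^ 2 := by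
  simp [Complex.normSq_apply]; ring

lemma norm_sub_I_mul (b w : ℝ) : ‖(b : ℂ) - Complex.I * w‖ = √(b ^ 2 + w ^ 2) := by
  rw [← normSq_sub_I_mul, Complex.norm_def]

lemma norm_cauchyKer (b w : ℝ) : ‖cauchyKer b w‖ = (√(b ^ 2 + w ^ 2))⁻¹ := by
  rw [cauchyKer, norm_inv, norm_sub_I_mul]

lemma norm_cauchyKer_sq (b w : ℝ) : ‖cauchyKer b w‖ ^ 2 = (b ^ 2 + w ^ 2)⁻¹ := by
  rw [norm_cauchyKer, inv_pow, Real.sq_sqrt (by positivity)]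

lemma re_cauchyKer (b w : ℝ) : (cauchyKer b w).re = b / (b ^ 2 + w ^ 2) := by
  rw [cauchyKer, Complex.inv_re, normSq_sub_I_mul]
  simp

lemma sub_I_mul_ne_zero {b w : ℝ} (h : 0 < b ^ 2 + w ^ 2) : (b : ℂ) - Complex.I * w ≠ 0 := by
  rw [← Complex.normSq_pos, normSq_sub_I_mul]; exact h

/-- The resolvent identity. Every gain from differences of kernels, in the width as well as in the
frequency, goes back to it. -/
lemma cauchyKer_sub {b w b' w' : ℝ} (h : 0 < b ^ 2 + w ^ 2) (h' : 0 < b' ^ 2 + w' ^ 2) :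
    cauchyKer b w - cauchyKer b' w' =
      ((b' : ℂ) - b + Complex.I * (w - w')) * (cauchyKer b w * cauchyKer b' w') := by
  have h1 := sub_I_mul_ne_zero h
  have h2 := sub_I_mul_ne_zero h'
  unfold cauchyKer
  field_simp
  ring

lemma norm_cauchyKer_sub_left {b b' w : ℝ} (h : 0 < b ^ 2 + w ^ 2) (h' : 0 < b' ^ 2 + w ^ 2) :
    ‖cauchyKer b w - cauchyKer b' w‖ = |b - b'| * (‖cauchyKer b w‖ * ‖cauchyKer b' w‖) := by
  rw [cauchyKer_sub h h', sub_self, mul_zero, add_zero, norm_mul, norm_mul,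
    ← Complex.ofReal_sub, Complex.norm_real, Real.norm_eq_abs, abs_sub_comm]

lemma norm_cauchyKer_sub_right_le {b : ℝ} (hb : 0 < b) (w w' : ℝ) :
    ‖cauchyKer b w - cauchyKer b w'‖ ≤
      |w - w'| * ((b ^ 2 + w ^ 2)⁻¹ + (b ^ 2 + w' ^ 2)⁻¹) := by
  rw [cauchyKer_sub (by positivity) (by positivity), sub_self, zero_add, norm_mul, norm_mul,
    norm_mul, Complex.norm_I, one_mul, ← Complex.ofReal_sub, Complex.norm_real, Real.norm_eq_abs,
    ← norm_cauchyKer_sq, ← norm_cauchyKer_sq]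
  gcongr
  nlinarith [sq_nonneg (‖cauchyKer b w‖ - ‖cauchyKer b w'‖), sq_nonneg ‖cauchyKer b w‖,
    sq_nonneg ‖cauchyKer b w'‖]

lemma continuous_cauchyKer {b : ℝ} (hb : 0 < b) : Continuous (cauchyKer b) := by
  unfold cauchyKer
  refine Continuous.inv₀ (by fun_prop) fun w => sub_I_mul_ne_zero (by positivity)

lemma integrable_inv_sq_add_sq {b : ℝ} (hb : 0 < b) :
    Integrable fun w : ℝ => (b ^ 2 + w ^ 2)⁻¹ := by
  have h := (integrable_inv_one_add_sq.comp_mul_left' (inv_ne_zero hb.ne')).const_mul (b ^ 2)⁻¹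
  refine h.congr (ae_of_all _ fun w => ?_)
  simp only
  rw [← mul_inv]
  congr 1
  field_simp

lemma integral_univ_inv_sq_add_sq {b : ℝ} (hb : 0 < b) :
    ∫ w : ℝ, (b ^ 2 + w ^ 2)⁻¹ = Real.pi / b := by
  have h : (fun w : ℝ => (b ^ 2 + w ^ 2)⁻¹) =
      fun w => (b ^ 2)⁻¹ * (fun u : ℝ => (1 + u ^ 2)⁻¹) (b⁻¹ * w) := by
    ext w
    simp only
    rw [← mul_inv]
    congr 1
    field_simp
  rw [h, integral_const_mul, Measure.integral_comp_mul_left (fun u : ℝ => (1 + u ^ 2)⁻¹) b⁻¹,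
    integral_univ_inv_one_add_sq, inv_inv, abs_of_pos hb, smul_eq_mul]
  field_simp

/-- The integrand decays like `|w|^(-3/2)`; with `|w|` in place of `√|w|` the integral would diverge
logarithmically. -/
lemma integrable_sqrt_mul_inv_one_add_sq :
    Integrable fun w : ℝ => (1 + w ^ 2)⁻¹ * √|w| := by
  have h := (integrable_one_add_norm (E := ℝ) (μ := volume) (r := 3 / 2)
    (by simp; norm_num)).const_mul 2
  refine h.mono' (by fun_prop) (ae_of_all _ fun w => ?_)
  rw [Real.norm_of_nonneg (by positivity), Real.norm_eq_abs, ← sq_abs w]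
  have h0 := abs_nonneg w
  set x := |w|
  have h1 : (1 + x) ^ (-(3 / 2) : ℝ) = ((1 + x) ^ 2)⁻¹ * √(1 + x) := by
    rw [Real.sqrt_eq_rpow, ← Real.rpow_natCast, ← Real.rpow_neg (by positivity),
      ← Real.rpow_add (by positivity)]
    norm_num
  rw [h1, ← mul_assoc]
  gcongr
  · rw [← div_eq_mul_inv, inv_eq_one_div, div_le_div_iff₀ (by positivity) (by positivity)]
    nlinarith [sq_nonneg (x - 1)]
  · linarith

/-- The constant `∫ √|w| / (1 + w²) dw`. -/
noncomputable def sqrtMoment : ℝ := ∫ w : ℝ, (1 + w ^ 2)⁻¹ * √|w|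

lemma sqrtMoment_nonneg : 0 ≤ sqrtMoment := integral_nonneg fun w => by positivity

/-- Scaling by `b` shows that the moment is of order `b^(-1/2)`; multiplied by `b` this becomes the
gain `√b`. -/
lemma inv_sq_add_sq_mul_sqrt_eq {b : ℝ} (hb : 0 < b) :
    (fun w : ℝ => (b ^ 2 + w ^ 2)⁻¹ * √|w|) =
      fun w => (b ^ 2)⁻¹ * √b * (fun u : ℝ => (1 + u ^ 2)⁻¹ * √|u|) (b⁻¹ * w) := by
  ext w
  have h1 : (b ^ 2 + w ^ 2)⁻¹ = (b ^ 2)⁻¹ * (1 + (b⁻¹ * w) ^ 2)⁻¹ := by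
    rw [← mul_inv]
    congr 1
    field_simp
  have h2 : √|w| = √b * √|b⁻¹ * w| := by
    rw [← Real.sqrt_mul hb.le, abs_mul, abs_inv, abs_of_pos hb]
    congr 1
    field_simp
  rw [h1, h2]
  ring

lemma integrable_inv_sq_add_sq_mul_sqrt {b : ℝ} (hb : 0 < b) :
    Integrable fun w : ℝ => (b ^ 2 + w ^ 2)⁻¹ * √|w| := by
  rw [inv_sq_add_sq_mul_sqrt_eq hb]
  exact (integrable_sqrt_mul_inv_one_add_sq.comp_mul_left' (inv_ne_zero hb.ne')).const_mul _

lemma integral_inv_sq_add_sq_mul_sqrt {b : ℝ} (hb : 0 < b) :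
    ∫ w : ℝ, (b ^ 2 + w ^ 2)⁻¹ * √|w| = b⁻¹ * √b * sqrtMoment := by
  rw [inv_sq_add_sq_mul_sqrt_eq hb, integral_const_mul,
    Measure.integral_comp_mul_left (fun u : ℝ => (1 + u ^ 2)⁻¹ * √|u|) b⁻¹, inv_inv,
    abs_of_pos hb, smul_eq_mul, sqrtMoment]
  field_simp

/-- A single kernel decays only like `1 / |w|`; by the resolvent identity the leading terms cancel
in the difference, which decays quadratically. -/
lemma integrable_cauchyKer_sub {b b' : ℝ} (hb : 0 < b) (hb' : 0 < b') :
    Integrable fun w : ℝ => cauchyKer b w - cauchyKer b' w := by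
  have h := ((integrable_inv_sq_add_sq hb).add (integrable_inv_sq_add_sq hb')).const_mul |b - b'|
  refine h.mono' ?_ (ae_of_all _ fun w => ?_)
  · have := continuous_cauchyKer hb
    have := continuous_cauchyKer hb'
    exact Continuous.aestronglyMeasurable (by fun_prop)
  · rw [norm_cauchyKer_sub_left (by positivity) (by positivity), Pi.add_apply,
      ← norm_cauchyKer_sq, ← norm_cauchyKer_sq]
    gcongr
    nlinarith [sq_nonneg (‖cauchyKer b w‖ - ‖cauchyKer b' w‖), sq_nonneg ‖cauchyKer b w‖,
      sq_nonneg ‖cauchyKer b' w‖]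

open FourierTransform in
/-- The integral vanishes since the poles lie in the lower half plane. -/
lemma integral_exp_mul_cauchyKer_sub {b b' : ℝ} (hb : 0 < b) (hb' : 0 < b') {s : ℝ} (hs : 0 ≤ s) :
    ∫ w : ℝ, Complex.exp (Complex.I * ((s * w : ℝ) : ℂ)) *
      (cauchyKer b w - cauchyKer b' w) = 0 := by
  -- The Fourier transform of `g` at `ξ` is the difference of the kernels at `-2πξ`. The two
  -- exponentials agree at `0`, so `g` is continuous across the origin and inversion holds at every
  -- point.
  set g : ℝ → ℂ := fun u => (Set.Ioi (0 : ℝ)).indicator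
    (fun u : ℝ => Complex.exp (-b * u) - Complex.exp (-b' * u)) u with hg
  have hexp : ∀ {c : ℝ}, 0 < c → ∀ ξ : ℝ, IntegrableOn (fun u : ℝ => Complex.exp
      ((-c - 2 * Real.pi * ξ * Complex.I) * u)) (Set.Ioi 0) := by
    intro c hc ξ
    exact integrableOn_exp_mul_complex_Ioi (by simpa using hc) 0
  have hexpi : ∀ {c : ℝ}, 0 < c → ∀ ξ : ℝ, ∫ u in Set.Ioi (0 : ℝ), Complex.exp
      ((-c - 2 * Real.pi * ξ * Complex.I) * u) = cauchyKer c (-2 * Real.pi * ξ) := by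
    intro c hc ξ
    rw [integral_exp_mul_complex_Ioi (by simpa using hc) 0]
    simp only [Complex.ofReal_zero, mul_zero, Complex.exp_zero, cauchyKer]
    rw [neg_div, ← div_neg, one_div]
    congr 1
    push_cast
    ring
  have hgc : Continuous g := by
    refine continuous_indicator ?_ (by fun_prop)
    simp
  have hgi : Integrable g := by
    refine IntegrableOn.integrable_indicator ?_ measurableSet_Ioi
    have h1 := hexp hb 0
    have h2 := hexp hb' 0
    simp only [Complex.ofReal_zero, mul_zero, zero_mul, sub_zero] at h1 h2
    exact Integrable.sub h1 h2
  have hF : 𝓕 g = fun ξ : ℝ =>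
      cauchyKer b (-2 * Real.pi * ξ) - cauchyKer b' (-2 * Real.pi * ξ) := by
    ext ξ
    rw [Real.fourier_real_eq_integral_exp_smul, ← hexpi hb, ← hexpi hb',
      ← integral_sub (hexp hb ξ) (hexp hb' ξ), ← integral_indicator measurableSet_Ioi]
    congr 1
    ext u
    by_cases hu : 0 < u
    · simp only [hg, Set.indicator_of_mem (Set.mem_Ioi.2 hu), smul_eq_mul, mul_sub]
      rw [← Complex.exp_add, ← Complex.exp_add]
      congr 2 <;> (push_cast; ring)
    · simp [hg, hu]
  have hpi : -2 * Real.pi ≠ 0 := by simp [Real.pi_ne_zero]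
  have hFi : Integrable (𝓕 g) := by
    rw [hF]
    exact (integrable_cauchyKer_sub hb hb').comp_mul_left' hpi
  -- Inversion at `-s ≤ 0` recovers `g (-s) = 0`, as `g` lives on the positive half line.
  have hinv := hgi.fourierInv_fourier_eq hFi (v := -s) hgc.continuousAt
  rw [hF, Real.fourierInv_eq_fourier_neg, neg_neg, Real.fourier_real_eq_integral_exp_smul] at hinv
  have hgs : g (-s) = 0 := by simp [hg, hs]
  rw [hgs] at hinv
  have hcomp := Measure.integral_comp_mul_left (fun w : ℝ =>
    Complex.exp (Complex.I * ((s * w : ℝ) : ℂ)) * (cauchyKer b w - cauchyKer b' w)) (-2 * Real.pi)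
  have he : ∫ x : ℝ, (fun w : ℝ => Complex.exp (Complex.I * ((s * w : ℝ) : ℂ)) *
      (cauchyKer b w - cauchyKer b' w)) (-2 * Real.pi * x) = 0 := by
    rw [← hinv]
    congr 1
    ext ξ
    simp only [smul_eq_mul]
    congr 2
    push_cast
    ring
  rw [he] at hcomp
  exact (smul_eq_zero.1 hcomp.symm).resolve_left (by simp [Real.pi_ne_zero])

lemma integrable_inv_add_abs_mul {b : ℝ} (hb : 0 < b) (hb1 : b < 1) :
    Integrable (fun w : ℝ => ((b + |w|) * (1 + |w|))⁻¹) ∧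
    ∫ w : ℝ, ((b + |w|) * (1 + |w|))⁻¹ = 2 * ((1 - b)⁻¹ * -Real.log b) := by
  -- The antiderivative on the positive half line, from partial fractions.
  set g : ℝ → ℝ := fun w => (1 - b)⁻¹ * (Real.log (b + w) - Real.log (1 + w)) with hg
  have hb' : 0 < 1 - b := by linarith
  have hd : ∀ w ∈ Set.Ici (0 : ℝ), HasDerivAt g (((b + w) * (1 + w))⁻¹) w := by
    intro w hw
    have hw0 : 0 ≤ w := hw
    have h1 : HasDerivAt (fun w => Real.log (b + w)) (1 / (b + w)) w :=
      ((hasDerivAt_id w).const_add b).log (by simp; positivity)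
    have h2 : HasDerivAt (fun w => Real.log (1 + w)) (1 / (1 + w)) w :=
      ((hasDerivAt_id w).const_add 1).log (by simp; positivity)
    have h3 : HasDerivAt g ((1 - b)⁻¹ * (1 / (b + w) - 1 / (1 + w))) w :=
      (h1.sub h2).const_mul (1 - b)⁻¹
    rwa [show (1 - b)⁻¹ * (1 / (b + w) - 1 / (1 + w)) = ((b + w) * (1 + w))⁻¹ by
      field_simp; ring] at h3
  have hlim : Tendsto g atTop (𝓝 0) := by
    have h1 : Tendsto (fun w : ℝ => 1 - (1 - b) / (1 + w)) atTop (𝓝 (1 - 0)) :=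
      tendsto_const_nhds.sub
        (tendsto_const_nhds.div_atTop (tendsto_atTop_add_const_left _ _ tendsto_id))
    have h2 := ((Real.continuousAt_log (x := 1 - 0) (by simp)).tendsto.comp h1).const_mul (1 - b)⁻¹
    rw [sub_zero, Real.log_one, mul_zero] at h2
    refine h2.congr' ?_
    filter_upwards [eventually_ge_atTop (0 : ℝ)] with w hw
    simp only [hg, Function.comp]
    rw [← Real.log_div (by positivity) (by positivity)]
    rw [show 1 - (1 - b) / (1 + w) = (b + w) / (1 + w) by field_simp; ring]
  have hpos : ∀ w ∈ Set.Ioi (0 : ℝ), 0 ≤ ((b + w) * (1 + w))⁻¹ := by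
    intro w hw
    have hw0 : 0 < w := hw
    positivity
  have hv : ∫ w : ℝ, ((b + |w|) * (1 + |w|))⁻¹ = 2 * ((1 - b)⁻¹ * -Real.log b) := by
    rw [integral_comp_abs (f := fun w => ((b + w) * (1 + w))⁻¹),
      integral_Ioi_of_hasDerivAt_of_nonneg' hd hpos hlim, hg]
    simp
  -- The integral of a non-integrable function is `0` by convention, so the nonzero value just
  -- computed forces integrability.
  refine ⟨not_imp_comm.1 integral_undef ?_, hv⟩
  rw [hv]
  have := Real.log_neg hb hb1
  have : 0 < -Real.log b := by linarith
  positivity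

/-! ### The oscillating kernel and its half-period shift. -/

/-- The oscillating kernel `exp (i s w) / ((b - i w) (1 - i w))`. -/
noncomputable def oscKer (s b w : ℝ) : ℂ :=
  Complex.exp (Complex.I * ((s * w : ℝ) : ℂ)) * (cauchyKer b w * cauchyKer 1 w)

lemma norm_exp_I_mul_ofReal (x : ℝ) : ‖Complex.exp (Complex.I * (x : ℂ))‖ = 1 := by
  rw [mul_comm, Complex.norm_exp_ofReal_mul_I]

lemma continuous_oscKer (s : ℝ) {b : ℝ} (hb : 0 < b) : Continuous (oscKer s b) := by
  have := continuous_cauchyKer hb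
  have := continuous_cauchyKer one_pos
  unfold oscKer
  fun_prop

/-- Partial fractions through the resolvent identity: the kernel becomes an oscillating difference
of Cauchy kernels, whose integral is known to vanish. -/
lemma oscKer_eq (s : ℝ) {b : ℝ} (hb : 0 < b) (hb1 : b < 1) (w : ℝ) :
    oscKer s b w = ((1 - b : ℝ) : ℂ)⁻¹ * (Complex.exp (Complex.I * ((s * w : ℝ) : ℂ)) *
      (cauchyKer b w - cauchyKer 1 w)) := by
  have h : ((1 - b : ℝ) : ℂ) ≠ 0 := by
    rw [Complex.ofReal_ne_zero]; linarith
  rw [oscKer, cauchyKer_sub (by positivity) (by positivity)]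
  push_cast at h ⊢
  field_simp
  ring

lemma norm_cauchyKer_le_two_mul {b : ℝ} (hb : 0 < b) (w : ℝ) :
    ‖cauchyKer b w‖ ≤ 2 * (b + |w|)⁻¹ := by
  rw [norm_cauchyKer, ← div_eq_mul_inv, inv_eq_one_div,
    div_le_div_iff₀ (by positivity) (by positivity), one_mul, ← div_le_iff₀' two_pos]
  refine Real.le_sqrt_of_sq_le ?_
  rw [← sq_abs w]
  nlinarith [sq_nonneg (b - |w|), sq_nonneg (b + |w|)]

lemma norm_oscKer_le (s : ℝ) {b : ℝ} (hb : 0 < b) (w : ℝ) :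
    ‖oscKer s b w‖ ≤ 4 * ((b + |w|) * (1 + |w|))⁻¹ := by
  rw [oscKer, norm_mul, norm_exp_I_mul_ofReal, one_mul, norm_mul]
  calc _ ≤ (2 * (b + |w|)⁻¹) * (2 * (1 + |w|)⁻¹) := by
        gcongr
        · exact norm_cauchyKer_le_two_mul hb w
        · exact norm_cauchyKer_le_two_mul one_pos w
    _ = _ := by rw [mul_inv]; ring

lemma integrable_oscKer (s : ℝ) {b : ℝ} (hb : 0 < b) (hb1 : b < 1) : Integrable (oscKer s b) :=
  ((integrable_inv_add_abs_mul hb hb1).1.const_mul 4).mono'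
    (continuous_oscKer s hb).aestronglyMeasurable (ae_of_all _ fun w => norm_oscKer_le s hb w)

lemma integral_inv_add_abs_mul_le {b : ℝ} (hb : 0 < b) (hb1 : b ≤ 1 / 2) :
    ∫ w : ℝ, ((b + |w|) * (1 + |w|))⁻¹ ≤ 4 * |Real.log b| := by
  rw [(integrable_inv_add_abs_mul hb (by linarith)).2,
    abs_of_neg (Real.log_neg hb (by linarith))]
  have h1 : 0 < -Real.log b := by linarith [Real.log_neg hb (by linarith)]
  have h2 : (1 - b)⁻¹ ≤ 2 := by
    rw [inv_le_comm₀ (by linarith) two_pos]; linarith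
  nlinarith

lemma integral_norm_oscKer_le (s : ℝ) {b : ℝ} (hb : 0 < b) (hb1 : b ≤ 1 / 2) :
    ∫ w, ‖oscKer s b w‖ ≤ 16 * |Real.log b| := by
  calc ∫ w, ‖oscKer s b w‖ ≤ ∫ w : ℝ, 4 * ((b + |w|) * (1 + |w|))⁻¹ :=
        integral_mono (integrable_oscKer s hb (by linarith)).norm
          ((integrable_inv_add_abs_mul hb (by linarith)).1.const_mul 4) (norm_oscKer_le s hb)
    _ ≤ _ := by
        rw [integral_const_mul]
        linarith [integral_inv_add_abs_mul_le hb hb1]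

lemma integral_oscKer {s : ℝ} (hs : 0 ≤ s) {b : ℝ} (hb : 0 < b) (hb1 : b < 1) :
    ∫ w, oscKer s b w = 0 := by
  simp_rw [oscKer_eq s hb hb1]
  rw [integral_const_mul, integral_exp_mul_cauchyKer_sub hb one_pos hs, mul_zero]

/-- The shift by half a period flips the sign of the exponential, so the sum is a difference
quotient of Cauchy kernels and gains the length `π / s` of the shift. -/
lemma norm_oscKer_add_le {s : ℝ} (hs : 0 < s) {b : ℝ} (hb : 0 < b) (hb1 : b ≤ 1 / 2) (w : ℝ) :
    ‖oscKer s b w + oscKer s b (w + Real.pi / s)‖ ≤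
      4 * (Real.pi / s) * ((b ^ 2 + w ^ 2)⁻¹ + (b ^ 2 + (w + Real.pi / s) ^ 2)⁻¹) := by
  have hb1' : b < 1 := by linarith
  set δ := Real.pi / s with hδ
  have hδ0 : 0 < δ := div_pos Real.pi_pos hs
  have he : Complex.exp (Complex.I * ((s * (w + δ) : ℝ) : ℂ)) =
      -Complex.exp (Complex.I * ((s * w : ℝ) : ℂ)) := by
    have : s * (w + δ) = s * w + Real.pi := by rw [hδ]; field_simp
    rw [this, Complex.ofReal_add, mul_add, Complex.exp_add, mul_comm Complex.I (Real.pi : ℂ),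
      Complex.exp_pi_mul_I]
    ring
  rw [oscKer_eq s hb hb1', oscKer_eq s hb hb1', he]
  have h1 := norm_cauchyKer_sub_right_le hb w (w + δ)
  have h2 := norm_cauchyKer_sub_right_le one_pos w (w + δ)
  rw [show |w - (w + δ)| = δ by rw [sub_add_cancel_left, abs_neg, abs_of_pos hδ0]] at h1 h2
  have h3 : ∀ x : ℝ, ((1 : ℝ) ^ 2 + x ^ 2)⁻¹ ≤ (b ^ 2 + x ^ 2)⁻¹ := by
    intro x; gcongr
  rw [show ((1 - b : ℝ) : ℂ)⁻¹ * (Complex.exp (Complex.I * ((s * w : ℝ) : ℂ)) *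
      (cauchyKer b w - cauchyKer 1 w)) + ((1 - b : ℝ) : ℂ)⁻¹ *
      (-Complex.exp (Complex.I * ((s * w : ℝ) : ℂ)) *
      (cauchyKer b (w + δ) - cauchyKer 1 (w + δ))) =
      ((1 - b : ℝ) : ℂ)⁻¹ * (Complex.exp (Complex.I * ((s * w : ℝ) : ℂ)) *
      ((cauchyKer b w - cauchyKer b (w + δ)) - (cauchyKer 1 w - cauchyKer 1 (w + δ)))) by ring,
    norm_mul, norm_mul, norm_exp_I_mul_ofReal, one_mul, norm_inv, Complex.norm_real,
    Real.norm_of_nonneg (by linarith)]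
  have h4 : (1 - b)⁻¹ ≤ 2 := by
    rw [inv_le_comm₀ (by linarith) two_pos]; linarith
  have h5 := h3 w
  have h6 := h3 (w + δ)
  set X := (b ^ 2 + w ^ 2)⁻¹
  set Y := (b ^ 2 + (w + δ) ^ 2)⁻¹
  calc _ ≤ 2 * (δ * (X + Y) + δ * (X + Y)) := by
        gcongr
        refine (norm_sub_le _ _).trans (add_le_add h1 (h2.trans ?_))
        gcongr
    _ = _ := by ring

lemma moment_oscKer_add {s : ℝ} (hs : 0 < s) {b : ℝ} (hb : 0 < b) (hb1 : b ≤ 1 / 2) :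
    Integrable (fun w => ‖oscKer s b w + oscKer s b (w + Real.pi / s)‖ * √|w|) ∧
    ∫ w, ‖oscKer s b w + oscKer s b (w + Real.pi / s)‖ * √|w| ≤
      4 * (Real.pi / s) * (2 * (b⁻¹ * √b * sqrtMoment) + √(Real.pi / s) * (Real.pi / b)) := by
  set δ := Real.pi / s with hδ
  have hδ0 : 0 < δ := div_pos Real.pi_pos hs
  have hA := integrable_inv_sq_add_sq_mul_sqrt hb
  have hB := integrable_inv_sq_add_sq hb
  have hbd : ∀ w, ‖oscKer s b w + oscKer s b (w + δ)‖ * √|w| ≤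
      4 * δ * ((b ^ 2 + w ^ 2)⁻¹ * √|w| + ((b ^ 2 + (w + δ) ^ 2)⁻¹ * √|w + δ| +
        √δ * (b ^ 2 + (w + δ) ^ 2)⁻¹)) := by
    intro w
    -- Subadditivity of the square root recentres the moment of the shifted term; the remainder `√δ`
    -- multiplies the mass `π / b` of the Lorentzian profile.
    have h1 : √|w| ≤ √|w + δ| + √δ := by
      rw [Real.sqrt_le_left (by positivity), add_sq, Real.sq_sqrt (abs_nonneg _),
        Real.sq_sqrt hδ0.le]
      have : |w| ≤ |w + δ| + |δ| := by
        calc |w| = |w + δ - δ| := by ring_nf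
          _ ≤ _ := abs_sub _ _
      rw [abs_of_pos hδ0] at this
      have h3 : 0 ≤ 2 * √|w + δ| * √δ := by positivity
      linarith
    calc _ ≤ (4 * δ * ((b ^ 2 + w ^ 2)⁻¹ + (b ^ 2 + (w + δ) ^ 2)⁻¹)) * √|w| := by
          gcongr; exact norm_oscKer_add_le hs hb hb1 w
      _ = 4 * δ * ((b ^ 2 + w ^ 2)⁻¹ * √|w| + (b ^ 2 + (w + δ) ^ 2)⁻¹ * √|w|) := by ring
      _ ≤ 4 * δ * ((b ^ 2 + w ^ 2)⁻¹ * √|w| +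
            (b ^ 2 + (w + δ) ^ 2)⁻¹ * (√|w + δ| + √δ)) := by gcongr
      _ = _ := by ring
  have hA' := hA.comp_add_right δ
  have hB' := hB.comp_add_right δ
  have hi := (hA.add (hA'.add (hB'.const_mul √δ))).const_mul (4 * δ)
  have hint : Integrable (fun w => ‖oscKer s b w + oscKer s b (w + δ)‖ * √|w|) := by
    refine hi.mono' ?_ (ae_of_all _ fun w => ?_)
    · have := continuous_oscKer s hb
      exact Continuous.aestronglyMeasurable (by fun_prop)
    · rw [Real.norm_of_nonneg (by positivity)]
      exact hbd w
  refine ⟨hint, (integral_mono hint hi hbd).trans (le_of_eq ?_)⟩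
  rw [integral_const_mul, integral_add' hA (hA'.add (hB'.const_mul √δ)),
    integral_add' hA' (hB'.const_mul √δ), integral_const_mul,
    integral_add_right_eq_self (fun w : ℝ => (b ^ 2 + w ^ 2)⁻¹ * √|w|) δ,
    integral_add_right_eq_self (fun w : ℝ => (b ^ 2 + w ^ 2)⁻¹) δ,
    integral_inv_sq_add_sq_mul_sqrt hb, integral_univ_inv_sq_add_sq hb]
  ring

/-! ### Geometry of the resonance function and integration over slices. -/

/-- The space of wave vectors. -/
abbrev WaveSpace (d : ℕ) := EuclideanSpace ℝ (Fin d)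

section Geometry

variable {d : ℕ} {ζ : Fin d → ℝ}

/-- The bilinear form `∑ⱼ ζⱼ x⁽ʲ⁾ y⁽ʲ⁾`. -/
def bilinZeta (ζ : Fin d → ℝ) (x y : WaveSpace d) : ℝ := ∑ j, ζ j * x j * y j

/-- The quadratic terms cancel under momentum conservation; what remains is bilinear, hence affine
in `k₃` once `k₁` is fixed. -/
lemma resOmega_eq (k k₁ y : WaveSpace d) :
    resOmega ζ k (k₁, y) = -2 * bilinZeta ζ (k₁ - k) (y - k) := by
  simp only [resOmega, normSqZeta, bilinZeta, Finset.mul_sum, ← Finset.sum_sub_distrib,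
    ← Finset.sum_add_distrib, PiLp.add_apply, PiLp.sub_apply]
  refine Finset.sum_congr rfl fun j _ => ?_
  ring

lemma bilinZeta_add_smul (x y z : WaveSpace d) (t : ℝ) :
    bilinZeta ζ x (y + t • z) = bilinZeta ζ x y + t * bilinZeta ζ x z := by
  simp only [bilinZeta, Finset.mul_sum, ← Finset.sum_add_distrib, PiLp.add_apply, PiLp.smul_apply,
    smul_eq_mul]
  refine Finset.sum_congr rfl fun j _ => ?_
  ring

lemma bilinZeta_self (x : WaveSpace d) : bilinZeta ζ x x = normSqZeta ζ x := by
  simp only [bilinZeta, normSqZeta]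
  refine Finset.sum_congr rfl fun j _ => ?_
  ring

lemma norm_sq_le_normSqZeta (hζ : ∀ j, ζ j ∈ Set.Icc (1 : ℝ) 2) (x : WaveSpace d) :
    ‖x‖ ^ 2 ≤ normSqZeta ζ x := by
  rw [EuclideanSpace.real_norm_sq_eq]
  exact Finset.sum_le_sum fun j _ => le_mul_of_one_le_left (sq_nonneg _) (hζ j).1

lemma normSqZeta_le (hζ : ∀ j, ζ j ∈ Set.Icc (1 : ℝ) 2) (x : WaveSpace d) :
    normSqZeta ζ x ≤ 2 * ‖x‖ ^ 2 := by
  rw [EuclideanSpace.real_norm_sq_eq, Finset.mul_sum]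
  exact Finset.sum_le_sum fun j _ => mul_le_mul_of_nonneg_right (hζ j).2 (sq_nonneg _)

lemma normSqZeta_nonneg (hζ : ∀ j, ζ j ∈ Set.Icc (1 : ℝ) 2) (x : WaveSpace d) :
    0 ≤ normSqZeta ζ x := (sq_nonneg _).trans (norm_sq_le_normSqZeta hζ x)

/-- The unit vector in the direction of `x`. -/
noncomputable def unitDir (x : WaveSpace d) : WaveSpace d := ‖x‖⁻¹ • x

lemma norm_unitDir_le (x : WaveSpace d) : ‖unitDir x‖ ≤ 1 := by
  rw [unitDir, norm_smul, norm_inv, norm_norm]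
  exact inv_mul_le_one

/-- The slope of the resonance function in the direction of `k₁ - k`. -/
noncomputable def resSlope (ζ : Fin d → ℝ) (x : WaveSpace d) : ℝ :=
  -2 * bilinZeta ζ x (unitDir x)

lemma resOmega_add_smul (k k₁ y : WaveSpace d) (t : ℝ) :
    resOmega ζ k (k₁, y + t • unitDir (k₁ - k)) =
      resOmega ζ k (k₁, y) + t * resSlope ζ (k₁ - k) := by
  rw [resOmega_eq, resOmega_eq, add_sub_right_comm, bilinZeta_add_smul, resSlope]
  ring

lemma norm_le_abs_resSlope (hζ : ∀ j, ζ j ∈ Set.Icc (1 : ℝ) 2) (x : WaveSpace d) :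
    ‖x‖ ≤ |resSlope ζ x| := by
  rcases eq_or_ne x 0 with rfl | hx
  · simp
  have h1 : bilinZeta ζ x (unitDir x) = ‖x‖⁻¹ * normSqZeta ζ x := by
    have := bilinZeta_add_smul (ζ := ζ) x 0 x ‖x‖⁻¹
    rw [zero_add, bilinZeta_self] at this
    rw [unitDir, this]
    simp [bilinZeta]
  have h2 := norm_sq_le_normSqZeta hζ x
  have h3 : 0 < ‖x‖ := norm_pos_iff.2 hx
  have h4 : ‖x‖ ≤ ‖x‖⁻¹ * normSqZeta ζ x := by
    rw [← div_eq_inv_mul, le_div_iff₀ h3]; nlinarith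
  rw [resSlope, h1, abs_mul, abs_of_nonneg (h3.le.trans h4)]
  norm_num
  linarith

lemma continuous_normSqZeta : Continuous (normSqZeta ζ) := by
  unfold normSqZeta; fun_prop

lemma continuous_resOmega (k : WaveSpace d) : Continuous (resOmega ζ k) := by
  have := continuous_normSqZeta (ζ := ζ)
  unfold resOmega; fun_prop

/-- The weight `(1 + |x|)^{-(d+1)}`. -/
noncomputable def decayWeight (x : WaveSpace d) : ℝ := ((1 + ‖x‖) ^ (d + 1))⁻¹

lemma decayWeight_pos (x : WaveSpace d) : 0 < decayWeight x := by
  unfold decayWeight; positivity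

lemma continuous_decayWeight : Continuous (decayWeight (d := d)) := by
  unfold decayWeight
  exact Continuous.inv₀ (by fun_prop) fun x => by positivity

lemma integrable_decayWeight : Integrable (decayWeight (d := d)) := by
  refine (integrable_one_add_norm (E := WaveSpace d) (μ := volume) (r := d + 1)
    (by simp)).congr (ae_of_all _ fun x => ?_)
  simp only [decayWeight]
  rw [Real.rpow_neg (by positivity), ← Nat.cast_succ, Real.rpow_natCast]

/-- A polynomial weight varies by a bounded factor at unit distance; this supplies the constant `κ`
of the slice estimates. -/
lemma decayWeight_add_le (x v : WaveSpace d) (hv : ‖v‖ ≤ 1) :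
    decayWeight (x + v) ≤ 2 ^ (d + 1) * decayWeight x := by
  unfold decayWeight
  rw [← div_eq_mul_inv, inv_eq_one_div, div_le_div_iff₀ (by positivity) (by positivity), one_mul,
    ← mul_pow]
  gcongr
  have : ‖x‖ ≤ ‖x + v‖ + ‖v‖ := by
    calc ‖x‖ = ‖x + v - v‖ := by rw [add_sub_cancel_right]
      _ ≤ _ := norm_sub_le _ _
  have := norm_nonneg (x + v)
  linarith

/-- The singular weight `1 + |x|^{-3/2}`. -/
noncomputable def singWeight (x : WaveSpace d) : ℝ := 1 + ‖x‖⁻¹ * (√‖x‖)⁻¹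

/-- In polar coordinates the singularity `|x|^(-3/2)` meets the Jacobian `|x|^(d-1) ≤ |x|` near the
origin, which leaves an integrable `|x|^(-1/2)` because `d ≥ 2`. Uniformity in `k` comes from
bounding the decay weight by `1` in the singular part and translating. -/
lemma exists_integral_decayWeight_mul_singWeight_le (hd : 2 ≤ d) :
    ∃ C : ℝ, 0 ≤ C ∧ ∀ k : WaveSpace d,
      Integrable (fun x => decayWeight x * singWeight (x - k)) ∧
      ∫ x, decayWeight x * singWeight (x - k) ≤ C := by
  have : Nonempty (Fin d) := ⟨⟨0, by omega⟩⟩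
  set g : WaveSpace d → ℝ := (Metric.ball 0 1).indicator fun x => ‖x‖⁻¹ * (√‖x‖)⁻¹ with hg
  have hgi : Integrable g := by
    refine IntegrableOn.integrable_indicator ?_ measurableSet_ball
    have := integrableOn_fun_norm_addHaar (E := WaveSpace d) volume (r := 1)
      (f := fun x : ℝ => x⁻¹ * (√x)⁻¹)
    rw [this]
    refine ((intervalIntegral.integrableOn_Ioo_rpow_iff one_pos).2
      (by norm_num : (-1 : ℝ) < -(1 / 2))).mono' (by fun_prop) ?_
    filter_upwards [ae_restrict_mem measurableSet_Ioo] with y hy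
    have h0 : 0 < y := hy.1
    rw [Real.norm_of_nonneg (by positivity), smul_eq_mul, Real.rpow_neg h0.le, ← Real.sqrt_eq_rpow,
      ← mul_assoc]
    refine mul_le_of_le_one_left (by positivity) ?_
    rw [← div_eq_mul_inv, div_le_one h0]
    refine pow_le_of_le_one h0.le hy.2.le ?_
    simp only [finrank_euclideanSpace, Fintype.card_fin]
    omega
  have hg0 : ∀ x, 0 ≤ g x := fun x => Set.indicator_nonneg (fun x _ => by positivity) x
  have hle : ∀ x k : WaveSpace d, decayWeight x * singWeight (x - k) ≤
      2 * decayWeight x + g (x - k) := by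
    intro x k
    have h1 : decayWeight x ≤ 1 := by
      unfold decayWeight
      exact inv_le_one_of_one_le₀ (one_le_pow₀ (by linarith [norm_nonneg x]))
    have h2 : singWeight (x - k) ≤ 2 + g (x - k) := by
      unfold singWeight
      by_cases hx : ‖x - k‖ < 1
      · rw [hg, Set.indicator_of_mem (by simpa using hx)]
        linarith
      · rw [hg, Set.indicator_of_notMem (by simpa using hx)]
        have h3 : 1 ≤ ‖x - k‖ := not_lt.1 hx
        have h4 := inv_le_one_of_one_le₀ h3
        have h5 := inv_le_one_of_one_le₀ (Real.one_le_sqrt.2 h3)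
        have : ‖x - k‖⁻¹ * (√‖x - k‖)⁻¹ ≤ 1 := mul_le_one₀ h4 (by positivity) h5
        linarith
    have h6 := decayWeight_pos x
    nlinarith [hg0 (x - k), mul_le_mul_of_nonneg_left h2 h6.le]
  have hs0 : ∀ x : WaveSpace d, 0 ≤ singWeight x := fun x => by unfold singWeight; positivity
  have hmaj : ∀ k, Integrable fun x => 2 * decayWeight x + g (x - k) := fun k =>
    (integrable_decayWeight.const_mul 2).add (hgi.comp_sub_right k)
  have hint : ∀ k : WaveSpace d, Integrable (fun x => decayWeight x * singWeight (x - k)) := by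
    intro k
    refine (hmaj k).mono' ?_ (ae_of_all _ fun x => ?_)
    · have := continuous_decayWeight (d := d)
      have h : Measurable (singWeight (d := d)) := by unfold singWeight; fun_prop
      exact (this.measurable.mul (h.comp (measurable_id.sub_const k))).aestronglyMeasurable
    · rw [Real.norm_of_nonneg (mul_nonneg (decayWeight_pos x).le (hs0 _))]
      exact hle x k
  refine ⟨∫ x, 2 * decayWeight x + g x, integral_nonneg fun x => ?_, fun k => ⟨hint k, ?_⟩⟩
  · have := decayWeight_pos x
    have := hg0 x
    positivity
  · refine (integral_mono (hint k) (hmaj k) fun x => hle x k).trans (le_of_eq ?_)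
    rw [integral_add (integrable_decayWeight.const_mul 2) (hgi.comp_sub_right k),
      integral_add (integrable_decayWeight.const_mul 2) hgi, integral_sub_right_eq_self]

/-- The weight of an integrand on the space of pairs `(k₁, k₃)`. -/
noncomputable def pairWeight (p : WaveSpace d × WaveSpace d) : ℝ :=
  decayWeight p.1 * decayWeight p.2

lemma pairWeight_pos (p : WaveSpace d × WaveSpace d) : 0 < pairWeight p :=
  mul_pos (decayWeight_pos _) (decayWeight_pos _)

lemma integrable_pairWeight : Integrable (pairWeight (d := d)) :=
  integrable_decayWeight.mul_prod integrable_decayWeight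

lemma inv_abs_resSlope_mul_le (hζ : ∀ j, ζ j ∈ Set.Icc (1 : ℝ) 2) {x : WaveSpace d} (hx : x ≠ 0) :
    |resSlope ζ x|⁻¹ * (√|resSlope ζ x|)⁻¹ ≤ singWeight x := by
  have h1 := norm_le_abs_resSlope hζ x
  have h2 : 0 < ‖x‖ := norm_pos_iff.2 hx
  have h3 : 0 < √‖x‖ := Real.sqrt_pos.2 h2
  calc _ ≤ ‖x‖⁻¹ * (√‖x‖)⁻¹ := by gcongr
    _ ≤ _ := by unfold singWeight; linarith

/-- The same singular weight also absorbs the milder loss `|x|⁻¹`: for `|x| ≤ 1` it is below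
`|x|^(-3/2)`, otherwise below `1`. -/
lemma inv_abs_resSlope_le (hζ : ∀ j, ζ j ∈ Set.Icc (1 : ℝ) 2) {x : WaveSpace d} (hx : x ≠ 0) :
    |resSlope ζ x|⁻¹ ≤ singWeight x := by
  have h1 := norm_le_abs_resSlope hζ x
  have h2 : 0 < ‖x‖ := norm_pos_iff.2 hx
  have h3 : 0 < √‖x‖ := Real.sqrt_pos.2 h2
  have h4 : |resSlope ζ x|⁻¹ ≤ ‖x‖⁻¹ := by gcongr
  refine h4.trans ?_
  unfold singWeight
  rcases le_total 1 ‖x‖ with h | h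
  · have := inv_le_one_of_one_le₀ h
    have : 0 ≤ ‖x‖⁻¹ * (√‖x‖)⁻¹ := by positivity
    linarith
  · have h5 : 1 ≤ (√‖x‖)⁻¹ := (one_le_inv₀ h3).2 (Real.sqrt_le_one.2 h)
    have : ‖x‖⁻¹ * 1 ≤ ‖x‖⁻¹ * (√‖x‖)⁻¹ := by gcongr
    linarith

lemma resSlope_ne_zero (hζ : ∀ j, ζ j ∈ Set.Icc (1 : ℝ) 2) {x : WaveSpace d} (hx : x ≠ 0) :
    resSlope ζ x ≠ 0 :=
  abs_pos.1 ((norm_pos_iff.2 hx).trans_le (norm_le_abs_resSlope hζ x))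

lemma ae_sub_ne_zero (hd : 2 ≤ d) (k : WaveSpace d) : ∀ᵐ x : WaveSpace d, x - k ≠ 0 := by
  have : Nonempty (Fin d) := ⟨⟨0, by omega⟩⟩
  simpa [sub_eq_zero] using Measure.ae_ne volume k

/-- Integration of bounds for the slices. -/
lemma exists_norm_integral_pair_le (hd : 2 ≤ d) :
    ∃ C : ℝ, 0 ≤ C ∧ ∀ (k : WaveSpace d) (D : ℝ), 0 ≤ D →
      ∀ Φ : WaveSpace d × WaveSpace d → ℂ, Integrable Φ →
      (∀ k₁, k₁ - k ≠ 0 → ‖∫ y, Φ (k₁, y)‖ ≤ D * (decayWeight k₁ * singWeight (k₁ - k))) →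
      ‖∫ p, Φ p‖ ≤ C * D := by
  obtain ⟨C, hC0, hC⟩ := exists_integral_decayWeight_mul_singWeight_le hd
  refine ⟨C, hC0, fun k D hD Φ hΦ h => ?_⟩
  rw [Measure.volume_eq_prod, integral_prod _ hΦ]
  refine (norm_integral_le_of_norm_le ((hC k).1.const_mul D) ?_).trans ?_
  · filter_upwards [ae_sub_ne_zero hd k] with k₁ hk₁ using h k₁ hk₁
  · rw [integral_const_mul, mul_comm C]
    gcongr
    exact (hC k).2

lemma slice_weight (k₁ : WaveSpace d) {M : ℝ} (hM : 0 ≤ M) (x : WaveSpace d) :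
    ∀ y, ∀ t : ℝ, |t| ≤ 1 → M * pairWeight (k₁, y + t • unitDir x) ≤
      2 ^ (d + 1) * (M * pairWeight (k₁, y)) := by
  intro y t ht
  have h1 : ‖t • unitDir x‖ ≤ 1 := by
    rw [norm_smul]
    exact mul_le_one₀ ht (norm_nonneg _) (norm_unitDir_le x)
  have := decayWeight_add_le y _ h1
  have h2 := decayWeight_pos k₁
  simp only [pairWeight]
  calc _ ≤ M * (decayWeight k₁ * (2 ^ (d + 1) * decayWeight y)) := by gcongr
    _ = _ := by ring

lemma integral_slice_weight (k₁ : WaveSpace d) (M : ℝ) :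
    ∫ y, M * pairWeight (k₁, y) = M * (∫ y : WaveSpace d, decayWeight y) * decayWeight k₁ := by
  simp only [pairWeight]
  rw [integral_const_mul, integral_const_mul]
  ring

lemma integrable_slice_weight (k₁ : WaveSpace d) (M : ℝ) :
    Integrable fun y => M * pairWeight (k₁, y) := by
  simp only [pairWeight]
  exact (integrable_decayWeight.const_mul _).const_mul _

lemma continuous_slice_weight (k₁ : WaveSpace d) (M : ℝ) :
    Continuous fun y => M * pairWeight (k₁, y) := by
  have := continuous_decayWeight (d := d)
  simp only [pairWeight]
  fun_prop

lemma integral_decayWeight_nonneg : 0 ≤ ∫ y : WaveSpace d, decayWeight y :=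
  integral_nonneg fun y => (decayWeight_pos y).le

/-- The integral of kernels of vanishing integral in the resonance function is controlled by the
Hölder moment of a majorant. -/
lemma exists_norm_integral_comp_resOmega_le (hd : 2 ≤ d) (hζ : ∀ j, ζ j ∈ Set.Icc (1 : ℝ) 2) :
    ∃ C : ℝ, 0 ≤ C ∧ ∀ (k : WaveSpace d) (M : ℝ), 0 ≤ M → ∀ m : ℝ → ℝ, (∀ w, 0 ≤ m w) →
      Integrable (fun w => m w * √|w|) → ∀ Q : WaveSpace d × WaveSpace d → ℝ → ℂ,
      Integrable (fun p => Q p (resOmega ζ k p)) →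
      (∀ k₁, Integrable fun y => Q (k₁, y) (resOmega ζ k (k₁, y))) →
      (∀ p, resOmega ζ k p = 0 → Integrable (Q p) ∧ ∫ w, Q p w = 0) →
      (∀ p, ‖Q p (resOmega ζ k p)‖ ≤ M * pairWeight p * m (resOmega ζ k p)) →
      (∀ p, resOmega ζ k p = 0 → ∀ w, ‖Q p w‖ ≤ M * pairWeight p * m w) →
      (∀ k₁ y y₀, resOmega ζ k (k₁, y₀) = 0 → ‖y - y₀‖ ≤ 1 →
        ‖Q (k₁, y) (resOmega ζ k (k₁, y)) - Q (k₁, y₀) (resOmega ζ k (k₁, y))‖ ≤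
          M * pairWeight (k₁, y) * m (resOmega ζ k (k₁, y)) * ‖y - y₀‖) →
      ‖∫ p, Q p (resOmega ζ k p)‖ ≤ C * (M * ∫ w, m w * √|w|) := by
  obtain ⟨C, hC0, hC⟩ := exists_norm_integral_pair_le hd
  have hI := integral_decayWeight_nonneg (d := d)
  refine ⟨C * (3 * 2 ^ (d + 1) * ∫ y : WaveSpace d, decayWeight y), by positivity, ?_⟩
  intro k M hM m hm0 hmi Q hQp hQs hQ0 hQb hQb' hQl
  have hJ : 0 ≤ ∫ w, m w * √|w| := integral_nonneg fun w => mul_nonneg (hm0 w) (Real.sqrt_nonneg _)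
  rw [mul_assoc]
  refine hC k _ (by positivity) _ hQp fun k₁ hk₁ => ?_
  have key := norm_integral_comp_affine_le (μ := volume) (l := fun y => resOmega ζ k (k₁, y))
    (norm_unitDir_le (k₁ - k)) (resSlope_ne_zero hζ hk₁)
    (fun y t => resOmega_add_smul k k₁ y t) (W := fun y => M * pairWeight (k₁, y))
    (fun y => mul_nonneg hM (pairWeight_pos _).le) (integrable_slice_weight k₁ M)
    (κ := 2 ^ (d + 1)) (by positivity) (slice_weight k₁ hM (k₁ - k)) hm0 hmi
    (Q := fun y => Q (k₁, y)) (hQs k₁) (fun y hy => (hQ0 _ hy).1) (fun y hy => (hQ0 _ hy).2)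
    (fun y => hQb _) (fun y hy => hQb' _ hy) (fun y y₀ => hQl k₁ y y₀)
  refine key.trans ?_
  rw [integral_slice_weight]
  have h1 := inv_abs_resSlope_mul_le hζ hk₁
  have h2 := decayWeight_pos k₁
  generalize (∫ y : WaveSpace d, decayWeight y) = I at *
  generalize (∫ w, m w * √|w|) = J at *
  calc _ ≤ 3 * 2 ^ (d + 1) * (M * I * decayWeight k₁) * (singWeight (k₁ - k) * J) := by gcongr
    _ = _ := by ring

/-- The weighted integral of a function of the resonance function. -/
lemma exists_integral_pairWeight_mul_comp_resOmega_le (hd : 2 ≤ d)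
    (hζ : ∀ j, ζ j ∈ Set.Icc (1 : ℝ) 2) :
    ∃ C : ℝ, 0 ≤ C ∧ ∀ (k : WaveSpace d) (m : ℝ → ℝ), Continuous m → (∀ w, 0 ≤ m w) →
      Integrable m → Integrable (fun p => pairWeight p * m (resOmega ζ k p)) →
      ∫ p, pairWeight p * m (resOmega ζ k p) ≤ C * ∫ w, m w := by
  obtain ⟨C, hC0, hC⟩ := exists_norm_integral_pair_le hd
  have hI := integral_decayWeight_nonneg (d := d)
  refine ⟨C * (2 ^ (d + 1) * ∫ y : WaveSpace d, decayWeight y), by positivity, ?_⟩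
  intro k m hmc hm0 hmi hpi
  have hJ : 0 ≤ ∫ w, m w := integral_nonneg hm0
  have hnn : 0 ≤ ∫ p, pairWeight p * m (resOmega ζ k p) :=
    integral_nonneg fun p => mul_nonneg (pairWeight_pos p).le (hm0 _)
  rw [← abs_of_nonneg hnn, ← Real.norm_eq_abs, ← Complex.norm_real, ← integral_complex_ofReal,
    mul_assoc]
  refine hC k _ (by positivity) _ hpi.ofReal fun k₁ hk₁ => ?_
  have hk := continuous_resOmega (ζ := ζ) k
  obtain ⟨-, key⟩ := integral_weight_mul_comp_affine_le (μ := volume)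
    (l := fun y => resOmega ζ k (k₁, y)) (by fun_prop) (resSlope_ne_zero hζ hk₁)
    (fun y t => resOmega_add_smul k k₁ y t) (W := fun y => 1 * pairWeight (k₁, y))
    (continuous_slice_weight k₁ 1).measurable
    (fun y => mul_nonneg zero_le_one (pairWeight_pos _).le) (integrable_slice_weight k₁ 1)
    (κ := 2 ^ (d + 1)) (by positivity) (fun y t ht => slice_weight k₁ zero_le_one (k₁ - k) y t
      (by rw [abs_of_nonneg ht.1]; exact ht.2)) hmc.measurable hm0 hmi
  rw [integral_complex_ofReal, Complex.norm_real, Real.norm_of_nonneg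
    (integral_nonneg fun p => mul_nonneg (pairWeight_pos _).le (hm0 _))]
  rw [integral_slice_weight] at key
  simp only [one_mul] at key
  refine key.trans ?_
  have h1 := inv_abs_resSlope_le hζ hk₁
  have h2 := decayWeight_pos k₁
  generalize (∫ y : WaveSpace d, decayWeight y) = I at *
  generalize (∫ w, m w) = J at *
  calc _ ≤ 2 ^ (d + 1) * (I * decayWeight k₁) * (singWeight (k₁ - k) * J) := by gcongr
    _ = _ := by ring

/-- The effect of a shift of the kernel. -/
lemma exists_norm_integral_shift_comp_resOmega_le (hd : 2 ≤ d)
    (hζ : ∀ j, ζ j ∈ Set.Icc (1 : ℝ) 2) :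
    ∃ C : ℝ, 0 ≤ C ∧ ∀ (k : WaveSpace d) (M : ℝ), 0 ≤ M → ∀ H : ℝ → ℂ, Measurable H →
      Integrable H → ∀ A : WaveSpace d × WaveSpace d → ℂ, Continuous A →
      (∀ p, ‖A p‖ ≤ M * pairWeight p) →
      (∀ k₁ y y', ‖y - y'‖ ≤ 1 → ‖A (k₁, y) - A (k₁, y')‖ ≤ M * pairWeight (k₁, y) * ‖y - y'‖) →
      ∀ δ : ℝ, Integrable (fun p => (H (resOmega ζ k p) - H (resOmega ζ k p + δ)) * A p) →
      ‖∫ p, (H (resOmega ζ k p) - H (resOmega ζ k p + δ)) * A p‖ ≤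
        C * (M * (√|δ| * ∫ w, ‖H w‖)) := by
  obtain ⟨C, hC0, hC⟩ := exists_norm_integral_pair_le hd
  have hI := integral_decayWeight_nonneg (d := d)
  refine ⟨C * (2 * 2 ^ (d + 1) * ∫ y : WaveSpace d, decayWeight y), by positivity, ?_⟩
  intro k M hM H hHm hHi A hAc hAb hAl δ hint
  have hJ : 0 ≤ ∫ w, ‖H w‖ := integral_nonneg fun w => norm_nonneg _
  rw [mul_assoc]
  refine hC k _ (by positivity) _ hint fun k₁ hk₁ => ?_
  have hk := continuous_resOmega (ζ := ζ) k
  have key := norm_integral_shift_comp_affine_le (μ := volume)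
    (l := fun y => resOmega ζ k (k₁, y)) (by fun_prop) (norm_unitDir_le (k₁ - k))
    (resSlope_ne_zero hζ hk₁)
    (fun y t => resOmega_add_smul k k₁ y t) (W := fun y => M * pairWeight (k₁, y))
    (continuous_slice_weight k₁ M).measurable
    (fun y => mul_nonneg hM (pairWeight_pos _).le) (integrable_slice_weight k₁ M)
    (κ := 2 ^ (d + 1)) (by positivity) (slice_weight k₁ hM (k₁ - k)) hHm hHi
    (A := fun y => A (k₁, y)) (by fun_prop) (fun y => hAb _) (fun y y' => hAl k₁ y y') δ
  refine key.trans ?_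
  rw [integral_slice_weight]
  have h1 := inv_abs_resSlope_mul_le hζ hk₁
  have h2 := decayWeight_pos k₁
  generalize (∫ y : WaveSpace d, decayWeight y) = I at *
  generalize (∫ w, ‖H w‖) = J at *
  calc _ ≤ 2 * 2 ^ (d + 1) * (M * I * decayWeight k₁) * (singWeight (k₁ - k) * √|δ| * J) := by
        gcongr
    _ = _ := by ring

end Geometry

/-! ### Weighted amplitudes, multipliers and the lower bound for the denominators. -/

section Amplitudes

variable {d : ℕ} {ζ : Fin d → ℝ} {r : ℝ}

/-- The product `(1 + |k₁|) (1 + |k₂|) (1 + |k₃|)`. -/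
noncomputable def pairBracket (k : WaveSpace d) (p : WaveSpace d × WaveSpace d) : ℝ :=
  (1 + ‖p.1‖) * (1 + ‖p.1 + p.2 - k‖) * (1 + ‖p.2‖)

lemma one_add_norm_fst_le (k : WaveSpace d) (p : WaveSpace d × WaveSpace d) :
    1 + ‖p.1‖ ≤ pairBracket k p := by
  unfold pairBracket
  have h1 := norm_nonneg p.1
  have h2 := norm_nonneg (p.1 + p.2 - k)
  have h3 := norm_nonneg p.2
  rw [mul_assoc]
  exact le_mul_of_one_le_right (by positivity) (by nlinarith)

lemma one_add_norm_snd_le (k : WaveSpace d) (p : WaveSpace d × WaveSpace d) :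
    1 + ‖p.2‖ ≤ pairBracket k p := by
  unfold pairBracket
  have h1 := norm_nonneg p.1
  have h2 := norm_nonneg (p.1 + p.2 - k)
  have h3 := norm_nonneg p.2
  exact le_mul_of_one_le_left (by positivity) (by nlinarith)

lemma one_add_norm_mid_le (k : WaveSpace d) (p : WaveSpace d × WaveSpace d) :
    1 + ‖p.1 + p.2 - k‖ ≤ pairBracket k p := by
  unfold pairBracket
  have h1 := norm_nonneg p.1
  have h2 := norm_nonneg (p.1 + p.2 - k)
  have h3 := norm_nonneg p.2
  rw [mul_comm (1 + ‖p.1‖), mul_assoc]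
  exact le_mul_of_one_le_right (by positivity) (by nlinarith)

/-- Follows from `k = k₁ - k₂ + k₃`. Polynomial growth in the external momentum can thus be paid for
by the decay of the amplitude, which keeps the constants uniform in `k`. -/
lemma one_add_norm_le_pairBracket (k : WaveSpace d) (p : WaveSpace d × WaveSpace d) :
    1 + ‖k‖ ≤ pairBracket k p := by
  have h : ‖k‖ ≤ ‖p.1‖ + ‖p.1 + p.2 - k‖ + ‖p.2‖ := by
    calc ‖k‖ = ‖(p.1 - (p.1 + p.2 - k)) + p.2‖ := by congr 1; abel
      _ ≤ ‖p.1‖ + ‖p.1 + p.2 - k‖ + ‖p.2‖ :=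
        (norm_add_le _ _).trans (by gcongr; exact norm_sub_le _ _)
  unfold pairBracket
  have h1 := norm_nonneg p.1
  have h2 := norm_nonneg (p.1 + p.2 - k)
  have h3 := norm_nonneg p.2
  nlinarith [mul_nonneg h1 h2, mul_nonneg h2 h3, mul_nonneg h1 h3, mul_nonneg (mul_nonneg h1 h2) h3]

lemma one_le_pairBracket (k : WaveSpace d) (p : WaveSpace d × WaveSpace d) :
    1 ≤ pairBracket k p := by
  have := one_add_norm_fst_le k p
  linarith [norm_nonneg p.1]

lemma inv_pairBracket_pow_le (k : WaveSpace d) (p : WaveSpace d × WaveSpace d) :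
    (pairBracket k p ^ (d + 1))⁻¹ ≤ pairWeight p := by
  unfold pairWeight decayWeight pairBracket
  rw [← mul_inv, ← mul_pow]
  have h2 := norm_nonneg (p.1 + p.2 - k)
  gcongr
  exact le_mul_of_one_le_right (by positivity) (by linarith)

/-- Amplitudes that decay and are Lipschitz continuous in `k₃`, with weights. -/
structure TameAmplitude (k : WaveSpace d) (n : ℕ) (M : ℝ) (A : WaveSpace d × WaveSpace d → ℂ) :
    Prop where
  continuous : Continuous A
  bound : ∀ p, ‖A p‖ ≤ M * (pairBracket k p ^ n)⁻¹
  lipschitz : ∀ k₁ y y', ‖y - y'‖ ≤ 1 →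
    ‖A (k₁, y) - A (k₁, y')‖ ≤ M * (pairBracket k (k₁, y) ^ n)⁻¹ * ‖y - y'‖

/-- Multipliers of quadratic growth. -/
structure QuadMultiplier (k : WaveSpace d) (L : ℝ) (g : WaveSpace d × WaveSpace d → ℂ) :
    Prop where
  continuous : Continuous g
  bound : ∀ p, ‖g p‖ ≤ L * pairBracket k p ^ 2
  lipschitz : ∀ k₁ y y', ‖y - y'‖ ≤ 1 →
    ‖g (k₁, y) - g (k₁, y')‖ ≤ L * pairBracket k (k₁, y) ^ 2 * ‖y - y'‖

lemma TameAmplitude.nonneg {k : WaveSpace d} {n : ℕ} {M : ℝ} {A : WaveSpace d × WaveSpace d → ℂ}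
    (hA : TameAmplitude k n M A) : 0 ≤ M := by
  have h := (norm_nonneg _).trans (hA.bound 0)
  have := one_le_pairBracket k 0
  exact nonneg_of_mul_nonneg_left h (by positivity)

lemma QuadMultiplier.nonneg {k : WaveSpace d} {L : ℝ} {g : WaveSpace d × WaveSpace d → ℂ}
    (hg : QuadMultiplier k L g) : 0 ≤ L := by
  have h := (norm_nonneg _).trans (hg.bound 0)
  have := one_le_pairBracket k 0
  exact nonneg_of_mul_nonneg_left h (by positivity)

/-- The Leibniz rule, at the cost of two powers of decay. The factor `3` is `1 + 2`: the value of
`g` at the displaced point is at most twice the bound at the base point. -/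
lemma QuadMultiplier.mul {k : WaveSpace d} {n : ℕ} {M L : ℝ} {A g : WaveSpace d × WaveSpace d → ℂ}
    (hg : QuadMultiplier k L g) (hA : TameAmplitude k (n + 2) M A) :
    TameAmplitude k n (3 * L * M) fun p => g p * A p := by
  have hM := hA.nonneg
  have hL := hg.nonneg
  have hP : ∀ p, 0 < pairBracket k p := fun p => one_pos.trans_le (one_le_pairBracket k p)
  have hpow : ∀ p, pairBracket k p ^ 2 * (pairBracket k p ^ (n + 2))⁻¹ =
      (pairBracket k p ^ n)⁻¹ := by
    intro p
    have := hP p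
    rw [pow_add]
    field_simp
  refine ⟨hg.continuous.mul hA.continuous, fun p => ?_, fun k₁ y y' hy => ?_⟩
  · have := hP p
    rw [norm_mul]
    calc _ ≤ (L * pairBracket k p ^ 2) * (M * (pairBracket k p ^ (n + 2))⁻¹) := by
          gcongr
          · exact hg.bound p
          · exact hA.bound p
      _ = L * M * (pairBracket k p ^ n)⁻¹ := by rw [← hpow]; ring
      _ ≤ _ := by
          gcongr
          nlinarith
  · have hp := hP (k₁, y)
    have h1 := hg.bound (k₁, y)
    have h2 := hg.lipschitz k₁ y y' hy
    have h3 := hA.bound (k₁, y)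
    have h4 := hA.lipschitz k₁ y y' hy
    have h5 : ‖g (k₁, y')‖ ≤ 2 * L * pairBracket k (k₁, y) ^ 2 := by
      have e : g (k₁, y') = g (k₁, y) - (g (k₁, y) - g (k₁, y')) := by ring
      rw [e]
      refine (norm_sub_le _ _).trans ?_
      have : L * pairBracket k (k₁, y) ^ 2 * ‖y - y'‖ ≤ L * pairBracket k (k₁, y) ^ 2 * 1 := by
        gcongr
      linarith
    rw [show g (k₁, y) * A (k₁, y) - g (k₁, y') * A (k₁, y') =
      (g (k₁, y) - g (k₁, y')) * A (k₁, y) + g (k₁, y') * (A (k₁, y) - A (k₁, y')) by ring]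
    refine (norm_add_le _ _).trans ?_
    rw [norm_mul, norm_mul, ← hpow]
    calc _ ≤ (L * pairBracket k (k₁, y) ^ 2 * ‖y - y'‖) *
            (M * (pairBracket k (k₁, y) ^ (n + 2))⁻¹) +
          (2 * L * pairBracket k (k₁, y) ^ 2) *
            (M * (pairBracket k (k₁, y) ^ (n + 2))⁻¹ * ‖y - y'‖) := by gcongr
      _ = _ := by ring

lemma integrable_of_norm_le_pairWeight {Φ : WaveSpace d × WaveSpace d → ℂ} (hc : Continuous Φ)
    {K : ℝ} (hK : ∀ p, ‖Φ p‖ ≤ K * pairWeight p) :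
    Integrable Φ ∧ ∀ k₁, Integrable fun y => Φ (k₁, y) :=
  ⟨(integrable_pairWeight.const_mul K).mono' hc.aestronglyMeasurable (ae_of_all _ hK),
    fun k₁ => (integrable_slice_weight k₁ K).mono'
      (Continuous.aestronglyMeasurable (by fun_prop)) (ae_of_all _ fun y => hK _)⟩

lemma TameAmplitude.norm_le {k : WaveSpace d} {M : ℝ} {A : WaveSpace d × WaveSpace d → ℂ}
    (hA : TameAmplitude k (d + 1) M A) (p : WaveSpace d × WaveSpace d) :
    ‖A p‖ ≤ M * pairWeight p :=
  (hA.bound p).trans (mul_le_mul_of_nonneg_left (inv_pairBracket_pow_le k p) hA.nonneg)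

lemma TameAmplitude.norm_sub_le {k : WaveSpace d} {M : ℝ} {A : WaveSpace d × WaveSpace d → ℂ}
    (hA : TameAmplitude k (d + 1) M A) (k₁ y y' : WaveSpace d) (hy : ‖y - y'‖ ≤ 1) :
    ‖A (k₁, y) - A (k₁, y')‖ ≤ M * pairWeight (k₁, y) * ‖y - y'‖ := by
  refine (hA.lipschitz k₁ y y' hy).trans ?_
  have := hA.nonneg
  gcongr
  exact inv_pairBracket_pow_le k _

lemma TameAmplitude.integrable_comp_mul {k : WaveSpace d} {M : ℝ}
    {A : WaveSpace d × WaveSpace d → ℂ} (hA : TameAmplitude k (d + 1) M A) {h : ℝ → ℂ}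
    (hc : Continuous h) {K : ℝ} (hK : ∀ w, ‖h w‖ ≤ K) :
    Integrable (fun p => h (resOmega ζ k p) * A p) ∧
      ∀ k₁, Integrable fun y => h (resOmega ζ k (k₁, y)) * A (k₁, y) := by
  refine integrable_of_norm_le_pairWeight (Φ := fun p => h (resOmega ζ k p) * A p)
    (K := K * M) ?_ fun p => ?_
  · exact (hc.comp (continuous_resOmega k)).mul hA.continuous
  · have hM := hA.nonneg
    have hK0 := (norm_nonneg _).trans (hK 0)
    rw [norm_mul, mul_assoc]
    gcongr
    · exact hK _
    · exact hA.norm_le p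

/-- Kernels of vanishing integral, for tame amplitudes. -/
lemma exists_norm_integral_kernel_mul_le (hd : 2 ≤ d) (hζ : ∀ j, ζ j ∈ Set.Icc (1 : ℝ) 2) :
    ∃ C : ℝ, 0 ≤ C ∧ ∀ (k : WaveSpace d) (M : ℝ) (A : WaveSpace d × WaveSpace d → ℂ),
      TameAmplitude k (d + 1) M A → ∀ h : ℝ → ℂ, Continuous h → (∃ K, ∀ w, ‖h w‖ ≤ K) →
      Integrable h → ∫ w, h w = 0 → Integrable (fun w => ‖h w‖ * √|w|) →
      ‖∫ p, h (resOmega ζ k p) * A p‖ ≤ C * (M * ∫ w, ‖h w‖ * √|w|) := by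
  obtain ⟨C, hC0, hC⟩ := exists_norm_integral_comp_resOmega_le hd hζ
  refine ⟨C, hC0, fun k M A hA h hc ⟨K, hK⟩ hi h0 hm => ?_⟩
  obtain ⟨hp, hs⟩ := hA.integrable_comp_mul (ζ := ζ) hc hK
  refine hC k M hA.nonneg (fun w => ‖h w‖) (fun w => norm_nonneg _) hm (fun p w => h w * A p)
    hp hs (fun p _ => ⟨hi.mul_const _, by rw [integral_mul_const, h0, zero_mul]⟩)
    (fun p => ?_) (fun p _ w => ?_) (fun k₁ y y₀ _ hy => ?_)
  · rw [norm_mul, mul_comm]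
    gcongr
    exact hA.norm_le p
  · rw [norm_mul, mul_comm]
    gcongr
    exact hA.norm_le p
  · rw [← mul_sub, norm_mul]
    calc _ ≤ ‖h (resOmega ζ k (k₁, y))‖ * (M * pairWeight (k₁, y) * ‖y - y₀‖) := by
          gcongr
          exact hA.norm_sub_le k₁ y y₀ hy
      _ = _ := by ring

lemma abs_bilinZeta_le (hζ : ∀ j, ζ j ∈ Set.Icc (1 : ℝ) 2) (x y : WaveSpace d) :
    |bilinZeta ζ x y| ≤ 2 * (‖x‖ * ‖y‖) := by
  have h1 : |bilinZeta ζ x y| ≤ 2 * ∑ j, |x j| * |y j| := by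
    unfold bilinZeta
    refine (Finset.abs_sum_le_sum_abs _ _).trans ?_
    rw [Finset.mul_sum]
    refine Finset.sum_le_sum fun j _ => ?_
    have := (hζ j).1
    rw [abs_mul, abs_mul, abs_of_nonneg (by linarith), mul_assoc]
    gcongr
    exact (hζ j).2
  refine h1.trans ?_
  gcongr
  refine abs_le_of_sq_le_sq' ?_ (by positivity) |>.2
  rw [mul_pow, EuclideanSpace.real_norm_sq_eq, EuclideanSpace.real_norm_sq_eq]
  simpa using Finset.sum_mul_sq_le_sq_mul_sq Finset.univ (fun j => |x j|) (fun j => |y j|)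

lemma normSqZeta_sub (x y : WaveSpace d) :
    normSqZeta ζ x - normSqZeta ζ y = bilinZeta ζ (x - y) (x + y) := by
  simp only [normSqZeta, bilinZeta, ← Finset.sum_sub_distrib, PiLp.add_apply, PiLp.sub_apply]
  refine Finset.sum_congr rfl fun j _ => ?_
  ring

lemma abs_normSqZeta_sub_le (hζ : ∀ j, ζ j ∈ Set.Icc (1 : ℝ) 2) {x y : WaveSpace d}
    (h : ‖x - y‖ ≤ 1) :
    |normSqZeta ζ x - normSqZeta ζ y| ≤ 4 * (1 + ‖x‖) ^ 2 * ‖x - y‖ := by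
  rw [normSqZeta_sub]
  refine (abs_bilinZeta_le hζ _ _).trans ?_
  have h1 : ‖x + y‖ ≤ 2 * ‖x‖ + 1 := by
    calc ‖x + y‖ = ‖x + x - (x - y)‖ := by congr 1; abel
      _ ≤ ‖x‖ + ‖x‖ + ‖x - y‖ := (norm_sub_le _ _).trans (by gcongr; exact norm_add_le _ _)
      _ ≤ _ := by linarith
  have h2 := norm_nonneg x
  calc 2 * (‖x - y‖ * ‖x + y‖) ≤ 2 * (‖x - y‖ * (2 * ‖x‖ + 1)) := by gcongr
    _ = 2 * (2 * ‖x‖ + 1) * ‖x - y‖ := by ring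
    _ ≤ _ := mul_le_mul_of_nonneg_right (by nlinarith) (norm_nonneg _)

lemma normSqZeta_le_bracket (hζ : ∀ j, ζ j ∈ Set.Icc (1 : ℝ) 2) (x : WaveSpace d) :
    1 + normSqZeta ζ x ≤ 2 * (1 + ‖x‖) ^ 2 := by
  nlinarith [normSqZeta_le hζ x, norm_nonneg x]

lemma one_le_dissip (hζ : ∀ j, ζ j ∈ Set.Icc (1 : ℝ) 2) (hr : r ∈ Set.Ioc (0 : ℝ) 1)
    (x : WaveSpace d) : 1 ≤ dissip ζ r x :=
  Real.one_le_rpow (by linarith [normSqZeta_nonneg hζ x]) hr.1.le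

lemma dissip_le (hζ : ∀ j, ζ j ∈ Set.Icc (1 : ℝ) 2) (hr : r ∈ Set.Ioc (0 : ℝ) 1)
    (x : WaveSpace d) : dissip ζ r x ≤ 2 * (1 + ‖x‖) ^ 2 :=
  (Real.rpow_le_self_of_one_le (by linarith [normSqZeta_nonneg hζ x]) hr.2).trans
    (normSqZeta_le_bracket hζ x)

/-- On `[1, ∞)` the power `x^r`, `r ≤ 1`, has slope at most one. The proof factors out the smaller
base and uses `u^r ≤ u` for `u ≥ 1`. -/
lemma abs_rpow_sub_rpow_le {a b : ℝ} (ha : 1 ≤ a) (hb : 1 ≤ b) (hr : r ∈ Set.Ioc (0 : ℝ) 1) :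
    |a ^ r - b ^ r| ≤ |a - b| := by
  wlog hab : b ≤ a generalizing a b
  · rw [abs_sub_comm, abs_sub_comm a]
    exact this hb ha (le_of_not_ge hab)
  rw [abs_of_nonneg (sub_nonneg.2 hab), abs_of_nonneg
    (sub_nonneg.2 (Real.rpow_le_rpow (by linarith) hab hr.1.le))]
  have h1 : 0 < b := by linarith
  have h2 : (a / b) ^ r ≤ a / b :=
    Real.rpow_le_self_of_one_le ((one_le_div h1).2 hab) hr.2
  have h3 : b ^ r ≤ b := Real.rpow_le_self_of_one_le hb hr.2
  have h4 : a ^ r = b ^ r * (a / b) ^ r := by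
    rw [← Real.mul_rpow h1.le (by positivity)]
    congr 1
    field_simp
  have h5 : 1 ≤ a / b := (one_le_div h1).2 hab
  have h6 : 0 < b ^ r := by positivity
  calc a ^ r - b ^ r = b ^ r * ((a / b) ^ r - 1) := by rw [h4]; ring
    _ ≤ b * (a / b - 1) := by
        refine mul_le_mul h3 (by linarith) ?_ h1.le
        linarith [Real.one_le_rpow h5 hr.1.le]
    _ = a - b := by field_simp

lemma abs_dissip_sub_le (hζ : ∀ j, ζ j ∈ Set.Icc (1 : ℝ) 2) (hr : r ∈ Set.Ioc (0 : ℝ) 1)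
    {x y : WaveSpace d} (h : ‖x - y‖ ≤ 1) :
    |dissip ζ r x - dissip ζ r y| ≤ 4 * (1 + ‖x‖) ^ 2 * ‖x - y‖ := by
  refine (abs_rpow_sub_rpow_le (by linarith [normSqZeta_nonneg hζ x])
    (by linarith [normSqZeta_nonneg hζ y]) hr).trans ?_
  rw [add_sub_add_left_eq_sub]
  exact abs_normSqZeta_sub_le hζ h

lemma continuous_dissip (hζ : ∀ j, ζ j ∈ Set.Icc (1 : ℝ) 2) : Continuous (dissip ζ r) := by
  have := continuous_normSqZeta (ζ := ζ)
  unfold dissip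
  exact Continuous.rpow_const (by fun_prop) fun x =>
    Or.inl (by linarith [normSqZeta_nonneg hζ x])

lemma dissip_bounds (hζ : ∀ j, ζ j ∈ Set.Icc (1 : ℝ) 2) (hr : r ∈ Set.Ioc (0 : ℝ) 1)
    (k : WaveSpace d) (p : WaveSpace d × WaveSpace d) :
    dissip ζ r k ≤ 2 * pairBracket k p ^ 2 ∧ dissip ζ r p.1 ≤ 2 * pairBracket k p ^ 2 ∧
    dissip ζ r (p.1 + p.2 - k) ≤ 2 * pairBracket k p ^ 2 ∧
    dissip ζ r p.2 ≤ 2 * pairBracket k p ^ 2 := by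
  refine ⟨(dissip_le hζ hr _).trans ?_, (dissip_le hζ hr _).trans ?_,
    (dissip_le hζ hr _).trans ?_, (dissip_le hζ hr _).trans ?_⟩ <;> gcongr
  · exact one_add_norm_le_pairBracket k p
  · exact one_add_norm_fst_le k p
  · exact one_add_norm_mid_le k p
  · exact one_add_norm_snd_le k p

/-- With `k` and `k₁` fixed, only the terms in `k₃` and `k₂ = k₁ + k₃ - k` vary. Each contributes
`4`, whence the constant `8` in the Lipschitz bounds for `Γ₋`, `Γ₊` and `Ω`. -/
lemma abs_sub_pair_le {g : WaveSpace d → ℝ}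
    (hg : ∀ x y : WaveSpace d, ‖x - y‖ ≤ 1 → |g x - g y| ≤ 4 * (1 + ‖x‖) ^ 2 * ‖x - y‖)
    (k k₁ y y' : WaveSpace d) (h : ‖y - y'‖ ≤ 1) :
    |g y - g y'| ≤ 4 * pairBracket k (k₁, y) ^ 2 * ‖y - y'‖ ∧
    |g (k₁ + y - k) - g (k₁ + y' - k)| ≤ 4 * pairBracket k (k₁, y) ^ 2 * ‖y - y'‖ := by
  have e : k₁ + y - k - (k₁ + y' - k) = y - y' := by abel
  refine ⟨(hg y y' h).trans ?_, (hg _ _ (by rwa [e])).trans ?_⟩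
  · gcongr
    exact one_add_norm_snd_le k (k₁, y)
  · rw [e]
    gcongr
    exact one_add_norm_mid_le k (k₁, y)

lemma abs_gammaMinus_le (hζ : ∀ j, ζ j ∈ Set.Icc (1 : ℝ) 2) (hr : r ∈ Set.Ioc (0 : ℝ) 1)
    (k : WaveSpace d) (p : WaveSpace d × WaveSpace d) :
    |gammaMinus ζ r k p| ≤ 8 * pairBracket k p ^ 2 := by
  obtain ⟨h1, h2, h3, h4⟩ := dissip_bounds hζ hr k p
  have g1 := one_le_dissip hζ hr k
  have g2 := one_le_dissip hζ hr p.1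
  have g3 := one_le_dissip hζ hr (p.1 + p.2 - k)
  have g4 := one_le_dissip hζ hr p.2
  unfold gammaMinus
  rw [abs_le]
  constructor <;> linarith

lemma abs_gammaMinus_sub_le (hζ : ∀ j, ζ j ∈ Set.Icc (1 : ℝ) 2) (hr : r ∈ Set.Ioc (0 : ℝ) 1)
    (k k₁ y y' : WaveSpace d) (h : ‖y - y'‖ ≤ 1) :
    |gammaMinus ζ r k (k₁, y) - gammaMinus ζ r k (k₁, y')| ≤
      8 * pairBracket k (k₁, y) ^ 2 * ‖y - y'‖ := by
  obtain ⟨h1, h2⟩ := abs_sub_pair_le (g := dissip ζ r)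
    (fun x y hxy => abs_dissip_sub_le hζ hr hxy) k k₁ y y' h
  rw [abs_le] at h1 h2 ⊢
  unfold gammaMinus
  constructor <;> linarith [h1.1, h1.2, h2.1, h2.2]

lemma abs_gammaPlus_sub_le (hζ : ∀ j, ζ j ∈ Set.Icc (1 : ℝ) 2) (hr : r ∈ Set.Ioc (0 : ℝ) 1)
    (k k₁ y y' : WaveSpace d) (h : ‖y - y'‖ ≤ 1) :
    |gammaPlus ζ r k (k₁, y) - gammaPlus ζ r k (k₁, y')| ≤
      8 * pairBracket k (k₁, y) ^ 2 * ‖y - y'‖ := by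
  obtain ⟨h1, h2⟩ := abs_sub_pair_le (g := dissip ζ r)
    (fun x y hxy => abs_dissip_sub_le hζ hr hxy) k k₁ y y' h
  rw [abs_le] at h1 h2 ⊢
  unfold gammaPlus
  constructor <;> linarith [h1.1, h1.2, h2.1, h2.2]

lemma abs_resOmega_le (hζ : ∀ j, ζ j ∈ Set.Icc (1 : ℝ) 2)
    (k : WaveSpace d) (p : WaveSpace d × WaveSpace d) :
    |resOmega ζ k p| ≤ 8 * pairBracket k p ^ 2 := by
  have key : ∀ x : WaveSpace d, 1 + ‖x‖ ≤ pairBracket k p →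
      0 ≤ normSqZeta ζ x ∧ normSqZeta ζ x ≤ 2 * pairBracket k p ^ 2 := by
    intro x hx
    have h1 := normSqZeta_le_bracket hζ x
    have h2 : 2 * (1 + ‖x‖) ^ 2 ≤ 2 * pairBracket k p ^ 2 := by gcongr
    exact ⟨normSqZeta_nonneg hζ x, by linarith⟩
  have h1 := key _ (one_add_norm_le_pairBracket k p)
  have h2 := key _ (one_add_norm_fst_le k p)
  have h3 := key _ (one_add_norm_mid_le k p)
  have h4 := key _ (one_add_norm_snd_le k p)
  unfold resOmega
  rw [abs_le]
  constructor <;> linarith [h1.1, h1.2, h2.1, h2.2, h3.1, h3.2, h4.1, h4.2]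

lemma abs_resOmega_sub_le (hζ : ∀ j, ζ j ∈ Set.Icc (1 : ℝ) 2)
    (k k₁ y y' : WaveSpace d) (h : ‖y - y'‖ ≤ 1) :
    |resOmega ζ k (k₁, y) - resOmega ζ k (k₁, y')| ≤
      8 * pairBracket k (k₁, y) ^ 2 * ‖y - y'‖ := by
  obtain ⟨h1, h2⟩ := abs_sub_pair_le (g := normSqZeta ζ)
    (fun x y hxy => abs_normSqZeta_sub_le hζ hxy) k k₁ y y' h
  rw [abs_le] at h1 h2 ⊢
  unfold resOmega
  constructor <;> linarith [h1.1, h1.2, h2.1, h2.2]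

lemma continuous_gammaMinus (hζ : ∀ j, ζ j ∈ Set.Icc (1 : ℝ) 2) (k : WaveSpace d) :
    Continuous (gammaMinus ζ r k) := by
  have := continuous_dissip (r := r) hζ
  unfold gammaMinus; fun_prop

lemma continuous_gammaPlus (hζ : ∀ j, ζ j ∈ Set.Icc (1 : ℝ) 2) (k : WaveSpace d) :
    Continuous (gammaPlus ζ r k) := by
  have := continuous_dissip (r := r) hζ
  unfold gammaPlus; fun_prop

lemma quadMultiplier_one_sub_resOmega (hζ : ∀ j, ζ j ∈ Set.Icc (1 : ℝ) 2) (k : WaveSpace d) :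
    QuadMultiplier k 9 fun p => ((1 : ℝ) : ℂ) - Complex.I * resOmega ζ k p := by
  have hc := continuous_resOmega (ζ := ζ) k
  refine ⟨by fun_prop, fun p => ?_, fun k₁ y y' h => ?_⟩
  · refine (norm_sub_le _ _).trans ?_
    rw [norm_mul, Complex.norm_I, one_mul, Complex.norm_real, Complex.norm_real, Real.norm_eq_abs,
      Real.norm_eq_abs, abs_one]
    have := one_le_pow₀ (one_le_pairBracket k p) (n := 2)
    linarith [abs_resOmega_le hζ k p]
  · rw [sub_sub_sub_cancel_left, ← mul_sub, norm_mul, Complex.norm_I, one_mul,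
      ← Complex.ofReal_sub, Complex.norm_real, Real.norm_eq_abs, abs_sub_comm]
    refine (abs_resOmega_sub_le hζ k k₁ y y' h).trans ?_
    gcongr
    norm_num

/-- The factor `a` lost in differentiating the exponential is recovered from `exp (-a u) ≤ exp (-a)`
and `a exp (-a) ≤ 1`. The bound is uniform in `a = ϱ τ`, which may be arbitrarily large. -/
lemma abs_exp_neg_mul_sub_le {a u v : ℝ} (ha : 0 ≤ a) (hu : 1 ≤ u) (hv : 1 ≤ v) :
    |Real.exp (-(a * u)) - Real.exp (-(a * v))| ≤ |u - v| := by
  wlog huv : u ≤ v generalizing u v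
  · rw [abs_sub_comm, abs_sub_comm u]
    exact this hv hu (le_of_not_ge huv)
  have h1 : Real.exp (-(a * v)) ≤ Real.exp (-(a * u)) := by
    gcongr
  rw [abs_of_nonneg (sub_nonneg.2 h1), abs_sub_comm, abs_of_nonneg (sub_nonneg.2 huv)]
  have h2 : Real.exp (-(a * v)) = Real.exp (-(a * u)) * Real.exp (-(a * (v - u))) := by
    rw [← Real.exp_add]; congr 1; ring
  have h3 := Real.add_one_le_exp (-(a * (v - u)))
  have h4 : Real.exp (-(a * u)) ≤ Real.exp (-a) := by
    gcongr
    nlinarith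
  have h5 : a * Real.exp (-a) ≤ 1 := by
    rw [Real.exp_neg, ← div_eq_mul_inv, div_le_one (Real.exp_pos a)]
    linarith [Real.add_one_le_exp a]
  have h6 : 0 ≤ a * (v - u) := mul_nonneg ha (by linarith)
  calc _ = Real.exp (-(a * u)) * (1 - Real.exp (-(a * (v - u)))) := by rw [h2]; ring
    _ ≤ Real.exp (-a) * (a * (v - u)) := by
        refine mul_le_mul h4 (by linarith) ?_ (Real.exp_pos _).le
        have : Real.exp (-(a * (v - u))) ≤ 1 := Real.exp_le_one_iff.2 (by linarith)
        linarith
    _ = a * Real.exp (-a) * (v - u) := by ring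
    _ ≤ 1 * (v - u) := by
        gcongr
    _ = _ := one_mul _

lemma one_le_gammaPlus (hζ : ∀ j, ζ j ∈ Set.Icc (1 : ℝ) 2) (hr : r ∈ Set.Ioc (0 : ℝ) 1)
    (k : WaveSpace d) (p : WaveSpace d × WaveSpace d) : 1 ≤ gammaPlus ζ r k p := by
  have g1 := one_le_dissip hζ hr k
  have g2 := one_le_dissip hζ hr p.1
  have g3 := one_le_dissip hζ hr (p.1 + p.2 - k)
  have g4 := one_le_dissip hζ hr p.2
  unfold gammaPlus
  linarith

lemma quadMultiplier_exp_gammaPlus (hζ : ∀ j, ζ j ∈ Set.Icc (1 : ℝ) 2)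
    (hr : r ∈ Set.Ioc (0 : ℝ) 1) {a : ℝ} (ha : 0 ≤ a) (k : WaveSpace d) :
    QuadMultiplier k 8 fun p => (Real.exp (-(a * gammaPlus ζ r k p)) : ℂ) := by
  have hc := continuous_gammaPlus (r := r) hζ k
  refine ⟨by fun_prop, fun p => ?_, fun k₁ y y' h => ?_⟩
  · rw [Complex.norm_real, Real.norm_of_nonneg (Real.exp_pos _).le]
    have h1 := one_le_pow₀ (one_le_pairBracket k p) (n := 2)
    have h2 : Real.exp (-(a * gammaPlus ζ r k p)) ≤ 1 :=
      Real.exp_le_one_iff.2 (by nlinarith [one_le_gammaPlus hζ hr k p])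
    linarith
  · rw [← Complex.ofReal_sub, Complex.norm_real, Real.norm_eq_abs]
    exact (abs_exp_neg_mul_sub_le ha (one_le_gammaPlus hζ hr k _)
      (one_le_gammaPlus hζ hr k _)).trans (abs_gammaPlus_sub_le hζ hr k k₁ y y' h)

/-- Since `|k|² = |k₁|² - |k₂|² + |k₃|² - Ω`, dropping `|k₂|²` and applying subadditivity of `x^r`
gives `γ_k ≤ γ_{k₁} + γ_{k₃} + |Ω|^r`; the spare `γ_{k₂}` is at least one. -/
lemma one_sub_rpow_le_gammaMinus (hζ : ∀ j, ζ j ∈ Set.Icc (1 : ℝ) 2) (hr : r ∈ Set.Ioc (0 : ℝ) 1)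
    (k : WaveSpace d) (p : WaveSpace d × WaveSpace d) :
    1 - |resOmega ζ k p| ^ r ≤ gammaMinus ζ r k p := by
  have n1 := normSqZeta_nonneg hζ p.1
  have n2 := normSqZeta_nonneg hζ (p.1 + p.2 - k)
  have n3 := normSqZeta_nonneg hζ p.2
  have n4 := normSqZeta_nonneg hζ k
  have g3 := one_le_dissip hζ hr (p.1 + p.2 - k)
  have h1 : 1 + normSqZeta ζ k ≤
      (1 + normSqZeta ζ p.1) + (1 + normSqZeta ζ p.2) + |resOmega ζ k p| := by
    have := neg_abs_le (resOmega ζ k p)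
    unfold resOmega at this ⊢
    linarith
  have h2 : dissip ζ r k ≤ dissip ζ r p.1 + dissip ζ r p.2 + |resOmega ζ k p| ^ r := by
    unfold dissip
    refine (Real.rpow_le_rpow (by linarith) h1 hr.1.le).trans ?_
    refine (Real.rpow_add_le_add_rpow (by positivity) (abs_nonneg _) hr.1.le hr.2).trans ?_
    gcongr
    exact Real.rpow_add_le_add_rpow (by positivity) (by positivity) hr.1.le hr.2
  unfold gammaMinus
  linarith

lemma one_le_gammaMinus (hζ : ∀ j, ζ j ∈ Set.Icc (1 : ℝ) 2) (hr : r ∈ Set.Ioc (0 : ℝ) 1)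
    {k : WaveSpace d} {p : WaveSpace d × WaveSpace d} (hp : resOmega ζ k p = 0) :
    1 ≤ gammaMinus ζ r k p := by
  have := one_sub_rpow_le_gammaMinus hζ hr k p
  rwa [hp, abs_zero, Real.zero_rpow hr.1.ne', sub_zero] at this

/-- The denominators are nondegenerate, although `Γ₋` may be negative. -/
lemma exists_sq_le_denominator (hζ : ∀ j, ζ j ∈ Set.Icc (1 : ℝ) 2) (hr : r ∈ Set.Ioc (0 : ℝ) 1) :
    ∃ c ∈ Set.Ioc (0 : ℝ) 1, ∀ ν ∈ Set.Ioc (0 : ℝ) (1 / 2), ∀ (k : WaveSpace d)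
      (p : WaveSpace d × WaveSpace d), c ^ 2 * (ν ^ 2 + resOmega ζ k p ^ 2) ≤
        (ν * gammaMinus ζ r k p) ^ 2 + resOmega ζ k p ^ 2 := by
  -- The threshold is chosen so that `c ^ r = 1/2`: for `|Ω| ≤ c` this gives `Γ₋ ≥ 1/2`, and for
  -- `|Ω| ≥ c` the term `Ω²` alone suffices.
  have hc0 : (0 : ℝ) < (1 / 2) ^ (1 / r) := by positivity
  have hc1 : ((1 : ℝ) / 2) ^ (1 / r) ≤ 1 / 2 := by
    have : 1 ≤ 1 / r := (one_le_div hr.1).2 hr.2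
    simpa using Real.rpow_le_rpow_of_exponent_ge (by norm_num) (by norm_num) this
  have hc2 : (((1 : ℝ) / 2) ^ (1 / r)) ^ r = 1 / 2 := by
    rw [← Real.rpow_mul (by norm_num), one_div_mul_cancel hr.1.ne', Real.rpow_one]
  set c : ℝ := (1 / 2) ^ (1 / r)
  refine ⟨c, ⟨hc0, by linarith⟩, fun ν hν k p => ?_⟩
  have hcs : c ^ 2 ≤ 1 / 4 := by nlinarith
  have hν1 : ν ^ 2 ≤ 1 / 4 := by nlinarith [hν.1, hν.2]
  have hΩ := sq_nonneg (resOmega ζ k p)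
  rcases le_total c |resOmega ζ k p| with h | h
  · have h1 : c ^ 2 ≤ resOmega ζ k p ^ 2 := by
      rw [← sq_abs (resOmega ζ k p)]; gcongr
    nlinarith [sq_nonneg (ν * gammaMinus ζ r k p), sq_nonneg c, sq_nonneg ν]
  · have h1 := one_sub_rpow_le_gammaMinus hζ hr k p
    have h2 : |resOmega ζ k p| ^ r ≤ c ^ r := Real.rpow_le_rpow (abs_nonneg _) h hr.1.le
    have h3 : 1 / 2 ≤ gammaMinus ζ r k p := by linarith
    have h4 : ν * (1 / 2) ≤ ν * gammaMinus ζ r k p := mul_le_mul_of_nonneg_left h3 hν.1.le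
    have h5 : (ν * (1 / 2)) ^ 2 ≤ (ν * gammaMinus ζ r k p) ^ 2 := by
      have := hν.1
      gcongr
    nlinarith [sq_nonneg ν]

end Amplitudes

/-! ### Replacing `Γ₋` by one, and the gain from oscillation. -/

section Kernels

variable {d : ℕ} {ζ : Fin d → ℝ} {r : ℝ}

lemma norm_cauchyKer_le_of_sq_le {c ν b w : ℝ} (hc : 0 < c) (hν : 0 < ν)
    (h : c ^ 2 * (ν ^ 2 + w ^ 2) ≤ b ^ 2 + w ^ 2) :
    ‖cauchyKer b w‖ ≤ c⁻¹ * ‖cauchyKer ν w‖ := by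
  rw [norm_cauchyKer, norm_cauchyKer, ← mul_inv]
  have h0 : 0 < √(ν ^ 2 + w ^ 2) := Real.sqrt_pos.2 (by positivity)
  gcongr
  refine Real.le_sqrt_of_sq_le ?_
  rwa [mul_pow, Real.sq_sqrt (by positivity)]

/-- The resolvent identity with both denominators compared to `ν² + w²`: a change of the coefficient
yields a Lorentzian majorant, whose `√|w|` moment is of order `√ν`. -/
lemma norm_cauchyKer_mul_sub_le {c ν b b' w : ℝ} (hc : 0 < c) (hν : 0 < ν)
    (h : c ^ 2 * (ν ^ 2 + w ^ 2) ≤ (ν * b) ^ 2 + w ^ 2)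
    (h' : c ^ 2 * (ν ^ 2 + w ^ 2) ≤ (ν * b') ^ 2 + w ^ 2) :
    ‖cauchyKer (ν * b) w - cauchyKer (ν * b') w‖ ≤
      (c⁻¹) ^ 2 * |b - b'| * (ν * (ν ^ 2 + w ^ 2)⁻¹) := by
  have hpos : 0 < c ^ 2 * (ν ^ 2 + w ^ 2) := by positivity
  rw [norm_cauchyKer_sub_left (hpos.trans_le h) (hpos.trans_le h'), ← mul_sub, abs_mul,
    abs_of_pos hν, ← norm_cauchyKer_sq]
  calc _ ≤ ν * |b - b'| * ((c⁻¹ * ‖cauchyKer ν w‖) * (c⁻¹ * ‖cauchyKer ν w‖)) := by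
        gcongr
        · exact norm_cauchyKer_le_of_sq_le hc hν h
        · exact norm_cauchyKer_le_of_sq_le hc hν h'
    _ = _ := by ring

lemma sq_le_of_one_le {c ν b w : ℝ} (hc : c ∈ Set.Ioc (0 : ℝ) 1) (hb : 1 ≤ b) :
    c ^ 2 * (ν ^ 2 + w ^ 2) ≤ (ν * b) ^ 2 + w ^ 2 := by
  have h1 : c ^ 2 ≤ 1 := pow_le_one₀ hc.1.le hc.2
  have h2 : 1 ≤ b ^ 2 := one_le_pow₀ hb
  rw [mul_pow]
  nlinarith [mul_le_mul_of_nonneg_left h2 (sq_nonneg ν), mul_le_mul_of_nonneg_right h1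
    (add_nonneg (sq_nonneg ν) (sq_nonneg w))]

lemma continuous_cauchyKer_gammaMinus (hζ : ∀ j, ζ j ∈ Set.Icc (1 : ℝ) 2)
    (hr : r ∈ Set.Ioc (0 : ℝ) 1) {ν : ℝ} (hν : ν ∈ Set.Ioc (0 : ℝ) (1 / 2)) (k : WaveSpace d) :
    Continuous fun p => cauchyKer (ν * gammaMinus ζ r k p) (resOmega ζ k p) := by
  obtain ⟨c, hc, hden⟩ := exists_sq_le_denominator hζ hr
  have h1 := continuous_gammaMinus (r := r) hζ k
  have h2 := continuous_resOmega (ζ := ζ) k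
  unfold cauchyKer
  refine Continuous.inv₀ (by fun_prop) fun p => sub_I_mul_ne_zero ?_
  have := hc.1
  have := hν.1
  exact lt_of_lt_of_le (by positivity) (hden ν hν k p)

/-- The coefficient `Γ₋` in the kernel may be replaced by `1`. -/
lemma exists_norm_integral_gammaMinus_sub_le (hd : 2 ≤ d) (hζ : ∀ j, ζ j ∈ Set.Icc (1 : ℝ) 2)
    (hr : r ∈ Set.Ioc (0 : ℝ) 1) :
    ∃ C : ℝ, 0 ≤ C ∧ ∀ (k : WaveSpace d) (M : ℝ) (A : WaveSpace d × WaveSpace d → ℂ),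
      TameAmplitude k (d + 1 + 2) M A → ∀ s : ℝ, 0 ≤ s → ∀ ν ∈ Set.Ioc (0 : ℝ) (1 / 2),
      ‖∫ p, Complex.exp (Complex.I * ((s * resOmega ζ k p : ℝ) : ℂ)) *
        (cauchyKer (ν * gammaMinus ζ r k p) (resOmega ζ k p) -
          cauchyKer ν (resOmega ζ k p)) * A p‖ ≤ C * (M * √ν) := by
  obtain ⟨C, hC0, hC⟩ := exists_norm_integral_comp_resOmega_le hd hζ
  obtain ⟨c, hc, hden⟩ := exists_sq_le_denominator hζ hr
  have hc0 := hc.1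
  have hS := sqrtMoment_nonneg
  refine ⟨C * (25 * (c⁻¹) ^ 2 * sqrtMoment), by positivity, fun k M A hA s hs ν hν => ?_⟩
  have hν0 := hν.1
  have hM := hA.nonneg
  set m : ℝ → ℝ := fun w => ν * (ν ^ 2 + w ^ 2)⁻¹ with hm
  have hm0 : ∀ w, 0 ≤ m w := fun w => by simp only [hm]; positivity
  have hmi : Integrable fun w => m w * √|w| := by
    simp only [hm, mul_assoc]
    exact (integrable_inv_sq_add_sq_mul_sqrt hν0).const_mul ν
  have hmv : ∫ w, m w * √|w| = √ν * sqrtMoment := by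
    simp only [hm, mul_assoc]
    rw [integral_const_mul, integral_inv_sq_add_sq_mul_sqrt hν0]
    field_simp
  set Q : WaveSpace d × WaveSpace d → ℝ → ℂ := fun p w =>
    Complex.exp (Complex.I * ((s * w : ℝ) : ℂ)) *
      (cauchyKer (ν * gammaMinus ζ r k p) w - cauchyKer ν w) * A p with hQ
  have hnorm : ∀ (w : ℝ) (z z' : ℂ), ‖Complex.exp (Complex.I * ((s * w : ℝ) : ℂ)) * z * z'‖ =
      ‖z‖ * ‖z'‖ := fun w z z' => by rw [norm_mul, norm_mul, norm_exp_I_mul_ofReal, one_mul]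
  have hP : ∀ p, 0 < pairBracket k p := fun p => one_pos.trans_le (one_le_pairBracket k p)
  have hG : ∀ p, |gammaMinus ζ r k p - 1| ≤ 9 * pairBracket k p ^ 2 := by
    intro p
    have h1 := one_le_pow₀ (one_le_pairBracket k p) (n := 2)
    have h2 := abs_le.1 (abs_gammaMinus_le hζ hr k p)
    rw [abs_le]
    constructor <;> linarith [h2.1, h2.2]
  have hpow : ∀ p, pairBracket k p ^ 2 * (pairBracket k p ^ (d + 1 + 2))⁻¹ ≤ pairWeight p := by
    intro p
    refine le_trans (le_of_eq ?_) (inv_pairBracket_pow_le k p)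
    have := hP p
    rw [pow_add _ (d + 1) 2]
    field_simp
  have hone : ∀ w, cauchyKer ν w = cauchyKer (ν * 1) w := fun w => by rw [mul_one]
  -- The frequency `w` is kept independent of `p`: the bound is needed both at `w = Ω(p)` and, at
  -- resonant `p`, for every `w`. The denominator condition holds in each case for a different
  -- reason.
  have hgood : ∀ p w, c ^ 2 * (ν ^ 2 + w ^ 2) ≤ (ν * gammaMinus ζ r k p) ^ 2 + w ^ 2 →
      ‖Q p w‖ ≤ 25 * (c⁻¹) ^ 2 * M * pairWeight p * m w := by
    intro p w h
    simp only [hQ]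
    rw [hnorm, hone]
    have h1 := norm_cauchyKer_mul_sub_le hc0 hν0 h (sq_le_of_one_le hc le_rfl)
    have hmw := hm0 w
    have hp := hP p
    have hw := pairWeight_pos p
    calc _ ≤ ((c⁻¹) ^ 2 * (9 * pairBracket k p ^ 2) * m w) *
          (M * (pairBracket k p ^ (d + 1 + 2))⁻¹) := by
          gcongr
          · refine h1.trans ?_
            simp only [hm]
            gcongr
            exact hG p
          · exact hA.bound p
      _ = 9 * (c⁻¹) ^ 2 * M * (pairBracket k p ^ 2 * (pairBracket k p ^ (d + 1 + 2))⁻¹) * m w := by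
          ring
      _ ≤ 25 * (c⁻¹) ^ 2 * M * pairWeight p * m w := by
          gcongr
          · norm_num
          · exact hpow p
  have hcont : Continuous fun p => Q p (resOmega ζ k p) := by
    have h1 := continuous_cauchyKer_gammaMinus hζ hr hν k
    have h2 := (continuous_cauchyKer hν0).comp (continuous_resOmega (ζ := ζ) k)
    have h3 := continuous_resOmega (ζ := ζ) k
    have h4 := hA.continuous
    simp only [hQ]
    exact ((by fun_prop : Continuous fun p => Complex.exp (Complex.I *
      ((s * resOmega ζ k p : ℝ) : ℂ))).mul (h1.sub h2)).mul h4
  obtain ⟨hi1, hi2⟩ := integrable_of_norm_le_pairWeight hcont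
    (K := 25 * (c⁻¹) ^ 2 * M * ν⁻¹) (fun p => by
      refine (hgood p _ (hden ν hν k p)).trans ?_
      have h1 : m (resOmega ζ k p) ≤ ν⁻¹ := by
        simp only [hm]
        rw [← div_eq_mul_inv, inv_eq_one_div, div_le_div_iff₀ (by positivity) hν0]
        nlinarith [sq_nonneg (resOmega ζ k p)]
      have hw := pairWeight_pos p
      calc _ ≤ 25 * (c⁻¹) ^ 2 * M * pairWeight p * ν⁻¹ := by gcongr
        _ = _ := by ring)
  refine (hC k (25 * (c⁻¹) ^ 2 * M) (by positivity) m hm0 hmi Q hi1 hi2 (fun p hp => ?_)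
    (fun p => hgood p _ (hden ν hν k p))
    (fun p hp w => hgood p w (sq_le_of_one_le hc (one_le_gammaMinus hζ hr hp)))
    (fun k₁ y y₀ h0 hy => ?_)).trans (le_of_eq ?_)
  · have hΓ := one_le_gammaMinus hζ hr hp
    have hpos : 0 < ν * gammaMinus ζ r k p := by positivity
    simp only [hQ]
    constructor
    · refine Integrable.mul_const ?_ _
      refine ((integrable_cauchyKer_sub hpos hν0).norm).mono' ?_ (ae_of_all _ fun w => ?_)
      · have := continuous_cauchyKer hpos
        have := continuous_cauchyKer hν0
        exact Continuous.aestronglyMeasurable (by fun_prop)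
      · rw [norm_mul, norm_exp_I_mul_ofReal, one_mul]
    · rw [integral_mul_const, integral_exp_mul_cauchyKer_sub hpos hν0 hs, zero_mul]
  · set w := resOmega ζ k (k₁, y)
    have hg1 := hden ν hν k (k₁, y)
    have hΓ₀ := one_le_gammaMinus hζ hr h0
    have hg2 := sq_le_of_one_le (ν := ν) (w := w) hc hΓ₀
    -- First the coefficient `Γ₋` moves, then the amplitude. At the resonant point `y₀` the
    -- coefficient is at least one, so its kernel is controlled at every frequency.
    have e : Q (k₁, y) w - Q (k₁, y₀) w = Complex.exp (Complex.I * ((s * w : ℝ) : ℂ)) *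
        (cauchyKer (ν * gammaMinus ζ r k (k₁, y)) w - cauchyKer (ν * gammaMinus ζ r k (k₁, y₀)) w) *
          A (k₁, y) + Complex.exp (Complex.I * ((s * w : ℝ) : ℂ)) *
        (cauchyKer (ν * gammaMinus ζ r k (k₁, y₀)) w - cauchyKer (ν * 1) w) *
          (A (k₁, y) - A (k₁, y₀)) := by
      simp only [hQ, mul_one]; ring
    have h1 := norm_cauchyKer_mul_sub_le hc0 hν0 hg1 hg2
    have h2 := norm_cauchyKer_mul_sub_le hc0 hν0 hg2 (sq_le_of_one_le hc le_rfl)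
    have hmw := hm0 w
    have hp := hP (k₁, y)
    have hw := pairWeight_pos (k₁, y)
    have hΓ1 := abs_gammaMinus_sub_le hζ hr k k₁ y y₀ hy
    have hΓ2 : |gammaMinus ζ r k (k₁, y₀) - 1| ≤ 17 * pairBracket k (k₁, y) ^ 2 := by
      have h3 : |gammaMinus ζ r k (k₁, y) - gammaMinus ζ r k (k₁, y₀)| ≤
          8 * pairBracket k (k₁, y) ^ 2 * 1 := hΓ1.trans (by gcongr)
      have h4 := abs_le.1 h3
      have h5 := abs_le.1 (hG (k₁, y))
      rw [abs_le]
      constructor <;> linarith [h4.1, h4.2, h5.1, h5.2]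
    rw [e]
    refine (norm_add_le _ _).trans ?_
    rw [hnorm, hnorm]
    calc _ ≤ ((c⁻¹) ^ 2 * (8 * pairBracket k (k₁, y) ^ 2 * ‖y - y₀‖) * m w) *
          (M * (pairBracket k (k₁, y) ^ (d + 1 + 2))⁻¹) +
          ((c⁻¹) ^ 2 * (17 * pairBracket k (k₁, y) ^ 2) * m w) *
          (M * (pairBracket k (k₁, y) ^ (d + 1 + 2))⁻¹ * ‖y - y₀‖) := by
          gcongr
          · refine h1.trans ?_
            simp only [hm]
            gcongr
          · exact hA.bound _
          · refine h2.trans ?_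
            simp only [hm]
            gcongr
          · exact hA.lipschitz k₁ y y₀ hy
      -- `25 = 8 + 17`: the Lipschitz constant of `Γ₋`, plus the bound for `Γ₋ - 1` at `y₀`, which
      -- is `9` at `y` and `8` for the move.
      _ = 25 * (c⁻¹) ^ 2 * M * (pairBracket k (k₁, y) ^ 2 *
          (pairBracket k (k₁, y) ^ (d + 1 + 2))⁻¹) * m w * ‖y - y₀‖ := by ring
      _ ≤ _ := by
          gcongr
          exact hpow _
  · rw [hmv]; ring

lemma TameAmplitude.one_sub_mul {k : WaveSpace d} {M : ℝ} {A : WaveSpace d × WaveSpace d → ℂ}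
    (hζ : ∀ j, ζ j ∈ Set.Icc (1 : ℝ) 2) (hA : TameAmplitude k (d + 1 + 2) M A) :
    TameAmplitude k (d + 1) (27 * M) fun p =>
      (((1 : ℝ) : ℂ) - Complex.I * resOmega ζ k p) * A p := by
  have := (quadMultiplier_one_sub_resOmega hζ k).mul hA
  norm_num at this ⊢
  exact this

/-- The Cauchy kernel alone is not integrable in `w`. A factor `(1 - i w)⁻¹` is inserted in the
kernel and compensated in the amplitude, where it costs two powers of decay. -/
lemma exp_mul_cauchyKer_mul_eq (k : WaveSpace d) (s ν : ℝ) (A : WaveSpace d × WaveSpace d → ℂ)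
    (p : WaveSpace d × WaveSpace d) :
    Complex.exp (Complex.I * ((s * resOmega ζ k p : ℝ) : ℂ)) * cauchyKer ν (resOmega ζ k p) * A p =
      oscKer s ν (resOmega ζ k p) * ((((1 : ℝ) : ℂ) - Complex.I * resOmega ζ k p) * A p) := by
  have h : cauchyKer 1 (resOmega ζ k p) * (((1 : ℝ) : ℂ) - Complex.I * resOmega ζ k p) = 1 :=
    inv_mul_cancel₀ (sub_I_mul_ne_zero (by positivity))
  unfold oscKer
  linear_combination (-Complex.exp (Complex.I * ((s * resOmega ζ k p : ℝ) : ℂ)) *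
    cauchyKer ν (resOmega ζ k p) * A p) * h

lemma norm_oscKer_le_inv {s ν : ℝ} (hν : 0 < ν) (w : ℝ) : ‖oscKer s ν w‖ ≤ 4 * ν⁻¹ := by
  refine (norm_oscKer_le s hν w).trans ?_
  gcongr
  have := abs_nonneg w
  nlinarith

/-- Let `J` be the integral with the kernel shifted by `δ = π / s` and write `2 I = (I - J) + (I +
J)`. In `I - J` the shift is moved to the amplitude, which gains `√δ` against an `L¹` norm of order
`|log ν|`. In `I + J` the exponentials cancel up to a difference of Cauchy kernels, again of
vanishing integral, so its `√|w|` moment decides. -/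
lemma exists_norm_integral_osc_le (hd : 2 ≤ d) (hζ : ∀ j, ζ j ∈ Set.Icc (1 : ℝ) 2) :
    ∃ C : ℝ, 0 ≤ C ∧ ∀ (k : WaveSpace d) (M : ℝ) (A : WaveSpace d × WaveSpace d → ℂ),
      TameAmplitude k (d + 1 + 2) M A → ∀ s : ℝ, 0 < s → ∀ ν ∈ Set.Ioc (0 : ℝ) (1 / 2),
      ‖∫ p, Complex.exp (Complex.I * ((s * resOmega ζ k p : ℝ) : ℂ)) *
        cauchyKer ν (resOmega ζ k p) * A p‖ ≤
        C * (M * (√(Real.pi / s) * |Real.log ν| +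
          (Real.pi / s) * (ν⁻¹ * √ν + √(Real.pi / s) * ν⁻¹))) := by
  obtain ⟨C₁, hC₁0, hC₁⟩ := exists_norm_integral_kernel_mul_le hd hζ
  obtain ⟨C₂, hC₂0, hC₂⟩ := exists_norm_integral_shift_comp_resOmega_le hd hζ
  have hS := sqrtMoment_nonneg
  refine ⟨C₂ * (27 * 16) + C₁ * (27 * (8 * sqrtMoment + 4 * Real.pi)), by positivity,
    fun k M A hA s hs ν hν => ?_⟩
  have hν0 := hν.1
  have hM := hA.nonneg
  have hν1 : ν < 1 := by linarith [hν.2]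
  have hB := hA.one_sub_mul hζ
  simp_rw [exp_mul_cauchyKer_mul_eq]
  set B : WaveSpace d × WaveSpace d → ℂ := fun p =>
    (((1 : ℝ) : ℂ) - Complex.I * resOmega ζ k p) * A p
  set δ := Real.pi / s with hδ
  have hδ0 : 0 < δ := div_pos Real.pi_pos hs
  have hc := continuous_oscKer s hν0
  have hc' : Continuous fun w => oscKer s ν (w + δ) := by fun_prop
  have hi1 := (hB.integrable_comp_mul (ζ := ζ) hc (norm_oscKer_le_inv hν0)).1
  have hi2 := (hB.integrable_comp_mul (ζ := ζ) hc' (fun w => norm_oscKer_le_inv hν0 (w + δ))).1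
  have hki := integrable_oscKer s hν0 hν1
  have hki' := hki.comp_add_right δ
  have e1 : ∫ p, (oscKer s ν (resOmega ζ k p) - oscKer s ν (resOmega ζ k p + δ)) * B p =
      (∫ p, oscKer s ν (resOmega ζ k p) * B p) - ∫ p, oscKer s ν (resOmega ζ k p + δ) * B p := by
    rw [← integral_sub hi1 hi2]; simp_rw [sub_mul]
  have e2 : ∫ p, (oscKer s ν (resOmega ζ k p) + oscKer s ν (resOmega ζ k p + δ)) * B p =
      (∫ p, oscKer s ν (resOmega ζ k p) * B p) + ∫ p, oscKer s ν (resOmega ζ k p + δ) * B p := by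
    rw [← integral_add hi1 hi2]; simp_rw [add_mul]
  have b1 := hC₂ k (27 * M) (by positivity) (oscKer s ν) hc.measurable hki B hB.continuous
    hB.norm_le hB.norm_sub_le δ ((hi1.sub hi2).congr (ae_of_all _ fun p => by
      simp only [Pi.sub_apply, sub_mul]))
  obtain ⟨hmi, hmb⟩ := moment_oscKer_add hs hν0 hν.2
  have b2 := hC₁ k (27 * M) B hB (fun w => oscKer s ν w + oscKer s ν (w + δ)) (hc.add hc')
    ⟨4 * ν⁻¹ + 4 * ν⁻¹, fun w => (norm_add_le _ _).trans
      (add_le_add (norm_oscKer_le_inv hν0 w) (norm_oscKer_le_inv hν0 _))⟩ (hki.add hki')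
    (by rw [integral_add hki hki', integral_add_right_eq_self (oscKer s ν),
      integral_oscKer hs.le hν0 hν1, add_zero]) hmi
  rw [e1, abs_of_pos hδ0] at b1
  rw [e2] at b2
  have b3 := integral_norm_oscKer_le s hν0 hν.2
  set I := ∫ p, oscKer s ν (resOmega ζ k p) * B p
  set J := ∫ p, oscKer s ν (resOmega ζ k p + δ) * B p
  have h2 : ‖I‖ ≤ ‖I - J‖ + ‖I + J‖ := by
    have : ‖(2 : ℂ) * I‖ ≤ ‖I - J‖ + ‖I + J‖ := by
      rw [show (2 : ℂ) * I = (I - J) + (I + J) by ring]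
      exact norm_add_le _ _
    rw [norm_mul, Complex.norm_ofNat] at this
    linarith [norm_nonneg I]
  have hL := abs_nonneg (Real.log ν)
  have hq := Real.sqrt_nonneg δ
  have hqν := Real.sqrt_nonneg ν
  have hpi := Real.pi_pos
  calc ‖I‖ ≤ C₂ * (27 * M * (√δ * (16 * |Real.log ν|))) +
        C₁ * (27 * M * (4 * δ * (2 * (ν⁻¹ * √ν * sqrtMoment) + √δ * (Real.pi / ν)))) := by
        refine h2.trans (add_le_add (b1.trans ?_) (b2.trans ?_)) <;> gcongr
    _ = C₂ * (27 * 16) * (M * (√δ * |Real.log ν|)) + C₁ * (27 * (8 * sqrtMoment)) *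
        (M * (δ * (ν⁻¹ * √ν))) + C₁ * (27 * (4 * Real.pi)) * (M * (δ * (√δ * ν⁻¹))) := by
        ring
    _ ≤ _ := by
        have x1 : 0 ≤ M * (√δ * |Real.log ν|) := by positivity
        have x2 : 0 ≤ M * (δ * (ν⁻¹ * √ν)) := by positivity
        have x3 : 0 ≤ M * (δ * (√δ * ν⁻¹)) := by positivity
        have y1 : 0 ≤ C₂ * (27 * 16) := by positivity
        have y2 : 0 ≤ C₁ * (27 * (8 * sqrtMoment)) := by positivity
        have y3 : 0 ≤ C₁ * (27 * (4 * Real.pi)) := by positivity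
        nlinarith [mul_nonneg x1 y2, mul_nonneg x1 y3, mul_nonneg x2 y1, mul_nonneg x2 y3,
          mul_nonneg x3 y1, mul_nonneg x3 y2]

end Kernels

/-! ### Schwartz functions give tame amplitudes. -/

section Schwartz

variable {d : ℕ} {ζ : Fin d → ℝ} {r : ℝ}

lemma exists_schwartz_decay (B : ℕ → ℕ → ℝ) (n : ℕ) :
    ∃ K : ℝ, 0 ≤ K ∧ ∀ f : 𝓢(WaveSpace d, ℝ),
      (∀ m j : ℕ, SchwartzMap.seminorm ℝ m j f ≤ B m j) →
      (∀ x, |f x| ≤ K * ((1 + ‖x‖) ^ n)⁻¹) ∧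
      ∀ x y, ‖x - y‖ ≤ 1 → |f x - f y| ≤ K * ((1 + ‖x‖) ^ n)⁻¹ * ‖x - y‖ := by
  set b : ℝ := ∑ i ∈ Finset.Iic (n, 1), |B i.1 i.2| with hb
  have hb0 : 0 ≤ b := Finset.sum_nonneg fun i _ => abs_nonneg _
  -- One factor `2 ^ n` comes from the seminorm inequality, the other from comparing the weights at
  -- points of the unit ball around `x`.
  refine ⟨2 ^ n * (2 ^ n * b), by positivity, fun f hf => ?_⟩
  have hsup : ((Finset.Iic (n, 1)).sup fun m : ℕ × ℕ => SchwartzMap.seminorm ℝ m.1 m.2) f ≤ b := by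
    refine Seminorm.finset_sup_apply_le hb0 fun i hi => (hf i.1 i.2).trans ((le_abs_self _).trans ?_)
    exact Finset.single_le_sum (f := fun i : ℕ × ℕ => |B i.1 i.2|) (fun i _ => abs_nonneg _) hi
  have key : ∀ j ≤ 1, ∀ x, ‖iteratedFDeriv ℝ j f x‖ ≤ 2 ^ n * b * ((1 + ‖x‖) ^ n)⁻¹ := by
    intro j hj x
    have h := SchwartzMap.one_add_le_sup_seminorm_apply (𝕜 := ℝ) (m := (n, 1)) (k := n) (n := j)
      le_rfl hj f x
    rw [← div_eq_mul_inv, le_div_iff₀ (by positivity), mul_comm]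
    exact h.trans (by gcongr)
  have h2n : (1 : ℝ) ≤ 2 ^ n := one_le_pow₀ one_le_two
  refine ⟨fun x => ?_, fun x y hxy => ?_⟩
  · have h := key 0 zero_le_one x
    rw [norm_iteratedFDeriv_zero, Real.norm_eq_abs] at h
    refine h.trans ?_
    gcongr
    exact le_mul_of_one_le_left (by positivity) h2n
  · have hdiff : ∀ z ∈ Metric.closedBall x 1, ‖fderiv ℝ f z‖ ≤
        2 ^ n * (2 ^ n * b) * ((1 + ‖x‖) ^ n)⁻¹ := by
      intro z hz
      have h := key 1 le_rfl z
      rw [norm_iteratedFDeriv_one] at h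
      refine h.trans ?_
      have h1 : ‖x‖ ≤ ‖z‖ + 1 := by
        have h2 : ‖z - x‖ ≤ 1 := by simpa [dist_eq_norm] using hz
        have h3 := norm_sub_norm_le x z
        rw [norm_sub_rev] at h3
        linarith
      have h4 : ((1 + ‖z‖) ^ n)⁻¹ ≤ 2 ^ n * ((1 + ‖x‖) ^ n)⁻¹ := by
        rw [← div_eq_mul_inv, inv_eq_one_div, div_le_div_iff₀ (by positivity) (by positivity),
          one_mul, ← mul_pow]
        gcongr
        linarith [norm_nonneg z]
      calc _ ≤ 2 ^ n * b * (2 ^ n * ((1 + ‖x‖) ^ n)⁻¹) := by gcongr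
        _ = _ := by ring
    have hy : y ∈ Metric.closedBall x 1 := by
      rw [Metric.mem_closedBall, dist_eq_norm, norm_sub_rev]; exact hxy
    have h := (convex_closedBall x (1 : ℝ)).norm_image_sub_le_of_norm_fderiv_le
      (fun z _ => f.differentiableAt) hdiff hy (Metric.mem_closedBall_self zero_le_one)
    rwa [Real.norm_eq_abs] at h

lemma exists_tameAmplitude_tripleProd (B : ℕ → ℕ → ℝ) (n : ℕ) :
    ∃ M : ℝ, ∀ f₁ f₂ f₃ : 𝓢(WaveSpace d, ℝ),
      (∀ m j : ℕ, SchwartzMap.seminorm ℝ m j f₁ ≤ B m j ∧ SchwartzMap.seminorm ℝ m j f₂ ≤ B m j ∧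
        SchwartzMap.seminorm ℝ m j f₃ ≤ B m j) →
      ∀ k, TameAmplitude k n M fun p => (tripleProd f₁ f₂ f₃ k p : ℂ) := by
  obtain ⟨K, hK0, hK⟩ := exists_schwartz_decay (d := d) B n
  refine ⟨3 * K ^ 3, fun f₁ f₂ f₃ hf k => ?_⟩
  obtain ⟨b₁, -⟩ := hK f₁ fun m j => (hf m j).1
  obtain ⟨b₂, l₂⟩ := hK f₂ fun m j => (hf m j).2.1
  obtain ⟨b₃, l₃⟩ := hK f₃ fun m j => (hf m j).2.2
  have hpow : ∀ p, (pairBracket k p ^ n)⁻¹ = ((1 + ‖p.1‖) ^ n)⁻¹ *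
      ((1 + ‖p.1 + p.2 - k‖) ^ n)⁻¹ * ((1 + ‖p.2‖) ^ n)⁻¹ := by
    intro p
    rw [pairBracket, mul_pow, mul_pow, mul_inv, mul_inv]
  refine ⟨?_, fun p => ?_, fun k₁ y y' hy => ?_⟩
  · have h1 := f₁.continuous
    have h2 := f₂.continuous
    have h3 := f₃.continuous
    unfold tripleProd
    fun_prop
  · rw [Complex.norm_real, Real.norm_eq_abs, tripleProd, abs_mul, abs_mul, hpow]
    calc _ ≤ (K * ((1 + ‖p.1‖) ^ n)⁻¹) * (K * ((1 + ‖p.1 + p.2 - k‖) ^ n)⁻¹) *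
          (K * ((1 + ‖p.2‖) ^ n)⁻¹) := by
          gcongr
          · exact b₁ _
          · exact b₂ _
          · exact b₃ _
      _ = 1 * K ^ 3 * (((1 + ‖p.1‖) ^ n)⁻¹ * ((1 + ‖p.1 + p.2 - k‖) ^ n)⁻¹ *
          ((1 + ‖p.2‖) ^ n)⁻¹) := by ring
      _ ≤ _ := by
          gcongr
          norm_num
  · have e : k₁ + y - k - (k₁ + y' - k) = y - y' := by abel
    have c1 := b₁ k₁
    have c2 := b₂ (k₁ + y - k)
    have c3 := b₃ y
    have d2 := l₂ (k₁ + y - k) (k₁ + y' - k) (by rwa [e])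
    have d3 := l₃ y y' hy
    rw [e] at d2
    have c2' : |f₂ (k₁ + y' - k)| ≤ 2 * K * ((1 + ‖k₁ + y - k‖) ^ n)⁻¹ := by
      have h1 : |f₂ (k₁ + y - k) - f₂ (k₁ + y' - k)| ≤ K * ((1 + ‖k₁ + y - k‖) ^ n)⁻¹ * 1 :=
        d2.trans (by gcongr)
      have h2 := abs_le.1 h1
      have h3 := abs_le.1 c2
      rw [abs_le]
      constructor <;> linarith [h2.1, h2.2, h3.1, h3.2]
    rw [← Complex.ofReal_sub, Complex.norm_real, Real.norm_eq_abs, hpow]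
    simp only [tripleProd]
    rw [show f₁ k₁ * f₂ (k₁ + y - k) * f₃ y - f₁ k₁ * f₂ (k₁ + y' - k) * f₃ y' =
      f₁ k₁ * (f₂ (k₁ + y - k) - f₂ (k₁ + y' - k)) * f₃ y +
        f₁ k₁ * f₂ (k₁ + y' - k) * (f₃ y - f₃ y') by ring]
    refine (abs_add_le _ _).trans ?_
    rw [abs_mul, abs_mul, abs_mul, abs_mul]
    calc _ ≤ (K * ((1 + ‖k₁‖) ^ n)⁻¹) * (K * ((1 + ‖k₁ + y - k‖) ^ n)⁻¹ * ‖y - y'‖) *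
          (K * ((1 + ‖y‖) ^ n)⁻¹) + (K * ((1 + ‖k₁‖) ^ n)⁻¹) *
          (2 * K * ((1 + ‖k₁ + y - k‖) ^ n)⁻¹) * (K * ((1 + ‖y‖) ^ n)⁻¹ * ‖y - y'‖) := by gcongr
      _ = _ := by ring

lemma TameAmplitude.of_add {k : WaveSpace d} {n j : ℕ} {M : ℝ}
    {A : WaveSpace d × WaveSpace d → ℂ} (hA : TameAmplitude k (n + j) M A) :
    TameAmplitude k n M A := by
  have hM := hA.nonneg
  have h : ∀ p, (pairBracket k p ^ (n + j))⁻¹ ≤ (pairBracket k p ^ n)⁻¹ := by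
    intro p
    have h1 := one_le_pairBracket k p
    exact inv_anti₀ (by positivity) (pow_le_pow_right₀ h1 (by omega))
  exact ⟨hA.continuous, fun p => (hA.bound p).trans (mul_le_mul_of_nonneg_left (h p) hM),
    fun k₁ y y' hy => (hA.lipschitz k₁ y y' hy).trans
      (mul_le_mul_of_nonneg_right (mul_le_mul_of_nonneg_left (h _) hM) (norm_nonneg _))⟩

end Schwartz

/-! ### Limits from a two-parameter comparison. -/

section Limits

/-- `D ε` serves as a pivot: two values of `Z` differ by `K` times the sum of the two roots, up to a
term in `√ε` that disappears as `ε → 0`. This makes `Z` Cauchy and removes `R` from the final bound.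
-/
lemma exists_limit_of_abs_sub_le {Z D : ℝ → ℝ} {K R : ℝ} (hK : 0 ≤ K)
    (h : ∀ ν ∈ Set.Ioc (0 : ℝ) (1 / 2), ∀ ε > 0, |Z ν - D ε| ≤ K * (√ν + √ε * R)) :
    ∃ Z₀, ∀ ν ∈ Set.Ioc (0 : ℝ) (1 / 2), |Z ν - Z₀| ≤ K * √ν := by
  set u : ℕ → ℝ := fun n => 1 / ((n : ℝ) + 2) with hu
  have hu0 : ∀ n, 0 < u n := fun n => by simp only [hu]; positivity
  have hu1 : ∀ n, u n ∈ Set.Ioc (0 : ℝ) (1 / 2) := fun n => ⟨hu0 n, by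
    simp only [hu]; gcongr; linarith [(Nat.cast_nonneg n : (0 : ℝ) ≤ n)]⟩
  have huanti : ∀ n N, N ≤ n → u n ≤ u N := fun n N hn => by
    simp only [hu]; gcongr
  have hulim : Tendsto u atTop (𝓝 0) :=
    tendsto_const_nhds.div_atTop (tendsto_atTop_add_const_right _ _ tendsto_natCast_atTop_atTop)
  have hsq : Tendsto (fun n => √(u n)) atTop (𝓝 0) := by
    have := (Real.continuous_sqrt.tendsto 0).comp hulim
    rwa [Real.sqrt_zero] at this
  have htri : ∀ ν ∈ Set.Ioc (0 : ℝ) (1 / 2), ∀ n N, N ≤ n →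
      |Z ν - Z (u n)| ≤ K * √ν + K * (1 + 2 * R) * √(u N) := by
    intro ν hν n N hn
    have h1 := h ν hν (u N) (hu0 N)
    have h2 := h (u n) (hu1 n) (u N) (hu0 N)
    have h3 : K * √(u n) ≤ K * √(u N) := by gcongr; exact huanti n N hn
    calc |Z ν - Z (u n)| = |(Z ν - D (u N)) - (Z (u n) - D (u N))| := by ring_nf
      _ ≤ |Z ν - D (u N)| + |Z (u n) - D (u N)| := abs_sub _ _
      _ ≤ K * √ν + K * (1 + 2 * R) * √(u N) := by nlinarith
  have hc : CauchySeq fun n => Z (u n) := by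
    refine cauchySeq_of_le_tendsto_0 (fun N => K * √(u N) + K * (1 + 2 * R) * √(u N)) ?_ ?_
    · intro n m N hn hm
      rw [Real.dist_eq]
      refine (htri (u n) (hu1 n) m N hm).trans ?_
      gcongr
      exact huanti n N hn
    · simpa using (hsq.const_mul K).add (hsq.const_mul (K * (1 + 2 * R)))
  obtain ⟨Z₀, hZ₀⟩ := cauchySeq_tendsto_of_complete hc
  refine ⟨Z₀, fun ν hν => ?_⟩
  have h1 : Tendsto (fun n => |Z ν - Z (u n)|) atTop (𝓝 |Z ν - Z₀|) :=
    (tendsto_const_nhds.sub hZ₀).abs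
  have h2 : Tendsto (fun N => K * √ν + K * (1 + 2 * R) * √(u N)) atTop (𝓝 (K * √ν)) := by
    simpa using tendsto_const_nhds.add (hsq.const_mul (K * (1 + 2 * R)))
  exact le_of_tendsto_of_tendsto' h1 h2 fun n => htri ν hν n n le_rfl

/-- Coupling `ν` to `ε` transfers convergence from `Z` to `D`. The limit does not depend on `D`,
which is what makes all approximations of the identity agree. -/
lemma tendsto_of_abs_sub_le {Z D : ℝ → ℝ} {K R Z₀ : ℝ} (hK : 0 ≤ K)
    (h : ∀ ν ∈ Set.Ioc (0 : ℝ) (1 / 2), ∀ ε > 0, |Z ν - D ε| ≤ K * (√ν + √ε * R))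
    (h₀ : ∀ ν ∈ Set.Ioc (0 : ℝ) (1 / 2), |Z ν - Z₀| ≤ K * √ν) :
    Tendsto D (𝓝[>] 0) (𝓝 Z₀) := by
  have hsq : Tendsto (fun ε : ℝ => K * (2 + R) * √ε) (𝓝[>] 0) (𝓝 0) := by
    have : Tendsto (fun ε : ℝ => K * (2 + R) * √ε) (𝓝 0) (𝓝 (K * (2 + R) * √0)) :=
      (Real.continuous_sqrt.tendsto 0).const_mul _
    rw [Real.sqrt_zero, mul_zero] at this
    exact this.mono_left nhdsWithin_le_nhds
  rw [tendsto_iff_dist_tendsto_zero]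
  refine squeeze_zero' (Eventually.of_forall fun _ => dist_nonneg) ?_ hsq
  filter_upwards [self_mem_nhdsWithin] with ε hε
  have hε0 : 0 < ε := hε
  set ν := min ε (1 / 2) with hν
  have hν1 : ν ∈ Set.Ioc (0 : ℝ) (1 / 2) := ⟨lt_min hε0 (by norm_num), min_le_right _ _⟩
  have h1 := h ν hν1 ε hε0
  have h2 := h₀ ν hν1
  have h3 : K * √ν ≤ K * √ε := by gcongr; exact min_le_left _ _
  rw [Real.dist_eq]
  calc |D ε - Z₀| = |(Z ν - Z₀) - (Z ν - D ε)| := by ring_nf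
    _ ≤ |Z ν - Z₀| + |Z ν - D ε| := abs_sub _ _
    _ ≤ K * (2 + R) * √ε := by nlinarith

end Limits

/-! ### Comparison of the Lorentzian with approximations of the identity. -/

section Main

variable {d : ℕ} {ζ : Fin d → ℝ} {r : ℝ}

lemma integrable_exp_mul_cauchyKer_gammaMinus (hζ : ∀ j, ζ j ∈ Set.Icc (1 : ℝ) 2)
    (hr : r ∈ Set.Ioc (0 : ℝ) 1) {ν : ℝ} (hν : ν ∈ Set.Ioc (0 : ℝ) (1 / 2)) {k : WaveSpace d}
    {M : ℝ} {A : WaveSpace d × WaveSpace d → ℂ} (hA : TameAmplitude k (d + 1) M A) (s : ℝ) :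
    Integrable fun p => Complex.exp (Complex.I * ((s * resOmega ζ k p : ℝ) : ℂ)) *
      cauchyKer (ν * gammaMinus ζ r k p) (resOmega ζ k p) * A p := by
  obtain ⟨c, hc, hden⟩ := exists_sq_le_denominator hζ hr
  have hc0 := hc.1
  have hν0 := hν.1
  have hM := hA.nonneg
  refine (integrable_of_norm_le_pairWeight (K := c⁻¹ * (4 * ν⁻¹) * M) ?_ fun p => ?_).1
  · have h1 := continuous_cauchyKer_gammaMinus hζ hr hν k
    have h3 := continuous_resOmega (ζ := ζ) k
    exact ((by fun_prop : Continuous fun p => Complex.exp (Complex.I *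
      ((s * resOmega ζ k p : ℝ) : ℂ))).mul h1).mul hA.continuous
  · rw [norm_mul, norm_mul, norm_exp_I_mul_ofReal, one_mul, mul_assoc (c⁻¹ * _)]
    have h1 := norm_cauchyKer_le_of_sq_le hc0 hν0 (hden ν hν k p)
    have h2 := norm_cauchyKer_le_two_mul hν0 (resOmega ζ k p)
    have h3 : (ν + |resOmega ζ k p|)⁻¹ ≤ ν⁻¹ := by
      gcongr
      linarith [abs_nonneg (resOmega ζ k p)]
    have hi : 0 < ν⁻¹ := by positivity
    gcongr
    · exact h1.trans (by gcongr; linarith)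
    · exact hA.norm_le p

lemma integral_mul_sqrt_rescale (ρ : ℝ → ℝ) {ε : ℝ} (hε : 0 < ε)
    (hi : Integrable fun u => |ρ u| * √|u|) :
    Integrable (fun w => |ε⁻¹ * ρ (w / ε)| * √|w|) ∧
    ∫ w, |ε⁻¹ * ρ (w / ε)| * √|w| = √ε * ∫ u, |ρ u| * √|u| := by
  have h : (fun w => |ε⁻¹ * ρ (w / ε)| * √|w|) =
      fun w => ε⁻¹ * √ε * (fun u => |ρ u| * √|u|) (ε⁻¹ * w) := by
    ext w
    have h2 : √|w| = √ε * √|ε⁻¹ * w| := by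
      rw [← Real.sqrt_mul hε.le, abs_mul, abs_inv, abs_of_pos hε]
      congr 1
      field_simp
    rw [h2, abs_mul, abs_of_pos (inv_pos.2 hε), div_eq_inv_mul]
    ring
  rw [h]
  refine ⟨(hi.comp_mul_left' (inv_ne_zero hε.ne')).const_mul _, ?_⟩
  rw [integral_const_mul, Measure.integral_comp_mul_left (fun u => |ρ u| * √|u|) ε⁻¹, inv_inv,
    abs_of_pos hε, smul_eq_mul]
  field_simp

/-- Comparison of the Lorentzian with an arbitrary approximation of the identity. -/
lemma exists_abs_lorentzian_sub_approx_le (hd : 2 ≤ d) (hζ : ∀ j, ζ j ∈ Set.Icc (1 : ℝ) 2)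
    (hr : r ∈ Set.Ioc (0 : ℝ) 1) :
    ∃ C : ℝ, 0 ≤ C ∧ ∀ (k : WaveSpace d) (M : ℝ) (F : WaveSpace d × WaveSpace d → ℝ),
      TameAmplitude k (d + 1 + 2) M (fun p => (F p : ℂ)) → ∀ ρ : ℝ → ℝ, Continuous ρ →
      HasCompactSupport ρ → ∫ u, ρ u = 1 → ∀ ν ∈ Set.Ioc (0 : ℝ) (1 / 2), ∀ ε > 0,
      Integrable (fun p => ε⁻¹ * ρ (resOmega ζ k p / ε) * F p) ∧
      |(∫ p, Complex.exp (Complex.I * (((0 : ℝ) * resOmega ζ k p : ℝ) : ℂ)) *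
        cauchyKer (ν * gammaMinus ζ r k p) (resOmega ζ k p) * F p).re -
        Real.pi * ∫ p, ε⁻¹ * ρ (resOmega ζ k p / ε) * F p| ≤
        C * M * (√ν + √ε * ∫ u, |ρ u| * √|u|) := by
  obtain ⟨C₁, hC₁0, hC₁⟩ := exists_norm_integral_kernel_mul_le hd hζ
  obtain ⟨C₂, hC₂0, hC₂⟩ := exists_norm_integral_gammaMinus_sub_le hd hζ hr
  have hS := sqrtMoment_nonneg
  have hpi := Real.pi_pos
  refine ⟨C₂ + C₁ * (sqrtMoment + Real.pi), by positivity, ?_⟩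
  intro k M F hF ρ hρ hρc hρ1 ν hν ε hε
  have hν0 := hν.1
  have hM := hF.nonneg
  have hF1 : TameAmplitude k (d + 1) M (fun p => (F p : ℂ)) := hF.of_add
  obtain ⟨Kρ, hKρ⟩ := hρc.exists_bound_of_continuous hρ
  have hρi : Integrable ρ := hρ.integrable_of_hasCompactSupport hρc
  have hρm : Integrable fun u => |ρ u| * √|u| :=
    (by fun_prop : Continuous fun u => |ρ u| * √|u|).integrable_of_hasCompactSupport
      (hρc.abs.mul_right)
  set g : ℝ → ℝ := fun w => ε⁻¹ * ρ (w / ε) with hg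
  have hgc : Continuous g := by fun_prop
  have hgb : ∀ w, ‖(g w : ℂ)‖ ≤ ε⁻¹ * Kρ := by
    intro w
    rw [Complex.norm_real, norm_mul, Real.norm_of_nonneg (by positivity)]
    gcongr
    exact hKρ _
  have hgi : Integrable g := (hρi.comp_div hε.ne').const_mul _
  have hg1 : ∫ w, g w = 1 := by
    simp only [hg]
    rw [integral_const_mul, Measure.integral_comp_div, hρ1, abs_of_pos hε, smul_eq_mul, mul_one,
      inv_mul_cancel₀ hε.ne']
  obtain ⟨hgm, hgmv⟩ := integral_mul_sqrt_rescale ρ hε hρm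
  have hgF := (hF1.integrable_comp_mul (ζ := ζ) (h := fun w => (g w : ℂ)) (by fun_prop) hgb).1
  have hgF' : Integrable (fun p => g (resOmega ζ k p) * F p) := by
    refine hgF.re.congr (ae_of_all _ fun p => ?_)
    simp only [← Complex.ofReal_mul]
    exact Complex.ofReal_re _
  refine ⟨hgF', ?_⟩
  set P : ℝ → ℝ := fun w => ν / (ν ^ 2 + w ^ 2) with hP
  have hPc : Continuous P := Continuous.div (by fun_prop) (by fun_prop) fun w => by positivity
  have hPi : Integrable P := by
    simp only [hP, div_eq_mul_inv]
    exact (integrable_inv_sq_add_sq hν0).const_mul ν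
  have hP0 : ∀ w, 0 ≤ P w := fun w => by simp only [hP]; positivity
  have hPb : ∀ w, ‖(P w : ℂ)‖ ≤ ν⁻¹ := by
    intro w
    rw [Complex.norm_real, Real.norm_of_nonneg (hP0 w)]
    simp only [hP]
    rw [inv_eq_one_div, div_le_div_iff₀ (by positivity) hν0]
    nlinarith [sq_nonneg w]
  have hPm : Integrable (fun w => P w * √|w|) ∧ ∫ w, P w * √|w| = √ν * sqrtMoment := by
    simp only [hP, div_eq_mul_inv, mul_assoc]
    refine ⟨(integrable_inv_sq_add_sq_mul_sqrt hν0).const_mul ν, ?_⟩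
    rw [integral_const_mul, integral_inv_sq_add_sq_mul_sqrt hν0]
    field_simp
  have hPv : ∫ w, P w = Real.pi := by
    simp only [hP, div_eq_mul_inv]
    rw [integral_const_mul, integral_univ_inv_sq_add_sq hν0]
    field_simp
  -- The Lorentzian has mass `π` and `g` has mass one, so `h` has integral zero; its `√|w|` moment
  -- is of order `√ν + √ε`.
  set h : ℝ → ℂ := fun w => (P w : ℂ) - Real.pi * (g w : ℂ) with hh
  have hnorm : ∀ w, ‖h w‖ ≤ P w + Real.pi * |g w| := by
    intro w
    refine (norm_sub_le _ _).trans (le_of_eq ?_)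
    rw [norm_mul, Complex.norm_real, Complex.norm_real, Complex.norm_real,
      Real.norm_of_nonneg (hP0 w), Real.norm_of_nonneg hpi.le, Real.norm_eq_abs]
  have hmaj : Integrable fun w => P w * √|w| + Real.pi * (|g w| * √|w|) :=
    hPm.1.add (hgm.const_mul _)
  have hbd : ∀ w, ‖h w‖ * √|w| ≤ P w * √|w| + Real.pi * (|g w| * √|w|) := by
    intro w
    calc _ ≤ (P w + Real.pi * |g w|) * √|w| := by gcongr; exact hnorm w
      _ = _ := by ring
  have hhc : Continuous h := by fun_prop
  have hhm : Integrable fun w => ‖h w‖ * √|w| :=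
    hmaj.mono' (Continuous.aestronglyMeasurable (by fun_prop)) (ae_of_all _ fun w => by
      rw [Real.norm_of_nonneg (by positivity)]; exact hbd w)
  have hhv : ∫ w, ‖h w‖ * √|w| ≤ √ν * sqrtMoment + Real.pi * (√ε * ∫ u, |ρ u| * √|u|) := by
    refine (integral_mono hhm hmaj hbd).trans (le_of_eq ?_)
    rw [integral_add hPm.1 (hgm.const_mul _), integral_const_mul, hPm.2, hgmv]
  have b1 := hC₁ k M _ hF1 h hhc ⟨ν⁻¹ + Real.pi * (ε⁻¹ * Kρ), fun w => by
      refine (norm_sub_le _ _).trans ?_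
      rw [norm_mul, Complex.norm_real Real.pi, Real.norm_of_nonneg hpi.le]
      gcongr
      · exact hPb w
      · exact hgb w⟩ (hPi.ofReal.sub (hgi.ofReal.const_mul _)) (by
      rw [integral_sub hPi.ofReal (hgi.ofReal.const_mul _), integral_const_mul,
        integral_complex_ofReal, integral_complex_ofReal, hPv, hg1]
      simp) hhm
  have b2 := hC₂ k M _ hF 0 le_rfl ν hν
  set I₁ := ∫ p, Complex.exp (Complex.I * (((0 : ℝ) * resOmega ζ k p : ℝ) : ℂ)) *
        cauchyKer (ν * gammaMinus ζ r k p) (resOmega ζ k p) * F p with hI₁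
  have i1 := integrable_exp_mul_cauchyKer_gammaMinus hζ hr hν hF1 0
  have i2 : Integrable fun p => Complex.exp (Complex.I * (((0 : ℝ) * resOmega ζ k p : ℝ) : ℂ)) *
      cauchyKer ν (resOmega ζ k p) * (F p : ℂ) := by
    refine ((hF1.integrable_comp_mul (ζ := ζ) (continuous_cauchyKer hν0)
      (K := 2 * ν⁻¹) fun w => ?_).1).congr (ae_of_all _ fun p => by simp)
    refine (norm_cauchyKer_le_two_mul hν0 w).trans ?_
    gcongr
    linarith [abs_nonneg w]
  set I₂ := ∫ p, Complex.exp (Complex.I * (((0 : ℝ) * resOmega ζ k p : ℝ) : ℂ)) *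
      cauchyKer ν (resOmega ζ k p) * (F p : ℂ) with hI₂
  have e2 : ∫ p, Complex.exp (Complex.I * (((0 : ℝ) * resOmega ζ k p : ℝ) : ℂ)) *
        (cauchyKer (ν * gammaMinus ζ r k p) (resOmega ζ k p) -
          cauchyKer ν (resOmega ζ k p)) * F p = I₁ - I₂ := by
    rw [hI₁, hI₂, ← integral_sub i1 i2]
    refine integral_congr_ae (ae_of_all _ fun p => ?_)
    simp only; ring
  have hPF := (hF1.integrable_comp_mul (ζ := ζ) (h := fun w => (P w : ℂ)) (by fun_prop) hPb).1
  have e3 : I₂.re = ∫ p, P (resOmega ζ k p) * F p := by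
    rw [hI₂]
    have := integral_re i2
    simp only [RCLike.re_to_complex] at this
    rw [← this]
    refine integral_congr_ae (ae_of_all _ fun p => ?_)
    simp only [zero_mul, Complex.ofReal_zero, mul_zero, Complex.exp_zero, one_mul,
      Complex.re_mul_ofReal, re_cauchyKer, hP]
  have e1 : ∫ p, h (resOmega ζ k p) * F p =
      ((∫ p, P (resOmega ζ k p) * F p : ℝ) : ℂ) -
        ((Real.pi * ∫ p, g (resOmega ζ k p) * F p : ℝ) : ℂ) := by
    rw [Complex.ofReal_mul, ← integral_complex_ofReal, ← integral_complex_ofReal,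
      ← integral_const_mul]
    simp only [Complex.ofReal_mul]
    rw [← integral_sub hPF (hgF.const_mul _)]
    refine integral_congr_ae (ae_of_all _ fun p => ?_)
    simp only [hh]; ring
  rw [e2] at b2
  rw [e1, ← e3, ← Complex.ofReal_sub, Complex.norm_real, Real.norm_eq_abs] at b1
  have b3 := (Complex.abs_re_le_norm _).trans b2
  rw [Complex.sub_re] at b3
  have hR : 0 ≤ ∫ u, |ρ u| * √|u| := integral_nonneg fun u => by positivity
  set R := ∫ u, |ρ u| * √|u|
  have hqν := Real.sqrt_nonneg ν
  have hqε := Real.sqrt_nonneg ε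
  change |I₁.re - Real.pi * ∫ p, g (resOmega ζ k p) * F p| ≤ _
  set D := ∫ p, g (resOmega ζ k p) * F p
  calc |I₁.re - Real.pi * D| = |(I₁.re - I₂.re) + (I₂.re - Real.pi * D)| := by ring_nf
    _ ≤ |I₁.re - I₂.re| + |I₂.re - Real.pi * D| := abs_add_le _ _
    _ ≤ C₂ * (M * √ν) + C₁ * (M * (√ν * sqrtMoment + Real.pi * (√ε * R))) := by
        refine add_le_add b3 (b1.trans ?_)
        gcongr
    _ ≤ _ := by
        have x1 : 0 ≤ M * √ν := by positivity
        have x2 : 0 ≤ M * (√ε * R) := by positivity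
        have y1 : 0 ≤ C₁ * Real.pi := by positivity
        have y2 : 0 ≤ C₁ * sqrtMoment := by positivity
        nlinarith [mul_nonneg x1 y1, mul_nonneg x2 y2, mul_nonneg x2 hC₂0]

end Main

/-! ### Rewriting the integrands; logarithmic and oscillatory bounds. -/

section Main

variable {d : ℕ} {ζ : Fin d → ℝ} {r : ℝ}

/-- The trivial exponential with `s = 0` is kept so that estimates stated for general `s` apply as
they stand. -/
lemma S1Integrand_eq (hζ : ∀ j, ζ j ∈ Set.Icc (1 : ℝ) 2) (hr : r ∈ Set.Ioc (0 : ℝ) 1) {ν : ℝ}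
    (hν : ν ∈ Set.Ioc (0 : ℝ) (1 / 2)) (f₁ f₂ f₃ : ℝ → 𝓢(WaveSpace d, ℝ)) (k : WaveSpace d)
    (t : ℝ) (p : WaveSpace d × WaveSpace d) :
    S1Integrand ζ r ν f₁ f₂ f₃ k t p =
      (Complex.exp (Complex.I * (((0 : ℝ) * resOmega ζ k p : ℝ) : ℂ)) *
        cauchyKer (ν * gammaMinus ζ r k p) (resOmega ζ k p) *
          (tripleProd (f₁ t) (f₂ t) (f₃ t) k p : ℂ)).re := by
  obtain ⟨c, hc, hden⟩ := exists_sq_le_denominator hζ hr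
  have hc0 := hc.1
  have hν0 := hν.1
  have hpos : 0 < (ν * gammaMinus ζ r k p) ^ 2 + resOmega ζ k p ^ 2 :=
    lt_of_lt_of_le (by positivity) (hden ν hν k p)
  simp only [zero_mul, Complex.ofReal_zero, mul_zero, Complex.exp_zero, one_mul,
    Complex.re_mul_ofReal, re_cauchyKer, S1Integrand]
  congr 1
  have e : gammaMinus ζ r k p ^ 2 + (ν⁻¹ * resOmega ζ k p) ^ 2 =
      (ν ^ 2)⁻¹ * ((ν * gammaMinus ζ r k p) ^ 2 + resOmega ζ k p ^ 2) := by
    field_simp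
  rw [e]
  field_simp

lemma S2Integrand_eq {ν : ℝ} (hν : 0 < ν) (lam : ℝ) (f₁ f₂ f₃ : ℝ → 𝓢(WaveSpace d, ℝ))
    (k : WaveSpace d) (t τ : ℝ) (p : WaveSpace d × WaveSpace d) :
    S2Integrand ζ r ν lam f₁ f₂ f₃ k t τ p =
      (Complex.exp (Complex.I * ((Tkin lam * τ * resOmega ζ k p : ℝ) : ℂ)) *
        cauchyKer (ν * gammaMinus ζ r k p) (resOmega ζ k p) *
          ((Real.exp (-(varrho ν lam * τ * gammaPlus ζ r k p)) : ℂ) *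
            (tripleProd (f₁ t) (f₂ t) (f₃ t) k p : ℂ))).re := by
  rw [← Complex.ofReal_mul, Complex.re_mul_ofReal, S2Integrand, mul_assoc]
  congr 2
  · rw [show Tkin lam * resOmega ζ k p * τ = Tkin lam * τ * resOmega ζ k p by ring, mul_comm
      ((ν⁻¹ : ℝ) : ℂ), mul_div_assoc, cauchyKer]
    congr 1
    have hν' : (ν : ℂ) ≠ 0 := Complex.ofReal_ne_zero.2 hν.ne'
    rw [Complex.ofReal_inv, div_eq_mul_inv, ← mul_inv]
    congr 1
    push_cast
    field_simp
  · rw [show varrho ν lam * gammaPlus ζ r k p * τ = varrho ν lam * τ * gammaPlus ζ r k p by ring]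

lemma abs_integral_re_le {Φ : WaveSpace d × WaveSpace d → ℂ} (hΦ : Integrable Φ) :
    |∫ p, (Φ p).re| ≤ ‖∫ p, Φ p‖ := by
  have h := integral_re hΦ
  simp only [RCLike.re_to_complex] at h
  rw [h]
  exact Complex.abs_re_le_norm _

/-- The logarithmic bound of the oscillatory integrals. -/
lemma exists_norm_integral_gammaMinus_le_log (hd : 2 ≤ d) (hζ : ∀ j, ζ j ∈ Set.Icc (1 : ℝ) 2)
    (hr : r ∈ Set.Ioc (0 : ℝ) 1) :
    ∃ C : ℝ, 0 ≤ C ∧ ∀ (k : WaveSpace d) (M : ℝ) (A : WaveSpace d × WaveSpace d → ℂ),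
      TameAmplitude k (d + 1 + 2) M A → ∀ s : ℝ, ∀ ν ∈ Set.Ioc (0 : ℝ) (1 / 2),
      ‖∫ p, Complex.exp (Complex.I * ((s * resOmega ζ k p : ℝ) : ℂ)) *
        cauchyKer (ν * gammaMinus ζ r k p) (resOmega ζ k p) * A p‖ ≤
        C * (M * |Real.log ν|) := by
  obtain ⟨C, hC0, hC⟩ := exists_integral_pairWeight_mul_comp_resOmega_le hd hζ
  obtain ⟨c, hc, hden⟩ := exists_sq_le_denominator hζ hr
  have hc0 := hc.1
  refine ⟨c⁻¹ * 2 * 27 * (C * 8), by positivity, fun k M A hA s ν hν => ?_⟩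
  have hν0 := hν.1
  have hν1 : ν < 1 := by linarith [hν.2]
  have hM := hA.nonneg
  have hB := hA.one_sub_mul hζ
  set m : ℝ → ℝ := fun w => ((ν + |w|) * (1 + |w|))⁻¹ with hm
  have hmc : Continuous m := Continuous.inv₀ (by fun_prop) fun w => by positivity
  have hm0 : ∀ w, 0 ≤ m w := fun w => by simp only [hm]; positivity
  have hmb : ∀ w, m w ≤ ν⁻¹ := by
    intro w
    simp only [hm]
    have := abs_nonneg w
    gcongr
    nlinarith
  have hpi : Integrable fun p => pairWeight p * m (resOmega ζ k p) := by
    refine (integrable_pairWeight.mul_const ν⁻¹).mono' ?_ (ae_of_all _ fun p => ?_)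
    · exact integrable_pairWeight.aestronglyMeasurable.mul
        (hmc.comp (continuous_resOmega k)).aestronglyMeasurable
    · have := (pairWeight_pos p).le
      rw [Real.norm_of_nonneg (mul_nonneg this (hm0 _))]
      gcongr
      exact hmb _
  have key := hC k m hmc hm0 (integrable_inv_add_abs_mul hν0 hν1).1 hpi
  have hbd : ∀ p, ‖Complex.exp (Complex.I * ((s * resOmega ζ k p : ℝ) : ℂ)) *
      cauchyKer (ν * gammaMinus ζ r k p) (resOmega ζ k p) * A p‖ ≤
      c⁻¹ * 2 * (27 * M) * 2 * (pairWeight p * m (resOmega ζ k p)) := by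
    intro p
    rw [norm_mul, norm_mul, norm_exp_I_mul_ofReal, one_mul]
    have h1 := norm_cauchyKer_le_of_sq_le hc0 hν0 (hden ν hν k p)
    have h2 := norm_cauchyKer_le_two_mul hν0 (resOmega ζ k p)
    have h3 := hB.norm_le p
    -- Dividing the bound for `(1 - i Ω) A` by `|1 - i Ω|` gives the amplitude decay in `Ω`, which
    -- keeps the `w`-integral finite at infinity.
    rw [norm_mul, norm_sub_I_mul, mul_comm, ← le_div_iff₀ (Real.sqrt_pos.2 (by positivity)),
      div_eq_mul_inv, ← norm_cauchyKer] at h3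
    have h4 := norm_cauchyKer_le_two_mul one_pos (resOmega ζ k p)
    have hw := pairWeight_pos p
    calc _ ≤ (c⁻¹ * (2 * (ν + |resOmega ζ k p|)⁻¹)) *
          (27 * M * pairWeight p * (2 * (1 + |resOmega ζ k p|)⁻¹)) := by
          gcongr
          · exact h1.trans (by gcongr)
          · exact h3.trans (by gcongr)
      _ = _ := by simp only [hm, mul_inv]; ring
  refine (norm_integral_le_of_norm_le (hpi.const_mul _) (ae_of_all _ hbd)).trans ?_
  rw [integral_const_mul]
  have h5 := integral_inv_add_abs_mul_le hν0 hν.2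
  calc _ ≤ c⁻¹ * 2 * (27 * M) * 2 * (C * (4 * |Real.log ν|)) := by
        gcongr
        exact key.trans (by gcongr)
    _ = _ := by ring

lemma sqrt_le_rpow {ν : ℝ} (hν : ν ∈ Set.Ioc (0 : ℝ) (1 / 2)) : √ν ≤ ν ^ (1 / 8 : ℝ) := by
  rw [Real.sqrt_eq_rpow]
  exact Real.rpow_le_rpow_of_exponent_ge hν.1 (by linarith [hν.2]) (by norm_num)

/-- In terms of `q = ν^(1/16)` all exponents are integers: `π / s ≤ 4 q¹⁴`, so the three terms are
of size `q⁷ |log ν|`, `q⁶` and `q⁵`. The logarithm is absorbed by `q⁵`, and everything is at most a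
multiple of `q² = ν^(1/8)`. -/
lemma error_le_rpow {ν s : ℝ} (hν : ν ∈ Set.Ioc (0 : ℝ) (1 / 2)) (hs0 : 0 < s)
    (hs : ν⁻¹ * ν ^ (1 / 8 : ℝ) ≤ s) :
    √(Real.pi / s) * |Real.log ν| + (Real.pi / s) * (ν⁻¹ * √ν + √(Real.pi / s) * ν⁻¹) ≤
      20 * ν ^ (1 / 8 : ℝ) := by
  have hν0 := hν.1
  have hν1 : ν ≤ 1 := by linarith [hν.2]
  set q : ℝ := ν ^ (1 / 16 : ℝ) with hq
  have hq0 : 0 < q := by positivity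
  have hq1 : q ≤ 1 := Real.rpow_le_one hν0.le hν1 (by norm_num)
  have hpow : ∀ n : ℕ, q ^ n = ν ^ ((n : ℝ) / 16) := by
    intro n
    rw [hq, ← Real.rpow_natCast, ← Real.rpow_mul hν0.le]
    congr 1; ring
  have e2 : ν ^ (1 / 8 : ℝ) = q ^ 2 := by rw [hpow]; norm_num
  have e5 : ν ^ (5 / 16 : ℝ) = q ^ 5 := by rw [hpow]; norm_num
  have e16 : ν = q ^ 16 := by rw [hpow]; norm_num
  have hinv : ν⁻¹ = (q ^ 16)⁻¹ := by rw [← e16]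
  have e8 : √ν = q ^ 8 := by rw [hpow, Real.sqrt_eq_rpow]; norm_num
  have hlog := (Real.abs_log_mul_self_rpow_lt ν (5 / 16) hν0 hν1 (by norm_num)).le
  rw [abs_mul, e5, abs_of_pos (pow_pos hq0 5)] at hlog
  have hδ : Real.pi / s ≤ 4 * q ^ 14 := by
    have h1 : (q ^ 14)⁻¹ ≤ s := by
      refine le_trans (le_of_eq ?_) hs
      rw [e2, hinv]
      field_simp
    rw [div_le_iff₀ hs0]
    have h2 : 1 ≤ q ^ 14 * s := by
      have := mul_le_mul_of_nonneg_left h1 (pow_pos hq0 14).le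
      rwa [mul_inv_cancel₀ (pow_pos hq0 14).ne'] at this
    nlinarith [Real.pi_le_four]
  have hsδ : √(Real.pi / s) ≤ 2 * q ^ 7 := by
    rw [Real.sqrt_le_left (by positivity)]
    refine hδ.trans (le_of_eq ?_)
    ring
  have hδ0 : 0 < Real.pi / s := div_pos Real.pi_pos hs0
  have hL := abs_nonneg (Real.log ν)
  rw [e2, e8]
  rw [hinv]
  have t1 : √(Real.pi / s) * |Real.log ν| ≤ 8 * q ^ 2 := by
    calc _ ≤ 2 * q ^ 7 * |Real.log ν| := by gcongr
      _ = 2 * q ^ 2 * (|Real.log ν| * q ^ 5) := by ring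
      _ ≤ 2 * q ^ 2 * (1 / (5 / 16)) := by gcongr
      _ ≤ _ := by nlinarith [pow_pos hq0 2]
  have t2 : Real.pi / s * ((q ^ 16)⁻¹ * q ^ 8 + √(Real.pi / s) * (q ^ 16)⁻¹) ≤ 12 * q ^ 2 := by
    calc _ ≤ 4 * q ^ 14 * ((q ^ 16)⁻¹ * q ^ 8 + 2 * q ^ 7 * (q ^ 16)⁻¹) := by gcongr
      _ = 4 * q ^ 6 + 8 * q ^ 5 := by field_simp; ring
      _ ≤ 4 * q ^ 2 + 8 * q ^ 2 := by
          gcongr ?_ * ?_ + ?_ * ?_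
          · exact pow_le_pow_of_le_one hq0.le hq1 (by norm_num)
          · exact pow_le_pow_of_le_one hq0.le hq1 (by norm_num)
      _ = _ := by ring
  linarith

/-- The oscillatory bound, with the coefficient `Γ₋`. -/
lemma exists_norm_integral_gammaMinus_osc_le (hd : 2 ≤ d) (hζ : ∀ j, ζ j ∈ Set.Icc (1 : ℝ) 2)
    (hr : r ∈ Set.Ioc (0 : ℝ) 1) :
    ∃ C : ℝ, 0 ≤ C ∧ ∀ (k : WaveSpace d) (M : ℝ) (A : WaveSpace d × WaveSpace d → ℂ),
      TameAmplitude k (d + 1 + 2) M A → ∀ ν ∈ Set.Ioc (0 : ℝ) (1 / 2), ∀ s : ℝ, 0 < s →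
      ν⁻¹ * ν ^ (1 / 8 : ℝ) ≤ s →
      ‖∫ p, Complex.exp (Complex.I * ((s * resOmega ζ k p : ℝ) : ℂ)) *
        cauchyKer (ν * gammaMinus ζ r k p) (resOmega ζ k p) * A p‖ ≤
        C * (M * ν ^ (1 / 8 : ℝ)) := by
  obtain ⟨C₁, hC₁0, hC₁⟩ := exists_norm_integral_gammaMinus_sub_le hd hζ hr
  obtain ⟨C₂, hC₂0, hC₂⟩ := exists_norm_integral_osc_le hd hζ
  refine ⟨C₁ + C₂ * 20, by positivity, fun k M A hA ν hν s hs0 hs => ?_⟩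
  have hν0 := hν.1
  have hM := hA.nonneg
  have hA1 : TameAmplitude k (d + 1) M A := hA.of_add
  have b1 := hC₁ k M A hA s hs0.le ν hν
  have b2 := hC₂ k M A hA s hs0 ν hν
  have i1 := integrable_exp_mul_cauchyKer_gammaMinus hζ hr hν hA1 s
  have i2 : Integrable fun p => Complex.exp (Complex.I * ((s * resOmega ζ k p : ℝ) : ℂ)) *
      cauchyKer ν (resOmega ζ k p) * A p := by
    have hc := continuous_cauchyKer hν0
    refine (hA1.integrable_comp_mul (ζ := ζ) (h := fun w =>
      Complex.exp (Complex.I * ((s * w : ℝ) : ℂ)) * cauchyKer ν w) (by fun_prop)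
      (K := 2 * ν⁻¹) fun w => ?_).1
    rw [norm_mul, norm_exp_I_mul_ofReal, one_mul]
    refine (norm_cauchyKer_le_two_mul hν0 w).trans ?_
    gcongr
    linarith [abs_nonneg w]
  have e : ∫ p, Complex.exp (Complex.I * ((s * resOmega ζ k p : ℝ) : ℂ)) *
        (cauchyKer (ν * gammaMinus ζ r k p) (resOmega ζ k p) -
          cauchyKer ν (resOmega ζ k p)) * A p =
      (∫ p, Complex.exp (Complex.I * ((s * resOmega ζ k p : ℝ) : ℂ)) *
        cauchyKer (ν * gammaMinus ζ r k p) (resOmega ζ k p) * A p) -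
      ∫ p, Complex.exp (Complex.I * ((s * resOmega ζ k p : ℝ) : ℂ)) *
        cauchyKer ν (resOmega ζ k p) * A p := by
    rw [← integral_sub i1 i2]
    refine integral_congr_ae (ae_of_all _ fun p => ?_)
    simp only; ring
  rw [e] at b1
  set I := ∫ p, Complex.exp (Complex.I * ((s * resOmega ζ k p : ℝ) : ℂ)) *
        cauchyKer (ν * gammaMinus ζ r k p) (resOmega ζ k p) * A p
  set J := ∫ p, Complex.exp (Complex.I * ((s * resOmega ζ k p : ℝ) : ℂ)) *
        cauchyKer ν (resOmega ζ k p) * A p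
  calc ‖I‖ = ‖(I - J) + J‖ := by rw [sub_add_cancel]
    _ ≤ ‖I - J‖ + ‖J‖ := norm_add_le _ _
    _ ≤ C₁ * (M * ν ^ (1 / 8 : ℝ)) + C₂ * (M * (20 * ν ^ (1 / 8 : ℝ))) := by
        refine add_le_add (b1.trans ?_) (b2.trans ?_)
        · gcongr
          exact sqrt_le_rpow hν
        · gcongr
          exact error_le_rpow hν hs0 hs
    _ = _ := by ring

end Main

/-! ### Assembly of the theorem. -/

theorem mainTheorem5 (d : ℕ) (hd : 2 ≤ d) (ζ : Fin d → ℝ) (hζ : ∀ j, ζ j ∈ Set.Icc (1 : ℝ) 2)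
    (r : ℝ) (hr : r ∈ Set.Ioc (0 : ℝ) 1) :
    ∃ θ ∈ Set.Ioo (0 : ℝ) 1, ∀ c₀ : ℝ, 0 < c₀ → ∀ B : ℕ → ℕ → ℝ, ∃ C : ℝ, 0 < C ∧
      ∀ f₁ f₂ f₃ : ℝ → 𝓢(EuclideanSpace ℝ (Fin d), ℝ),
      (∀ t ∈ Set.Icc (0 : ℝ) 1, ∀ m n : ℕ,
        SchwartzMap.seminorm ℝ m n (f₁ t) ≤ B m n ∧
        SchwartzMap.seminorm ℝ m n (f₂ t) ≤ B m n ∧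
        SchwartzMap.seminorm ℝ m n (f₃ t) ≤ B m n) →
      ∀ ν ∈ Set.Ioc (0 : ℝ) (1 / 2), ∀ lam : ℝ, 0 < lam → c₀ ≤ varrho ν lam →
      ∀ t ∈ Set.Icc (0 : ℝ) 1, ∀ k : EuclideanSpace ℝ (Fin d),
        Integrable (S1Integrand ζ r ν f₁ f₂ f₃ k t) volume ∧
        HasDeltaIntegral volume (resOmega ζ k)
          (fun p => 4 * Real.pi * tripleProd (f₁ t) (f₂ t) (f₃ t) k p)
          (K1 ζ (f₁ t) (f₂ t) (f₃ t) k) ∧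
        |S1 ζ r ν f₁ f₂ f₃ k t - K1 ζ (f₁ t) (f₂ t) (f₃ t) k| ≤ C * ν ^ θ ∧
        (∀ τ : ℝ, 0 < τ → Integrable (S2Integrand ζ r ν lam f₁ f₂ f₃ k t τ) volume) ∧
        (∀ τ ∈ Set.Icc ((varrho ν lam)⁻¹ * ν ^ θ) 1,
          |S2 ζ r ν lam f₁ f₂ f₃ k t τ| ≤ C * ν ^ θ) ∧
        (∀ τ ∈ Set.Ioo (0 : ℝ) ((varrho ν lam)⁻¹ * ν ^ θ),
          |S2 ζ r ν lam f₁ f₂ f₃ k t τ| ≤ C * |Real.log ν|) := by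
  obtain ⟨C₁, hC₁0, hC₁⟩ := exists_abs_lorentzian_sub_approx_le hd hζ hr
  obtain ⟨C₂, hC₂0, hC₂⟩ := exists_norm_integral_gammaMinus_osc_le hd hζ hr
  obtain ⟨C₃, hC₃0, hC₃⟩ := exists_norm_integral_gammaMinus_le_log hd hζ hr
  refine ⟨1 / 8, ⟨by norm_num, by norm_num⟩, fun c₀ _ B => ?_⟩
  -- Decay `d + 1` is for integrability in each variable, two powers pay for `1 - i Ω` or `Γ₋ - 1`,
  -- and two more for the factor `exp (-ϱ Γ₊ τ)`.
  obtain ⟨M, hM⟩ := exists_tameAmplitude_tripleProd (d := d) B (d + 1 + 2 + 2)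
  refine ⟨4 * (C₁ * |M| + C₂ * (24 * |M|) + C₃ * (24 * |M|)) + 1, by positivity, ?_⟩
  intro f₁ f₂ f₃ hf ν hν lam hlam _ t ht k
  have hν0 := hν.1
  have hF4 := hM (f₁ t) (f₂ t) (f₃ t) (hf t ht) k
  have hF : TameAmplitude k (d + 1 + 2) M
    (fun p => (tripleProd (f₁ t) (f₂ t) (f₃ t) k p : ℂ)) := hF4.of_add
  have hF1 : TameAmplitude k (d + 1) M
    (fun p => (tripleProd (f₁ t) (f₂ t) (f₃ t) k p : ℂ)) := hF.of_add
  have hM0 := hF.nonneg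
  rw [abs_of_nonneg hM0]
  set F : WaveSpace d × WaveSpace d → ℝ := tripleProd (f₁ t) (f₂ t) (f₃ t) k with hFdef
  have hT : 0 < Tkin lam := by unfold Tkin; positivity
  have hϱ : 0 < varrho ν lam := mul_pos hν0 hT
  have hνθ : 0 < ν ^ (1 / 8 : ℝ) := by positivity
  -- the first integral
  set Z : ℝ → ℝ := fun ν => (∫ p, Complex.exp (Complex.I * (((0 : ℝ) * resOmega ζ k p : ℝ) : ℂ)) *
    cauchyKer (ν * gammaMinus ζ r k p) (resOmega ζ k p) * F p).re with hZ
  have hcomp : ∀ ρ : ℝ → ℝ, Continuous ρ → HasCompactSupport ρ → ∫ s, ρ s = 1 →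
      ∀ ν ∈ Set.Ioc (0 : ℝ) (1 / 2), ∀ ε > 0,
      |Z ν - Real.pi * ∫ p, ε⁻¹ * ρ (resOmega ζ k p / ε) * F p| ≤
        C₁ * M * (√ν + √ε * ∫ u, |ρ u| * √|u|) := fun ρ h1 h2 h3 ν hν ε hε =>
    (hC₁ k M F hF ρ h1 h2 h3 ν hν ε hε).2
  have hK : 0 ≤ C₁ * M := by positivity
  obtain ⟨Z₀, hZ₀⟩ : ∃ Z₀, ∀ ν ∈ Set.Ioc (0 : ℝ) (1 / 2), |Z ν - Z₀| ≤ C₁ * M * √ν := by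
    -- Any one admissible `ρ` produces the limit `Z₀`; it is afterwards seen to be the limit for
    -- every `ρ`.
    let g : ContDiffBump (0 : ℝ) := ⟨1, 2, one_pos, one_lt_two⟩
    exact exists_limit_of_abs_sub_le hK
      (hcomp _ g.continuous_normed g.hasCompactSupport_normed (g.integral_normed (μ := volume)))
  have hdelta : HasDeltaIntegral volume (resOmega ζ k) (fun p => 4 * Real.pi * F p) (4 * Z₀) := by
    intro ρ h1 h2 h3
    have e : ∀ ε : ℝ, (fun p => ε⁻¹ * ρ (resOmega ζ k p / ε) * (4 * Real.pi * F p)) =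
        fun p => 4 * Real.pi * (ε⁻¹ * ρ (resOmega ζ k p / ε) * F p) := fun ε => by ext p; ring
    constructor
    · intro ε hε
      rw [e]
      exact (hC₁ k M F hF ρ h1 h2 h3 ν hν ε hε).1.const_mul _
    · refine ((tendsto_of_abs_sub_le hK (hcomp ρ h1 h2 h3) hZ₀).const_mul 4).congr fun ε => ?_
      rw [e, integral_const_mul, mul_assoc]
  have hK1 : K1 ζ (f₁ t) (f₂ t) (f₃ t) k = 4 * Z₀ := hdelta.deltaIntegral_eq
  have hS1i := integrable_exp_mul_cauchyKer_gammaMinus hζ hr hν hF1 0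
  have hS1e : S1Integrand ζ r ν f₁ f₂ f₃ k t = fun p =>
      (Complex.exp (Complex.I * (((0 : ℝ) * resOmega ζ k p : ℝ) : ℂ)) *
        cauchyKer (ν * gammaMinus ζ r k p) (resOmega ζ k p) * (F p : ℂ)).re :=
    funext fun p => S1Integrand_eq hζ hr hν f₁ f₂ f₃ k t p
  have hS1 : S1 ζ r ν f₁ f₂ f₃ k t = 4 * Z ν := by
    have h := integral_re hS1i
    simp only [RCLike.re_to_complex] at h
    rw [S1, hS1e, h]
  -- the second integral
  have hA : ∀ τ : ℝ, 0 < τ → TameAmplitude k (d + 1 + 2) (24 * M) fun p =>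
      (Real.exp (-(varrho ν lam * τ * gammaPlus ζ r k p)) : ℂ) * (F p : ℂ) := by
    intro τ hτ
    have := (quadMultiplier_exp_gammaPlus hζ hr (a := varrho ν lam * τ) (by positivity) k).mul hF4
    norm_num at this ⊢
    exact this
  have hS2e : ∀ τ, S2Integrand ζ r ν lam f₁ f₂ f₃ k t τ = fun p =>
      (Complex.exp (Complex.I * ((Tkin lam * τ * resOmega ζ k p : ℝ) : ℂ)) *
        cauchyKer (ν * gammaMinus ζ r k p) (resOmega ζ k p) *
          ((Real.exp (-(varrho ν lam * τ * gammaPlus ζ r k p)) : ℂ) * (F p : ℂ))).re := fun τ =>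
    funext fun p => S2Integrand_eq hν0 lam f₁ f₂ f₃ k t τ p
  have hS2i : ∀ τ : ℝ, 0 < τ → Integrable fun p =>
      Complex.exp (Complex.I * ((Tkin lam * τ * resOmega ζ k p : ℝ) : ℂ)) *
        cauchyKer (ν * gammaMinus ζ r k p) (resOmega ζ k p) *
          ((Real.exp (-(varrho ν lam * τ * gammaPlus ζ r k p)) : ℂ) * (F p : ℂ)) := fun τ hτ =>
    integrable_exp_mul_cauchyKer_gammaMinus hζ hr hν (hA τ hτ).of_add _
  have hS2 : ∀ τ : ℝ, 0 < τ → |S2 ζ r ν lam f₁ f₂ f₃ k t τ| ≤ 4 * ‖∫ p,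
      Complex.exp (Complex.I * ((Tkin lam * τ * resOmega ζ k p : ℝ) : ℂ)) *
        cauchyKer (ν * gammaMinus ζ r k p) (resOmega ζ k p) *
          ((Real.exp (-(varrho ν lam * τ * gammaPlus ζ r k p)) : ℂ) * (F p : ℂ))‖ := by
    intro τ hτ
    rw [S2, hS2e, abs_mul, abs_of_pos four_pos]
    gcongr
    exact abs_integral_re_le (hS2i τ hτ)
  have hlog := abs_nonneg (Real.log ν)
  refine ⟨?_, ?_, ?_, ?_, ?_, ?_⟩
  · rw [hS1e]
    exact hS1i.re
  · rw [hK1]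
    exact hdelta
  · rw [hS1, hK1, ← mul_sub, abs_mul, abs_of_pos four_pos]
    have h1 : C₁ * M * √ν ≤ C₁ * M * ν ^ (1 / 8 : ℝ) := by gcongr; exact sqrt_le_rpow hν
    have h2 := hZ₀ ν hν
    have h3 : 0 ≤ C₂ * (24 * M) * ν ^ (1 / 8 : ℝ) := by positivity
    have h4 : 0 ≤ C₃ * (24 * M) * ν ^ (1 / 8 : ℝ) := by positivity
    linarith
  · intro τ hτ
    rw [hS2e]
    exact (hS2i τ hτ).re
  · intro τ hτ
    have hτ0 : 0 < τ := lt_of_lt_of_le (by positivity) hτ.1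
    -- As `ϱ = ν T_kin`, the lower end of the range of `τ` is exactly the threshold `s = ν^(-7/8)`
    -- of the oscillatory bound.
    have hs : ν⁻¹ * ν ^ (1 / 8 : ℝ) ≤ Tkin lam * τ := by
      calc ν⁻¹ * ν ^ (1 / 8 : ℝ) = Tkin lam * ((varrho ν lam)⁻¹ * ν ^ (1 / 8 : ℝ)) := by
            unfold varrho; field_simp
        _ ≤ _ := by gcongr; exact hτ.1
    have h2 := (hS2 τ hτ0).trans (mul_le_mul_of_nonneg_left
      (hC₂ k _ _ (hA τ hτ0) ν hν _ (mul_pos hT hτ0) hs) four_pos.le)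
    have h3 : 0 ≤ C₁ * M * ν ^ (1 / 8 : ℝ) := by positivity
    have h4 : 0 ≤ C₃ * (24 * M) * ν ^ (1 / 8 : ℝ) := by positivity
    linarith
  · intro τ hτ
    have h2 := (hS2 τ hτ.1).trans (mul_le_mul_of_nonneg_left
      (hC₃ k _ _ (hA τ hτ.1) (Tkin lam * τ) ν hν) four_pos.le)
    have h3 : 0 ≤ C₁ * M * |Real.log ν| := by positivity
    have h4 : 0 ≤ C₂ * (24 * M) * |Real.log ν| := by positivity
    linarith
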